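/- Let $k$ be a field of characteristic different from $3$, let $d\ge 3$, and let $V=k^{d+2}$. Let $X,X'\subset\mathbb P(V)=\mathbb P^{d+1}_k$ be two cubic hypersurfaces (given by nonzero cubic forms over $k$) with isolated singularities, i.e. their singular loci over an algebraic closure $\bar k$ of $k$ are finite (possibly empty). Let $F$ and $F'$ be the Fano schemes of lines on $X$ and $X'$; they are closed subschemes of the Grassmannian of lines in $\mathbb P(V)$, and hence of $\mathbb P(\bigwedge^2V)$ via the Plücker embedding. Let $g:F\to F'$ be an isomorphism of $k$-schemes which is projective for the Plücker embeddings, i.e. $g$ is the restriction of the automorphism of $\mathbb P(\bigwedge^2V)$ given by some $k$-linear automorphism of $\bigwedge^2V$. Then there exists a projective isomorphism $f:X\to X'$, i.e. an isomorphism of $k$-schemes that is the restriction of the automorphism of $\mathbb P(V)$ given by some $k$-linear automorphism $a$ of $V$, such that $f$ induces $g$: for every $k$-algebra $A$ and every $A$-point $L$ of $F$, i.e. every rank two direct summand $L\subset A\otimes_k V$ defining a line on $X_A$, one has $g(L)=(\mathrm{id}_A\otimes a)(L)$. -/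

import Mathlib

open CategoryTheory TensorProduct

universe u

namespace CubicFano

/-- The standard vector space `k ^ n`; the projective space `ℙ(V)` is the space of lines in `V`. -/
abbrev V (k : Type u) [Field k] (n : ℕ) : Type u := Fin n → k

section Hypersurface

variable {k : Type u} [Field k] {n : ℕ}

/-- `f` is an equation of a cubic hypersurface in `ℙ(V k n)`: a nonzero homogeneous form of
degree `3`. -/
def IsCubicForm (f : MvPolynomial (Fin n) k) : Prop :=
  f ≠ 0 ∧ f.IsHomogeneous 3

/-- The geometric singular points of the hypersurface `f = 0`: the points of projective space over
the algebraic closure at which `f` and all its partial derivatives vanish (for homogeneous `f`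
this does not depend on the representative of the point). -/
def geometricSingularPoints (f : MvPolynomial (Fin n) k) :
    Set (Projectivization (AlgebraicClosure k) (Fin n → AlgebraicClosure k)) :=
  {p | MvPolynomial.aeval p.rep f = 0 ∧
    ∀ i, MvPolynomial.aeval p.rep (MvPolynomial.pderiv i f) = 0}

/-- The hypersurface `f = 0` has isolated singularities: its non-smooth locus, a closed subset of
projective space, has dimension at most zero, i.e. it has finitely many geometric points.
(The smooth case, with no singular points, is included.) -/
def HasIsolatedSingularities (f : MvPolynomial (Fin n) k) : Prop :=
  (geometricSingularPoints f).Finite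

/-- The value of the form `f` at an `A`-valued vector `x ∈ A ⊗ V = A ^ n`. -/
noncomputable def evalForm (f : MvPolynomial (Fin n) k) {A : Type u} [CommRing A] [Algebra k A]
    (x : A ⊗[k] V k n) : A :=
  MvPolynomial.aeval (TensorProduct.piScalarRight k k A (Fin n) x) f

/-- The scheme of linear subspaces of codimension `c` of `ℙ(V)` that are contained in the
hypersurface `f = 0`, given by its functor of points on `k`-algebras, as a subfunctor of the
Grassmannian functor. An `A`-point is a submodule `L` of `A ⊗ V` with `(A ⊗ V) / L` locally free
of rank `c` such that `f` vanishes identically on `L`, i.e. on all vectors of `L` and of all its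
base changes. -/
noncomputable def linearSubspaces (f : MvPolynomial (Fin n) k) (c : ℕ) :
    Subfunctor (Module.Grassmannian.functor.{u, u, u} (R := k) (M := V k n) c) where
  obj A := {L | ∀ (B : CommAlgCat.{u} k) (φ : A ⟶ B),
    ∀ x ∈ ((Module.Grassmannian.functor.{u, u, u} (R := k) (M := V k n) c).map φ L).toSubmodule,
      evalForm f x = 0}
  map {A B} φ L hL C ψ := by
    have h := hL C (φ ≫ ψ)
    rw [Functor.map_comp] at h
    exact h

end Hypersurface

section Schemes

variable {k : Type u} [Field k] {d : ℕ}

/-- The `d`-dimensional hypersurface `X = {f = 0}` in `ℙ(V) = ℙ ^ (d + 1)`, as a functor of points: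
the points of `X` are the rank one summands of `V` on which `f` vanishes. -/
noncomputable abbrev hypersurface (f : MvPolynomial (Fin (d + 2)) k) :
    CommAlgCat.{u} k ⥤ Type u :=
  (linearSubspaces f (d + 1)).toFunctor

/-- The Fano variety (scheme) of lines on the hypersurface `X = {f = 0}` in `ℙ ^ (d + 1)`, as a
functor of points: its points are the rank two summands of `V` on which `f` vanishes. -/
noncomputable abbrev fanoOfLines (f : MvPolynomial (Fin (d + 2)) k) :
    CommAlgCat.{u} k ⥤ Type u :=
  (linearSubspaces f d).toFunctor

end Schemes

section Pluecker

variable {k : Type u} [Field k] {n : ℕ}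

/-- The bilinear map `(v, w) ↦ v ∧ w` from `V` to its exterior square. -/
noncomputable def wedge (k : Type u) [Field k] (n : ℕ) :
    LinearMap.BilinMap k (V k n) (⋀[k]^2 (V k n)) :=
  LinearMap.mk₂ k (fun v w => exteriorPower.ιMulti k 2 ![v, w])
    (fun v v' w => Subtype.ext (by simp [ExteriorAlgebra.ιMulti_apply, add_mul]))
    (fun c v w => Subtype.ext (by simp [ExteriorAlgebra.ιMulti_apply]))
    (fun v w w' => Subtype.ext (by simp [ExteriorAlgebra.ιMulti_apply, mul_add]))
    (fun c v w => Subtype.ext (by simp [ExteriorAlgebra.ιMulti_apply]))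

/-- The Plücker embedding on `A`-points: a rank two summand `L` of `A ⊗ V` is sent to the rank one
summand `⋀² L` of `A ⊗ ⋀² V`, i.e. to the submodule generated by all `x ∧ y` with `x, y ∈ L`. -/
noncomputable def pluecker {A : Type u} [CommRing A] [Algebra k A]
    (L : Submodule A (A ⊗[k] V k n)) : Submodule A (A ⊗[k] (⋀[k]^2 (V k n))) :=
  Submodule.map₂ ((wedge k n).baseChange A) L L

end Pluecker

section Isomorphisms

variable {k : Type u} [Field k] {n c : ℕ} {f f' : MvPolynomial (Fin n) k}

/-- The isomorphism `g` between schemes of linear subspaces is induced by the projective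
isomorphism of `ℙ(V)` given by `a`: the subspace `L` is sent to its image under `a`. -/
def IsInducedBy (g : (linearSubspaces f c).toFunctor ≅ (linearSubspaces f' c).toFunctor)
    (a : V k n ≃ₗ[k] V k n) : Prop :=
  ∀ (A : CommAlgCat.{u} k) (L : (linearSubspaces f c).toFunctor.obj A),
    (g.hom.app A L).1.toSubmodule = L.1.toSubmodule.map (a.toLinearMap.baseChange A)

/-- The isomorphism `g` is projective for the Plücker embedding: it is the restriction of the
automorphism of `ℙ(⋀² V)` given by some linear automorphism `b` of `⋀² V`. (Used for the scheme
of lines.) -/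
def IsPlueckerProjective
    (g : (linearSubspaces f c).toFunctor ≅ (linearSubspaces f' c).toFunctor) : Prop :=
  ∃ b : (⋀[k]^2 (V k n)) ≃ₗ[k] (⋀[k]^2 (V k n)),
    ∀ (A : CommAlgCat.{u} k) (L : (linearSubspaces f c).toFunctor.obj A),
      pluecker (g.hom.app A L).1.toSubmodule =
        (pluecker L.1.toSubmodule).map (b.toLinearMap.baseChange A)

end Isomorphisms

end CubicFano

/-!
Let `n = d + 2`, let `K` be an algebraic closure of `k`, and let `F` be the form `f` over `K`. In
the ring `K[v, w]` of pairs of vectors of `K ^ n`, let `I` be the ideal of the four coefficients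
`lineEqs F` of the restriction of `F` to the line through `v` and `w`. Everything rests on the
question which polynomials `Q` in the pair `(v, w)` vanish on the scheme of lines of `X`.

*Polynomials vanishing on all lines lie in `I` near the origin.* The subscheme `I = 0` has
codimension four: where the line misses the singular points, a rank computation for the Jacobian
matrix (`exists_singular_of_jacobian`) gives this, and the pairs whose line meets one of the
finitely many singular points, or which are linearly dependent, form a set of dimension at most
`n + 1 ≤ 2 * n - 4`. So `I` is a complete intersection at the origin, hence unmixed
(`exists_mul_mem_of_forall_prime`). As the dependent pairs have dimension at most `n < 2 * n - 4`,
membership in `I` near the origin can be tested at primes where the pair is independent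
(`exists_mul_mem_span_lineEqs`). Over the local ring of `K[v, w] / I` at such a prime, the universal
pair spans a local point of the scheme of lines. Since schemes of lines may be nonreduced, points
over fields would not suffice here.

*The map `b` preserves decomposable bivectors.* For each quadratic Plücker relation `q`, the
polynomial `Q = q (b (v ∧ w))` vanishes on all lines, because the lines of `X` go to lines. It has
bidegree `(2, 2)`, so by homogeneity `Q = α(w) ∂_w F(v) + β(v) ∂_v F(w)` with linear forms `α` and
`β`. As `Q` only depends on `v ∧ w`, and `3` is invertible, `β = -α` and
`3 α(w) F(v) = α(v) ∂_w F(v)`. If `α` were nonzero, `F` would be singular along a quadric in the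
hyperplane `α = 0`. So `Q = 0` (`aeval_eq_zero_of_mul_mem`). By Chow's theorem
(`exists_linearEquiv_of_isDecomposable`) `b` is a multiple of the exterior square of some `a`.

*The map `a` induces both isomorphisms.* The Plücker embedding is injective on local points, so `a`
induces `g` on these, and thus on all points, since equality of points of a Grassmannian can be
tested at localizations (`isInducedBy_of_isLocalRing`). Finally `f'(a v)` vanishes on all lines
of `X`, so it lies in `I` near the origin; by homogeneity it is a multiple of `f`
(`exists_pullback_eq`), and `a` maps `X` to `X'`.
-/

namespace CubicFano

/-! ### Depth and associated primes over local rings -/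

section Depth

open RingTheory.Sequence IsLocalRing Pointwise

variable {S : Type u} [CommRing S] [IsLocalRing S] [IsNoetherianRing S]

/-- If `x ∈ 𝔪` is regular on `M`, every associated prime of `M` is contained in an associated prime
of `M / xM` that also contains `x`. -/
lemma exists_isAssociatedPrime_quotSMulTop {M : Type u} [AddCommGroup M] [Module S M]
    [Module.Finite S M] {x : S} (hx : x ∈ maximalIdeal S) (hreg : IsSMulRegular M x)
    {p : Ideal S} (hp : IsAssociatedPrime p M) :
    ∃ q : Ideal S, IsAssociatedPrime q (QuotSMulTop x M) ∧ p ≤ q ∧ x ∈ q := by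
  obtain ⟨hpp, z, hz⟩ := isAssociatedPrime_iff.mp hp
  -- `U` is the submodule of `M` killed by `p`; it is nonzero, so `U ≠ xU` by Nakayama
  let U : Submodule S M := Submodule.torsionBySet S M p
  have hzU : z ∈ U := by
    rw [Submodule.mem_torsionBySet_iff]
    rintro ⟨a, ha⟩
    have : a ∈ Submodule.colon (⊥ : Submodule S M) {z} := hz ▸ ha
    simpa [Submodule.mem_colon_singleton] using this
  have hz0 : z ≠ 0 := by
    rintro rfl
    apply hpp.ne_top
    rw [hz]
    ext r
    simp [Submodule.mem_colon_singleton]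
  have hU : ∃ u ∈ U, u ∉ x • (⊤ : Submodule S M) := by
    by_contra! hcon
    have hle : U ≤ maximalIdeal S • U := by
      intro u hu
      obtain ⟨y, -, hy⟩ := Submodule.mem_smul_pointwise_iff_exists _ _ _ |>.mp (hcon u hu)
      have hyU : y ∈ U := by
        rw [Submodule.mem_torsionBySet_iff] at hu ⊢
        rintro ⟨a, ha⟩
        apply hreg
        have := hu ⟨a, ha⟩
        simp only [← hy] at this
        simp only [smul_zero]
        rw [smul_comm]
        exact this
      rw [← hy]
      exact Submodule.smul_mem_smul hx hyU
    have := Submodule.eq_bot_of_le_smul_of_le_jacobson_bot (maximalIdeal S) U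
      (IsNoetherian.noetherian U) hle (IsLocalRing.maximalIdeal_le_jacobson _)
    rw [this] at hzU
    exact hz0 (by simpa using hzU)
  obtain ⟨u, huU, hu⟩ := hU
  let m : QuotSMulTop x M := Submodule.Quotient.mk u
  have hm : m ≠ 0 := by
    simpa [m, Submodule.Quotient.mk_eq_zero] using! hu
  obtain ⟨q, hq, hle⟩ := exists_le_isAssociatedPrime_of_isNoetherianRing S m hm
  refine ⟨q, hq, fun a ha => hle ?_, hle ?_⟩
  · rw [Submodule.mem_colon_singleton]
    have h1 : a • u = 0 := (Submodule.mem_torsionBySet_iff _ _).mp huU ⟨a, ha⟩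
    change a • Submodule.Quotient.mk u = (0 : QuotSMulTop x M)
    rw [← Submodule.Quotient.mk_smul, h1]
    rfl
  · rw [Submodule.mem_colon_singleton]
    change x • Submodule.Quotient.mk u = (0 : QuotSMulTop x M)
    rw [← Submodule.Quotient.mk_smul, Submodule.Quotient.mk_eq_zero]
    exact Submodule.smul_mem_pointwise_smul _ _ _ trivial

/-- The depth of a module is at most the dimension of each of its associated primes. -/
lemma length_le_ringKrullDim_of_isAssociatedPrime {rs : List S} :
    ∀ {M : Type u} [AddCommGroup M] [Module S M] [Module.Finite S M],
    (∀ r ∈ rs, r ∈ maximalIdeal S) → IsRegular M rs → ∀ {p : Ideal S}, IsAssociatedPrime p M →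
    (rs.length : WithBot ℕ∞) ≤ ringKrullDim (S ⧸ p) := by
  induction rs with
  | nil =>
    intro M _ _ _ _ _ p hp
    have := hp.1
    simpa using ringKrullDim_nonneg_of_nontrivial
  | cons x rs ih =>
    intro M _ _ _ hmem hreg p hp
    rw [isRegular_cons_iff] at hreg
    obtain ⟨q, hq, hpq, hxq⟩ :=
      exists_isAssociatedPrime_quotSMulTop (hmem x (by simp)) hreg.1 hp
    have h1 := ih (fun r hr => hmem r (by simp [hr])) hreg.2 hq
    have hxp : x ∉ p := fun h => by
      have : x ∈ ⋃ p ∈ associatedPrimes S M, (p : Set S) := Set.mem_biUnion hp h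
      rw [biUnion_associatedPrimes_eq_compl_regular] at this
      exact this hreg.1
    have := hp.1
    have := hq.1
    have h2 : ringKrullDim (S ⧸ q) + 1 ≤ ringKrullDim (S ⧸ p) := by
      refine ringKrullDim_succ_le_of_surjective (Ideal.Quotient.factor hpq)
        (Ideal.Quotient.factor_surjective hpq) (r := Ideal.Quotient.mk p x) ?_ ?_
      · rw [mem_nonZeroDivisors_iff_ne_zero]
        rwa [Ne, Ideal.Quotient.eq_zero_iff_mem]
      · simpa [Ideal.Quotient.eq_zero_iff_mem] using hxq
    refine le_trans ?_ h2
    rw [List.length_cons]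
    push_cast
    gcongr

/-- `M` has depth at least `t`, expressed by the existence of a regular sequence of length `t`. -/
def HasDepthGE (S : Type u) [CommRing S] [IsLocalRing S] (M : Type u) [AddCommGroup M] [Module S M]
    (t : ℕ) : Prop :=
  ∃ rs : List S, rs.length = t ∧ (∀ r ∈ rs, r ∈ maximalIdeal S) ∧ IsRegular M rs

omit [IsNoetherianRing S] in
lemma smul_top_lt_top (M : Type u) [AddCommGroup M] [Module S M] [Module.Finite S M]
    [Nontrivial M] : maximalIdeal S • (⊤ : Submodule S M) < ⊤ := by
  rw [lt_top_iff_ne_top]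
  intro h
  have := Submodule.eq_bot_of_le_smul_of_le_jacobson_bot (maximalIdeal S) (⊤ : Submodule S M)
    Module.Finite.fg_top h.ge (IsLocalRing.maximalIdeal_le_jacobson _)
  exact top_ne_bot this

open Abelian ModuleCat in
/-- Depth drops by at most one on dividing by any regular element, not only by a member of
a chosen regular sequence: this is Rees' characterization of depth by `Ext`. -/
lemma HasDepthGE.quotSMulTop {M : Type u} [AddCommGroup M] [Module S M] [Module.Finite S M]
    {t : ℕ} (h : HasDepthGE S M (t + 1)) {x : S} (hx : x ∈ maximalIdeal S)
    (hreg : IsSMulRegular M x) : HasDepthGE S (QuotSMulTop x M) t := by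
  obtain ⟨rs, hlen, hmem, hrs⟩ := h
  have : Nontrivial M := hrs.nontrivial
  have : Nontrivial (QuotSMulTop x M) := nontrivial_quotSMulTop_of_mem_maximalIdeal M hx
  have e1 : ∀ i < t + 1, Subsingleton (Ext
      (ModuleCat.of S (Shrink.{u} (S ⧸ maximalIdeal S))) (ModuleCat.of S M) i) :=
    ((exists_isRegular_tfae (maximalIdeal S) (t + 1) (ModuleCat.of S M)
    (smul_top_lt_top M)).out 1 3 rfl rfl).mpr ⟨rs, hlen, hmem, hrs⟩
  refine ((exists_isRegular_tfae (maximalIdeal S) t (ModuleCat.of S (QuotSMulTop x M))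
    (smul_top_lt_top (QuotSMulTop x M))).out 1 3).mp ?_
  intro i hi
  have zero1 := AddCommGrpCat.isZero_of_iff_subsingleton.mpr (e1 i (by omega))
  have zero2 := AddCommGrpCat.isZero_of_iff_subsingleton.mpr (e1 (i + 1) (by omega))
  exact AddCommGrpCat.subsingleton_of_isZero <| ShortComplex.Exact.isZero_of_both_zeros
    ((Ext.covariant_sequence_exact₃' _
      (IsSMulRegular.smulShortComplex_shortExact (M := ModuleCat.of S M) hreg)) i (i + 1) rfl)
    (zero1.eq_zero_of_src _) (zero2.eq_zero_of_tgt _)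

/-- Dividing a Noetherian local ring by one more element lowers the dimension by at most one. -/
lemma ringKrullDim_quotient_le_sup_span_singleton (J : Ideal S) {x : S}
    (hx : x ∈ maximalIdeal S) :
    ringKrullDim (S ⧸ J) ≤ ringKrullDim (S ⧸ (J ⊔ Ideal.span {x})) + 1 := by
  by_cases hJ : J = ⊤
  · subst hJ
    have : Subsingleton (S ⧸ (⊤ : Ideal S)) := Ideal.Quotient.subsingleton_iff.mpr rfl
    simp [ringKrullDim_eq_bot_of_subsingleton]
  have : Nontrivial (S ⧸ J) := Ideal.Quotient.nontrivial_iff.mpr hJ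
  have : IsLocalRing (S ⧸ J) := IsLocalRing.of_surjective' _ Ideal.Quotient.mk_surjective
  have : IsLocalHom (Ideal.Quotient.mk J) := IsLocalHom.of_surjective _ Ideal.Quotient.mk_surjective
  have hmem : Ideal.Quotient.mk J x ∈ maximalIdeal (S ⧸ J) := map_nonunit _ x hx
  have h := ringKrullDim_le_ringKrullDim_quotient_add_card (R := S ⧸ J) {Ideal.Quotient.mk J x} (by
    simpa [IsLocalRing.ringJacobson_eq_maximalIdeal] using hmem)
  refine h.trans (le_of_eq ?_)
  have e : ((S ⧸ J) ⧸ Ideal.span (({Ideal.Quotient.mk J x} : Finset (S ⧸ J)) : Set (S ⧸ J))) ≃+*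
      S ⧸ (J ⊔ Ideal.span {x}) :=
    (Ideal.quotEquivOfEq (by simp [Ideal.map_span])).trans
      (DoubleQuot.quotQuotEquivQuotSup J (Ideal.span {x}))
  rw [ringKrullDim_eq_of_ringEquiv e]
  simp

lemma ringKrullDim_quotient_le_add_length {rs : List S} (hrs : ∀ r ∈ rs, r ∈ maximalIdeal S) :
    ∀ J : Ideal S,
      ringKrullDim (S ⧸ J) ≤ ringKrullDim (S ⧸ (J ⊔ Ideal.ofList rs)) + rs.length := by
  induction rs with
  | nil =>
    intro J
    rw [Ideal.ofList_nil, sup_bot_eq]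
    simp
  | cons x rs ih =>
    intro J
    refine (ringKrullDim_quotient_le_sup_span_singleton J (hrs x (by simp))).trans ?_
    have := ih (fun r hr => hrs r (by simp [hr])) (J ⊔ Ideal.span {x})
    rw [sup_assoc, ← Ideal.ofList_cons] at this
    rw [List.length_cons]
    push_cast
    rw [← add_assoc]
    gcongr

/-- A sequence of elements that cuts the dimension down as far as it can is regular on a module of
full depth, and the quotient has the complementary depth: modules over a Cohen–Macaulay local ring
in the form needed here. -/
lemma HasDepthGE.quotient_ofList {t : ℕ} {fs : List S} (hfs : ∀ r ∈ fs, r ∈ maximalIdeal S) :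
    ∀ {M : Type u} [AddCommGroup M] [Module S M] [Module.Finite S M],
    HasDepthGE S M (t + fs.length) →
    ringKrullDim (S ⧸ (Module.annihilator S M ⊔ Ideal.ofList fs)) ≤ t →
    HasDepthGE S (M ⧸ (Ideal.ofList fs • ⊤ : Submodule S M)) t := by
  induction fs with
  | nil =>
    intro M _ _ _ ⟨rs, hlen, hmem, hrs⟩ _
    refine ⟨rs, by simpa using hlen, hmem, ?_⟩
    have := (Submodule.quotEquivOfEqBot (Ideal.ofList ([] : List S) • ⊤ : Submodule S M) (by simp))
    exact (this.isRegular_congr rs).mpr hrs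
  | cons x fs ih =>
    intro M _ _ _ hM hdim
    have hx : x ∈ maximalIdeal S := hfs x (by simp)
    have hfs' : ∀ r ∈ fs, r ∈ maximalIdeal S := fun r hr => hfs r (by simp [hr])
    -- a zero divisor `x` lies in an associated prime `p`; the remaining elements cannot cut the
    -- dimension of `S ⧸ p`, which is at least the depth of `M`, down to `t`
    have hreg : IsSMulRegular M x := by
      by_contra hcon
      have : x ∈ ⋃ p ∈ associatedPrimes S M, (p : Set S) := by
        rw [biUnion_associatedPrimes_eq_compl_regular]
        exact hcon
      obtain ⟨p, hp, hxp⟩ := Set.mem_iUnion₂.mp this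
      obtain ⟨rs, hlen, hmem, hrs⟩ := hM
      have h1 := length_le_ringKrullDim_of_isAssociatedPrime hmem hrs hp
      have h2 := ringKrullDim_quotient_le_add_length hfs' p
      have hle : Module.annihilator S M ⊔ Ideal.ofList (x :: fs) ≤ p ⊔ Ideal.ofList fs := by
        rw [Ideal.ofList_cons, ← sup_assoc]
        refine sup_le_sup_right (sup_le ?_ ?_) _
        · exact Submodule.annihilator_top (R := S) (M := M) ▸ IsAssociatedPrime.annihilator_le hp
        · rwa [Ideal.span_singleton_le_iff_mem]
      have h3 : ringKrullDim (S ⧸ (p ⊔ Ideal.ofList fs)) ≤ t :=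
        (ringKrullDim_le_of_surjective (Ideal.Quotient.factor hle)
          (Ideal.Quotient.factor_surjective hle)).trans hdim
      have h4 : (rs.length : WithBot ℕ∞) ≤ t + fs.length :=
        h1.trans (h2.trans (by gcongr))
      rw [hlen] at h4
      simp only [List.length_cons] at h4
      have : t + (fs.length + 1) ≤ t + fs.length := by exact_mod_cast h4
      omega
    have e := Submodule.quotOfListConsSMulTopEquivQuotSMulTopInner M x fs
    have hM' : HasDepthGE S M ((t + fs.length) + 1) := by simpa [add_assoc] using hM
    obtain ⟨rs, hlen, hmem, hrs⟩ := ih hfs' (hM'.quotSMulTop hx hreg) (by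
      have hle : Module.annihilator S M ⊔ Ideal.ofList (x :: fs) ≤
          Module.annihilator S (QuotSMulTop x M) ⊔ Ideal.ofList fs := by
        rw [Ideal.ofList_cons, ← sup_assoc]
        refine sup_le_sup_right (sup_le ?_ ?_) _
        · exact LinearMap.annihilator_le_of_surjective _ (Submodule.mkQ_surjective _)
        · rw [Ideal.span_singleton_le_iff_mem, Module.mem_annihilator]
          intro m
          obtain ⟨m, rfl⟩ := Submodule.Quotient.mk_surjective _ m
          rw [← Submodule.Quotient.mk_smul, Submodule.Quotient.mk_eq_zero]
          exact Submodule.smul_mem_pointwise_smul _ _ _ trivial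
      exact (ringKrullDim_le_of_surjective (Ideal.Quotient.factor hle)
          (Ideal.Quotient.factor_surjective hle)).trans hdim)
    exact ⟨rs, hlen, hmem, (e.isRegular_congr rs).mpr hrs⟩

end Depth

/-! ### Transcendence degree -/

section Trdeg

open Cardinal

/-- A proper specialization of affine domains lowers the transcendence degree. -/
lemma trdeg_lt_of_surjective {K A B : Type u} [Field K] [CommRing A] [IsDomain A] [CommRing B]
    [IsDomain B] [Algebra K A] [Algebra K B] [Algebra.FiniteType K A] [Algebra.FiniteType K B]
    (φ : A →ₐ[K] B) (hφ : Function.Surjective φ) (hφ' : ¬ Function.Injective φ) :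
    Algebra.trdeg K B < Algebra.trdeg K A := by
  by_contra! hle
  obtain ⟨b, hb⟩ := exists_isTranscendenceBasis K B
  choose y hy using fun i : b => hφ i
  have hcomp : φ ∘ y = ((↑) : b → B) := funext hy
  have hyi : AlgebraicIndependent K y := AlgebraicIndependent.of_comp φ (hcomp ▸ hb.1)
  have hbas : IsTranscendenceBasis K y := hyi.isTranscendenceBasis_of_trdeg_le
    trdeg_lt_aleph0_of_finiteType (by rwa [hb.cardinalMk_eq_trdeg])
  obtain ⟨a, ha, ha0⟩ : ∃ a, φ a = 0 ∧ a ≠ 0 := by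
    by_contra! h
    exact hφ' ((injective_iff_map_eq_zero φ).mpr h)
  have halg : Algebra.IsAlgebraic (Algebra.adjoin K (Set.range y)) A := hbas.isAlgebraic
  obtain ⟨r, hr0, hdvd⟩ := (halg.isAlgebraic a).exists_nonzero_dvd
    (mem_nonZeroDivisors_of_ne_zero ha0)
  have hr : φ r = 0 := by
    obtain ⟨c, hc⟩ := hdvd
    have : (r : A) = a * c := hc
    rw [this, map_mul, ha, zero_mul]
  obtain ⟨P, hP⟩ : ∃ P : MvPolynomial b K, MvPolynomial.aeval y P = (r : A) := by
    exact (Algebra.adjoin_range_eq_range_aeval K y).le r.2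
  have h0 : MvPolynomial.aeval ((↑) : b → B) P = 0 := by
    rw [← hcomp, ← hr, ← hP, MvPolynomial.comp_aeval_apply]
    rfl
  have hP0 : P = 0 := (injective_iff_map_eq_zero _).mp hb.1 P h0
  apply hr0
  ext
  rw [← hP, hP0, map_zero]
  rfl

open scoped IntermediateField.algebraAdjoinAdjoin in
/-- If finitely many elements are algebraic over a subfield generated by a set `s`, and generate the
field, then the transcendence degree is at most the size of `s`. -/
lemma trdeg_le_card_of_isAlgebraic {K L : Type u} [Field K] [Field L] [Algebra K L] {ι : Type*}
    (x : ι → L) (hx : IntermediateField.adjoin K (Set.range x) = ⊤) (s : Finset L)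
    (h : ∀ i, IsAlgebraic (IntermediateField.adjoin K (s : Set L)) (x i)) :
    Algebra.trdeg K L ≤ s.card := by
  set E := IntermediateField.adjoin K (s : Set L)
  have h1 : Algebra.IsAlgebraic E L := by
    have h2 : IntermediateField.adjoin K (Set.range x) ≤
        (algebraicClosure E L).restrictScalars K := by
      rw [IntermediateField.adjoin_le_iff]
      rintro _ ⟨i, rfl⟩
      exact mem_algebraicClosure_iff.mpr (h i)
    refine ⟨fun a => ?_⟩
    have : a ∈ (algebraicClosure E L).restrictScalars K := h2 (hx ▸ trivial)
    exact mem_algebraicClosure_iff.mp this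
  have : Algebra.IsAlgebraic (Algebra.adjoin K (s : Set L)) L :=
    (IsFractionRing.comap_isAlgebraic_iff (A := Algebra.adjoin K (s : Set L)) (K := E)
      (C := L)).mpr h1
  simpa using Algebra.IsAlgebraic.trdeg_le_cardinalMk K (s : Set L)

/-- The Jacobian criterion bounds the dimension from above, in any characteristic: a generic point
at which polynomials indexed by `κ` vanish with a nonzero maximal Jacobian minor has transcendence
degree at most the number of variables minus `|κ|`. -/
lemma trdeg_add_card_le_of_jacobian {K L : Type u} [Field K] [Field L] [Algebra K L]
    {ι κ : Type} [Fintype ι] [DecidableEq ι] [Fintype κ] [DecidableEq κ] (x : ι → L)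
    (hx : IntermediateField.adjoin K (Set.range x) = ⊤) (f : κ → MvPolynomial ι K)
    (hf : ∀ j, MvPolynomial.aeval x (f j) = 0) (e : κ → ι)
    (hdet : (Matrix.of fun j i => MvPolynomial.aeval x (MvPolynomial.pderiv (e i) (f j))).det ≠ 0) :
    ∃ c : ℕ, Algebra.trdeg K L ≤ c ∧ c + Fintype.card κ ≤ Fintype.card ι := by
  classical
  have he : Function.Injective e := by
    intro a b hab
    by_contra hne
    refine hdet (Matrix.det_zero_of_column_eq hne fun j => ?_)
    simp [hab]
  let T : Finset ι := (Finset.univ.image e)ᶜ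
  let s : Finset L := T.image x
  refine ⟨T.card, ?_, ?_⟩
  swap
  · rw [← Finset.card_univ (α := κ), ← Finset.card_image_of_injective _ he,
      Finset.card_compl_add_card]
  -- over the field `E` of the remaining coordinates, the invertible minor kills all differentials,
  -- so `L / E` is unramified and therefore algebraic
  set E := IntermediateField.adjoin K (s : Set L) with hE
  have hdD : ∀ (g : MvPolynomial ι K),
      KaehlerDifferential.D E L (MvPolynomial.aeval x g) =
        ∑ i, MvPolynomial.aeval x (MvPolynomial.pderiv i g) • KaehlerDifferential.D E L (x i) := by
    intro g
    induction g using MvPolynomial.induction_on with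
    | C a =>
      have : MvPolynomial.aeval x (MvPolynomial.C a) = algebraMap E L (algebraMap K E a) := by
        rw [MvPolynomial.aeval_C]; rfl
      rw [this, Derivation.map_algebraMap]
      simp
    | add p q hp hq => simp [hp, hq, add_smul, Finset.sum_add_distrib]
    | mul_X p i hp =>
      simp only [map_mul, MvPolynomial.aeval_X, Derivation.leibniz, hp, MvPolynomial.pderiv_X,
        smul_eq_mul, map_add, add_smul, Finset.sum_add_distrib, Finset.smul_sum, smul_smul]
      congr 1
      rw [Finset.sum_eq_single i]
      · simp
      · intro j _ hj; simp [hj.symm]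
      · simp
  have hT : ∀ i ∈ T, KaehlerDifferential.D E L (x i) = 0 := by
    intro i hi
    have : x i ∈ E := IntermediateField.subset_adjoin _ _ (by
      simpa [s] using ⟨i, hi, rfl⟩)
    exact (KaehlerDifferential.D E L).map_algebraMap (⟨x i, this⟩ : E)
  set M : Matrix κ κ L :=
    Matrix.of fun j i => MvPolynomial.aeval x (MvPolynomial.pderiv (e i) (f j))
  have hM : ∀ j, ∑ i, M j i • KaehlerDifferential.D E L (x (e i)) = 0 := by
    intro j
    have h1 := hdD (f j)
    rw [hf j, map_zero, ← Finset.sum_compl_add_sum (Finset.univ.image e),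
      Finset.sum_image (fun a _ b _ h => he h), Finset.sum_eq_zero, zero_add] at h1
    · exact h1.symm
    · intro i hi
      rw [hT i hi, smul_zero]
  have hDe : ∀ i, KaehlerDifferential.D E L (x (e i)) = 0 := by
    intro i
    have hinv : M⁻¹ * M = 1 := Matrix.nonsing_inv_mul _ (isUnit_iff_ne_zero.mpr hdet)
    have h2 : ∑ j, M⁻¹ i j • ∑ l, M j l • KaehlerDifferential.D E L (x (e l)) = 0 := by
      simp [hM]
    simp only [Finset.smul_sum, smul_smul] at h2
    rw [Finset.sum_comm] at h2
    simp only [← Finset.sum_smul, ← Matrix.mul_apply, hinv] at h2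
    rw [Finset.sum_eq_single i] at h2
    · simpa using h2
    · intro j _ hj; simp [hj.symm]
    · simp
  have hD : ∀ i, KaehlerDifferential.D E L (x i) = 0 := by
    intro i
    by_cases hi : i ∈ T
    · exact hT i hi
    · simp only [T, Finset.mem_compl, Finset.mem_image, Finset.mem_univ, true_and, not_not] at hi
      obtain ⟨j, rfl⟩ := hi
      exact hDe j
  have htop : IntermediateField.adjoin E (Set.range x) = ⊤ := by
    rw [← IntermediateField.restrictScalars_eq_top_iff (K := K), eq_top_iff, ← hx,
      IntermediateField.adjoin_le_iff]
    exact IntermediateField.subset_adjoin E (Set.range x)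
  have hD0 : ∀ a : L, KaehlerDifferential.D E L a = 0 := by
    intro a
    have ha : a ∈ IntermediateField.adjoin E (Set.range x) := htop ▸ trivial
    induction ha using IntermediateField.adjoin_induction with
    | mem b hb => obtain ⟨i, rfl⟩ := hb; exact hD i
    | algebraMap b => exact (KaehlerDifferential.D E L).map_algebraMap b
    | add a b _ _ ha hb => simp [ha, hb]
    | inv a _ ha => simp [Derivation.leibniz_inv, ha]
    | mul a b _ _ ha hb => simp [ha, hb]
  have hU : Algebra.FormallyUnramified E L := by
    constructor
    rw [← Submodule.subsingleton_iff L, ← subsingleton_iff_bot_eq_top,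
      ← KaehlerDifferential.span_range_derivation, eq_comm, Submodule.span_eq_bot]
    rintro _ ⟨a, rfl⟩
    exact hD0 a
  have hfin : Algebra.EssFiniteType E L := by
    rw [← IntermediateField.fg_top_iff, ← htop]
    exact IntermediateField.fg_adjoin_of_finite (Set.finite_range x)
  have hsep := Algebra.FormallyUnramified.isSeparable E L
  refine (trdeg_le_card_of_isAlgebraic x hx s fun i => ?_).trans ?_
  · exact Algebra.IsAlgebraic.isAlgebraic _
  · exact_mod_cast Finset.card_image_le

end Trdeg

/-! ### Dimensions of primes in polynomial rings -/

section Dimension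

variable {K : Type u} [Field K] {σ : Type} [Finite σ]

/-- The dimension of an irreducible closed subset of affine space, as the transcendence degree of
its function ring. -/
noncomputable def primeDim (p : Ideal (MvPolynomial σ K)) : ℕ :=
  Cardinal.toNat (Algebra.trdeg K (MvPolynomial σ K ⧸ p))

lemma primeDim_lt {p q : Ideal (MvPolynomial σ K)} [p.IsPrime] [q.IsPrime] (h : p < q) :
    primeDim q < primeDim p := by
  refine Cardinal.toNat_lt_toNat ?_ trdeg_lt_aleph0_of_finiteType
  refine trdeg_lt_of_surjective (Ideal.Quotient.factorₐ K h.le)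
    (Ideal.Quotient.factor_surjective h.le) fun hinj => ?_
  obtain ⟨a, haq, hap⟩ := Set.exists_of_ssubset h
  apply hap
  have : Ideal.Quotient.factorₐ K h.le (Ideal.Quotient.mk p a) = 0 := by
    simpa [Ideal.Quotient.eq_zero_iff_mem] using haq
  exact Ideal.Quotient.eq_zero_iff_mem.mp ((map_eq_zero_iff _ hinj).mp this)

/-- The Krull dimension of a quotient of a localization of a polynomial ring is bounded by the
transcendence degrees at the primes it contains. -/
lemma ringKrullDim_quotient_le_of_primeDim_le {S : Type u} [CommRing S]
    [Algebra (MvPolynomial σ K) S] (m : Submonoid (MvPolynomial σ K)) [IsLocalization m S]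
    (J : Ideal S) (c : ℕ)
    (h : ∀ q : Ideal S, q.IsPrime → J ≤ q →
      primeDim (q.comap (algebraMap (MvPolynomial σ K) S)) ≤ c) :
    ringKrullDim (S ⧸ J) ≤ c := by
  rw [ringKrullDim_quotient]
  let f : PrimeSpectrum.zeroLocus (J : Set S) → (Fin (c + 1))ᵒᵈ := fun q =>
    OrderDual.toDual ⟨primeDim (q.1.asIdeal.comap (algebraMap (MvPolynomial σ K) S)),
      Nat.lt_succ_of_le (h _ q.1.2 q.2)⟩
  have hf : StrictMono f := by
    intro q q' hqq
    rw [← OrderDual.ofDual_lt_ofDual]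
    change primeDim _ < primeDim _
    have := q.1.2
    have := q'.1.2
    refine primeDim_lt ?_
    have := (IsLocalization.orderEmbedding m S).strictMono
      (show q.1.asIdeal < q'.1.asIdeal from hqq)
    exact this
  refine (Order.krullDim_le_of_strictMono f hf).trans ?_
  refine iSup_le fun p => ?_
  have := p.length_lt_card
  simp only [Fintype.card_orderDual, Fintype.card_fin] at this
  exact_mod_cast Nat.le_of_lt_succ this

end Dimension

/-! ### Unmixedness of complete intersections -/

section Unmixed

open RingTheory.Sequence IsLocalRing MvPolynomial

variable {K : Type u} [Field K] {σ : Type} [Fintype σ]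

omit [Fintype σ] in
lemma isWeaklyRegular_map_X {l : List σ} (hl : l.Nodup) :
    IsWeaklyRegular (MvPolynomial σ K) (l.map (X : σ → MvPolynomial σ K)) := by
  classical
  refine ⟨fun i hi => ?_⟩
  rw [isSMulRegular_quotient_iff_mem_of_smul_mem]
  intro g hg
  have hi' : i < l.length := by simpa using hi
  have hspan : (Ideal.ofList ((l.map (X : σ → MvPolynomial σ K)).take i) • ⊤ :
      Submodule (MvPolynomial σ K) (MvPolynomial σ K)) =
      Ideal.span (X '' {a | a ∈ l.take i}) := by
    rw [smul_eq_mul, Ideal.mul_top, Ideal.ofList]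
    congr 1
    ext y
    simp [← List.map_take]
  rw [hspan] at hg ⊢
  rw [List.getElem_map, smul_eq_mul] at hg
  erw [mem_ideal_span_X_image] at hg ⊢
  intro m hm
  obtain ⟨a, ha, hma⟩ := hg (m + Finsupp.single l[i] 1) (by
    rw [mem_support_iff, mul_comm, coeff_mul_X]
    exact mem_support_iff.mp hm)
  refine ⟨a, ha, ?_⟩
  have hne : l[i] ≠ a := by
    rintro rfl
    obtain ⟨j, hj, hje⟩ := List.getElem_of_mem ha
    rw [List.length_take] at hj
    rw [List.getElem_take] at hje
    have := (List.Nodup.getElem_inj_iff hl).mp hje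
    omega
  simpa [Finsupp.single_apply, hne] using hma

/-- The ideal of the origin of affine space. -/
noncomputable abbrev originIdeal (K : Type u) [Field K] (σ : Type) : Ideal (MvPolynomial σ K) :=
  RingHom.ker (constantCoeff (R := K) (σ := σ))

instance : (originIdeal K σ).IsPrime := RingHom.ker_isPrime _

lemma hasDepthGE_localization_originIdeal :
    HasDepthGE (Localization.AtPrime (originIdeal K σ)) (Localization.AtPrime (originIdeal K σ))
      (Fintype.card σ) := by
  have h := (isWeaklyRegular_map_X (K := K)
    (Finset.nodup_toList (Finset.univ : Finset σ))).isRegular_of_isLocalization_of_mem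
    (Localization.AtPrime (originIdeal K σ)) (originIdeal K σ) (by
      intro r hr
      obtain ⟨i, -, rfl⟩ := List.mem_map.mp hr
      simp [RingHom.mem_ker])
  refine ⟨_, by simp, ?_, h⟩
  intro r hr
  obtain ⟨x, hx, rfl⟩ := List.mem_map.mp hr
  rw [IsLocalization.AtPrime.to_map_mem_maximal_iff _ (originIdeal K σ)]
  obtain ⟨i, -, rfl⟩ := List.mem_map.mp hx
  simp [RingHom.mem_ker]

/-- Macaulay's unmixedness theorem at the origin of affine space: if an ideal is generated by as
many elements as its codimension, then membership in it can be tested at the generic points of its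
components, after inverting a polynomial that does not vanish at the origin. -/
theorem exists_mul_mem_of_forall_prime (fs : List (MvPolynomial σ K))
    (h0 : ∀ f ∈ fs, constantCoeff f = 0) {c : ℕ} (hc : c + fs.length = Fintype.card σ)
    (hdim : ∀ p : Ideal (MvPolynomial σ K), p.IsPrime → Ideal.ofList fs ≤ p → primeDim p ≤ c)
    (Q : MvPolynomial σ K)
    (hQ : ∀ p : Ideal (MvPolynomial σ K), p.IsPrime → Ideal.ofList fs ≤ p → c ≤ primeDim p →
      ∃ s ∉ p, s * Q ∈ Ideal.ofList fs) :
    ∃ s, constantCoeff s ≠ 0 ∧ s * Q ∈ Ideal.ofList fs := by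
  let S := Localization.AtPrime (originIdeal K σ)
  let φ := algebraMap (MvPolynomial σ K) S
  have hmem : ∀ r ∈ fs.map φ, r ∈ maximalIdeal S := by
    intro r hr
    obtain ⟨x, hx, rfl⟩ := List.mem_map.mp hr
    exact (IsLocalization.AtPrime.to_map_mem_maximal_iff S (originIdeal K σ) x).mpr (h0 x hx)
  have hI : (Ideal.ofList fs).map φ = Ideal.ofList (fs.map φ) := Ideal.map_ofList φ fs
  have hle : ∀ q : Ideal S, Ideal.ofList (fs.map φ) ≤ q → Ideal.ofList fs ≤ q.comap φ := by
    intro q hq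
    rwa [← hI, Ideal.map_le_iff_le_comap] at hq
  have hd : ringKrullDim (S ⧸ (Module.annihilator S S ⊔ Ideal.ofList (fs.map φ))) ≤ c :=
    ringKrullDim_quotient_le_of_primeDim_le (originIdeal K σ).primeCompl _ c fun q hq hJq =>
      hdim _ (hq.comap _) (hle q (le_sup_right.trans hJq))
  have hdep : HasDepthGE S S (c + (fs.map φ).length) := by
    rw [List.length_map, hc]
    exact hasDepthGE_localization_originIdeal
  obtain ⟨rs, hlen, hrs, hreg⟩ := hdep.quotient_ofList hmem hd
  let N : Submodule S S := Ideal.ofList (fs.map φ) • ⊤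
  have hN : N = Ideal.ofList (fs.map φ) := by simp [N]
  suffices hz : φ Q ∈ Ideal.ofList (fs.map φ) by
    rw [← hI, IsLocalization.algebraMap_mem_map_algebraMap_iff (originIdeal K σ).primeCompl] at hz
    obtain ⟨s, hs, hsQ⟩ := hz
    exact ⟨s, fun h => hs h, hsQ⟩
  by_contra hz
  have hz' : (Submodule.Quotient.mk (φ Q) : S ⧸ N) ≠ 0 := by
    rw [Ne, Submodule.Quotient.mk_eq_zero, hN]
    exact hz
  -- an associated prime of the quotient which contains the annihilator of the class of `Q` has
  -- dimension at least `c`, by the depth of the quotient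
  obtain ⟨p, hp, hpann⟩ := exists_le_isAssociatedPrime_of_isNoetherianRing S _ hz'
  have hpp := hp.1
  have h1 := length_le_ringKrullDim_of_isAssociatedPrime hrs hreg hp
  have hfp : Ideal.ofList (fs.map φ) ≤ p := by
    intro a ha
    refine hpann ?_
    rw [Submodule.mem_colon_singleton, ← Submodule.Quotient.mk_smul, Submodule.mem_bot,
      Submodule.Quotient.mk_eq_zero, hN]
    exact Ideal.mul_mem_right _ _ ha
  have h2 : ringKrullDim (S ⧸ p) ≤ primeDim (p.comap φ) :=
    ringKrullDim_quotient_le_of_primeDim_le (originIdeal K σ).primeCompl _ _ fun q hq hpq => by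
      rcases eq_or_ne (p.comap φ) (q.comap φ) with h | h
      · exact h ▸ le_rfl
      · have := hq.comap φ
        exact (primeDim_lt (lt_of_le_of_ne (Ideal.comap_mono hpq) h)).le
  have h3 : c ≤ primeDim (p.comap φ) := by
    have := h1.trans h2
    rw [hlen] at this
    exact_mod_cast this
  obtain ⟨s, hs, hsQ⟩ := hQ _ (hpp.comap φ) (hle p hfp) h3
  refine hs (hpann ?_)
  rw [Submodule.mem_colon_singleton, ← Submodule.Quotient.mk_smul, Submodule.mem_bot,
      Submodule.Quotient.mk_eq_zero, hN, smul_eq_mul, ← map_mul, ← hI]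
  exact Ideal.mem_map_of_mem _ hsQ

end Unmixed

/-! ### Polarization of cubic forms -/

section CubicForms

open MvPolynomial
open scoped Pointwise

variable {K : Type u} [Field K] {n : ℕ}

/-- Quadratic forms are linear combinations of products of two variables. -/
lemma isHomogeneous_two_induction {F : MvPolynomial (Fin n) K} (hF : F.IsHomogeneous 2)
    {P : MvPolynomial (Fin n) K → Prop} (h0 : P 0) (hadd : ∀ f g, P f → P g → P (f + g))
    (hsmul : ∀ (c : K) f, P f → P (c • f)) (hX : ∀ a b, P (X a * X b)) : P F := by
  have h : F ∈ (homogeneousSubmodule (Fin n) K 1) ^ 2 := by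
    rw [homogeneousSubmodule_one_pow]; exact hF
  rw [homogeneousSubmodule_one_eq_span_X, Submodule.span_pow] at h
  clear hF
  induction h using Submodule.span_induction with
  | mem x hx =>
    rw [pow_two, Set.mem_mul] at hx
    obtain ⟨_, ⟨a, rfl⟩, _, ⟨b, rfl⟩, rfl⟩ := hx
    exact hX a b
  | zero => exact h0
  | add x y _ _ hx hy => exact hadd x y hx hy
  | smul c x _ hx => exact hsmul c x hx

/-- Cubic forms are linear combinations of products of three variables. -/
lemma isHomogeneous_three_induction {F : MvPolynomial (Fin n) K} (hF : F.IsHomogeneous 3)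
    {P : MvPolynomial (Fin n) K → Prop} (h0 : P 0) (hadd : ∀ f g, P f → P g → P (f + g))
    (hsmul : ∀ (c : K) f, P f → P (c • f)) (hX : ∀ a b c, P (X a * X b * X c)) : P F := by
  have h : F ∈ (homogeneousSubmodule (Fin n) K 1) ^ 3 := by
    rw [homogeneousSubmodule_one_pow]; exact hF
  rw [homogeneousSubmodule_one_eq_span_X, Submodule.span_pow] at h
  clear hF
  induction h using Submodule.span_induction with
  | mem x hx =>
    rw [pow_succ, pow_two, Set.mem_mul] at hx
    obtain ⟨y, hy, _, ⟨c, rfl⟩, rfl⟩ := hx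
    obtain ⟨_, ⟨a, rfl⟩, _, ⟨b, rfl⟩, rfl⟩ := Set.mem_mul.mp hy
    exact hX a b c
  | zero => exact h0
  | add x y _ _ hx hy => exact hadd x y hx hy
  | smul c x _ hx => exact hsmul c x hx

variable {A : Type*} [CommRing A] [Algebra K A]

/-- The derivative of the form `F` at `x` in the direction `y`. -/
noncomputable def dirDeriv (F : MvPolynomial (Fin n) K) (x y : Fin n → A) : A :=
  ∑ i, aeval x (pderiv i F) * y i

lemma dirDeriv_zero (x y : Fin n → A) : dirDeriv (0 : MvPolynomial (Fin n) K) x y = 0 := by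
  simp [dirDeriv]

lemma dirDeriv_add (F G : MvPolynomial (Fin n) K) (x y : Fin n → A) :
    dirDeriv (F + G) x y = dirDeriv F x y + dirDeriv G x y := by
  simp [dirDeriv, add_mul, Finset.sum_add_distrib]

lemma dirDeriv_smul (c : K) (F : MvPolynomial (Fin n) K) (x y : Fin n → A) :
    dirDeriv (c • F) x y = algebraMap K A c * dirDeriv F x y := by
  simp [dirDeriv, Finset.mul_sum, mul_assoc, Algebra.smul_def]

lemma dirDeriv_mul (F G : MvPolynomial (Fin n) K) (x y : Fin n → A) :
    dirDeriv (F * G) x y = aeval x F * dirDeriv G x y + aeval x G * dirDeriv F x y := by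
  simp only [dirDeriv, Derivation.leibniz, smul_eq_mul, map_add, map_mul, add_mul,
    Finset.sum_add_distrib, Finset.mul_sum, mul_assoc]

lemma dirDeriv_X (a : Fin n) (x y : Fin n → A) :
    dirDeriv (X a : MvPolynomial (Fin n) K) x y = y a := by
  classical
  simp only [dirDeriv, pderiv_X]
  rw [Finset.sum_eq_single a]
  · simp
  · intro b _ hb; simp [hb.symm]
  · simp

lemma dirDeriv_add_right (F : MvPolynomial (Fin n) K) (x y z : Fin n → A) :
    dirDeriv F x (y + z) = dirDeriv F x y + dirDeriv F x z := by
  simp [dirDeriv, mul_add, Finset.sum_add_distrib]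

lemma dirDeriv_smul_right (F : MvPolynomial (Fin n) K) (x y : Fin n → A) (c : A) :
    dirDeriv F x (c • y) = c * dirDeriv F x y := by
  simp [dirDeriv, Finset.mul_sum, mul_left_comm]

lemma map_dirDeriv {B : Type*} [CommRing B] [Algebra K B] (φ : A →ₐ[K] B)
    (F : MvPolynomial (Fin n) K) (x y : Fin n → A) :
    φ (dirDeriv F x y) = dirDeriv F (φ ∘ x) (φ ∘ y) := by
  simp [dirDeriv, MvPolynomial.comp_aeval_apply]
  rfl

lemma aeval_smul_eq_mul (c : K) (F : MvPolynomial (Fin n) K) (x : Fin n → A) :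
    aeval x (c • F) = algebraMap K A c * aeval x F := by
  rw [map_smul, Algebra.smul_def]

/-- Taylor expansion of a cubic form along the line spanned by `x` and `y`. -/
lemma aeval_add_of_cubic {F : MvPolynomial (Fin n) K} (hF : F.IsHomogeneous 3) (x y : Fin n → A)
    (s t : A) : aeval (s • x + t • y) F = s ^ 3 * aeval x F + s ^ 2 * t * dirDeriv F x y
      + s * t ^ 2 * dirDeriv F y x + t ^ 3 * aeval y F := by
  refine isHomogeneous_three_induction hF (P := fun F => aeval (s • x + t • y) F =
      s ^ 3 * aeval x F + s ^ 2 * t * dirDeriv F x y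
      + s * t ^ 2 * dirDeriv F y x + t ^ 3 * aeval y F)
    ?_ (fun f g hf hg => ?_) (fun c f hf => ?_)
    fun a b c => ?_
  · simp [dirDeriv_zero]
  · simp only [map_add, dirDeriv_add, hf, hg]; ring
  · simp only [aeval_smul_eq_mul, dirDeriv_smul, hf]; ring
  · simp [dirDeriv_mul, dirDeriv_X]; ring

lemma aeval_add_of_quadratic {F : MvPolynomial (Fin n) K} (hF : F.IsHomogeneous 2)
    (x y : Fin n → A) (s t : A) : aeval (s • x + t • y) F =
      s ^ 2 * aeval x F + s * t * dirDeriv F x y + t ^ 2 * aeval y F := by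
  refine isHomogeneous_two_induction hF (P := fun F => aeval (s • x + t • y) F =
      s ^ 2 * aeval x F + s * t * dirDeriv F x y + t ^ 2 * aeval y F)
    ?_ (fun f g hf hg => ?_) (fun c f hf => ?_)
    fun a b => ?_
  · simp [dirDeriv_zero]
  · simp only [map_add, dirDeriv_add, hf, hg]; ring
  · simp only [aeval_smul_eq_mul, dirDeriv_smul, hf]; ring
  · simp [dirDeriv_mul, dirDeriv_X]; ring

lemma dirDeriv_symm_of_quadratic {F : MvPolynomial (Fin n) K} (hF : F.IsHomogeneous 2)
    (x y : Fin n → A) : dirDeriv F x y = dirDeriv F y x := by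
  refine isHomogeneous_two_induction hF (P := fun F => dirDeriv F x y = dirDeriv F y x)
    ?_ (fun f g hf hg => ?_) (fun c f hf => ?_)
    fun a b => ?_
  · simp [dirDeriv_zero]
  · simp only [dirDeriv_add, hf, hg]
  · simp only [dirDeriv_smul, hf]
  · simp [dirDeriv_mul, dirDeriv_X]; ring

lemma dirDeriv_self_of_cubic {F : MvPolynomial (Fin n) K} (hF : F.IsHomogeneous 3)
    (x : Fin n → A) : dirDeriv F x x = 3 * aeval x F := by
  refine isHomogeneous_three_induction hF (P := fun F => dirDeriv F x x = 3 * aeval x F)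
    ?_ (fun f g hf hg => ?_) (fun c f hf => ?_)
    fun a b c => ?_
  · simp [dirDeriv_zero]
  · simp only [map_add, dirDeriv_add, hf, hg]; ring
  · simp only [aeval_smul_eq_mul, dirDeriv_smul, hf]; ring
  · simp [dirDeriv_mul, dirDeriv_X]; ring

lemma dirDeriv_add_self_of_cubic {F : MvPolynomial (Fin n) K} (hF : F.IsHomogeneous 3)
    (x y : Fin n → A) :
    dirDeriv F (y + x) x = 3 * aeval x F + 2 * dirDeriv F x y + dirDeriv F y x := by
  refine isHomogeneous_three_induction hF (P := fun F => dirDeriv F (y + x) x =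
      3 * aeval x F + 2 * dirDeriv F x y + dirDeriv F y x)
    ?_ (fun f g hf hg => ?_) (fun c f hf => ?_)
    fun a b c => ?_
  · simp [dirDeriv_zero]
  · simp only [map_add, dirDeriv_add, hf, hg]; ring
  · simp only [aeval_smul_eq_mul, dirDeriv_smul, hf]; ring
  · simp [dirDeriv_mul, dirDeriv_X]; ring

lemma pderiv_pderiv_comm {σ : Type*} (F : MvPolynomial σ K) (i j : σ) :
    pderiv i (pderiv j F) = pderiv j (pderiv i F) := by
  classical
  induction F using MvPolynomial.induction_on with
  | C a => simp
  | add p q hp hq => simp [hp, hq]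
  | mul_X p l hp =>
    simp only [Derivation.leibniz, pderiv_X, smul_eq_mul, map_add, hp]
    have h : ∀ a b : σ, pderiv a ((Pi.single b 1 : σ → MvPolynomial σ K) l) = 0 := by
      intro a b
      by_cases hb : l = b <;> simp [hb]
    simp only [h]
    ring

end CubicForms

/-! ### The Jacobian matrix of the line equations -/

section Jacobian

open MvPolynomial

variable {K : Type u} [Field K] {n : ℕ}

/-- The coordinate ring of the space of pairs `(v, w)` of vectors of `K ^ n`. -/
abbrev PairRing (K : Type u) [Field K] (n : ℕ) : Type u := MvPolynomial (Fin n ⊕ Fin n) K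

/-- The first vector of the universal pair. -/
noncomputable def fstVec (K : Type u) [Field K] (n : ℕ) : Fin n → PairRing K n :=
  fun i => X (.inl i)

/-- The second vector of the universal pair. -/
noncomputable def sndVec (K : Type u) [Field K] (n : ℕ) : Fin n → PairRing K n :=
  fun i => X (.inr i)

/-- The four coefficients of the restriction of the cubic form `F` to the line spanned by the
universal pair `(v, w)`: they define the variety of pairs spanning a line in `F = 0`. -/
noncomputable def lineEqs (F : MvPolynomial (Fin n) K) : Fin 4 → PairRing K n :=
  ![aeval (fstVec K n) F, dirDeriv F (fstVec K n) (sndVec K n),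
    dirDeriv F (sndVec K n) (fstVec K n), aeval (sndVec K n) F]

lemma aeval_fstVec (F : MvPolynomial (Fin n) K) : aeval (fstVec K n) F = rename Sum.inl F := by
  rw [show rename Sum.inl F = aeval (fstVec K n) F from
    DFunLike.congr_fun (algHom_ext (by simp [fstVec])) F]

lemma aeval_sndVec (F : MvPolynomial (Fin n) K) : aeval (sndVec K n) F = rename Sum.inr F := by
  rw [show rename Sum.inr F = aeval (sndVec K n) F from
    DFunLike.congr_fun (algHom_ext (by simp [sndVec])) F]

lemma pderiv_inl_aeval_fstVec (F : MvPolynomial (Fin n) K) (l : Fin n) :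
    pderiv (.inl l) (aeval (fstVec K n) F) = aeval (fstVec K n) (pderiv l F) := by
  rw [aeval_fstVec, aeval_fstVec, pderiv_rename Sum.inl_injective]

lemma pderiv_inr_aeval_sndVec (F : MvPolynomial (Fin n) K) (l : Fin n) :
    pderiv (.inr l) (aeval (sndVec K n) F) = aeval (sndVec K n) (pderiv l F) := by
  rw [aeval_sndVec, aeval_sndVec, pderiv_rename Sum.inr_injective]

lemma pderiv_inl_aeval_sndVec (F : MvPolynomial (Fin n) K) (l : Fin n) :
    pderiv (.inl l) (aeval (sndVec K n) F) = 0 := by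
  rw [aeval_sndVec]
  induction F using MvPolynomial.induction_on with
  | C a => simp
  | add p q hp hq => simp [hp, hq]
  | mul_X p l hp => simp [hp]

lemma pderiv_inr_aeval_fstVec (F : MvPolynomial (Fin n) K) (l : Fin n) :
    pderiv (.inr l) (aeval (fstVec K n) F) = 0 := by
  rw [aeval_fstVec]
  induction F using MvPolynomial.induction_on with
  | C a => simp
  | add p q hp hq => simp [hp, hq]
  | mul_X p l hp => simp [hp]

lemma pderiv_inl_dirDeriv (F : MvPolynomial (Fin n) K) (l : Fin n) :
    pderiv (.inl l) (dirDeriv F (fstVec K n) (sndVec K n)) =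
      dirDeriv (pderiv l F) (fstVec K n) (sndVec K n) := by
  simp only [dirDeriv, map_sum, Derivation.leibniz, pderiv_inl_aeval_fstVec, smul_eq_mul]
  refine Finset.sum_congr rfl fun i _ => ?_
  rw [pderiv_pderiv_comm]
  simp [sndVec, mul_comm]

lemma pderiv_inr_dirDeriv (F : MvPolynomial (Fin n) K) (l : Fin n) :
    pderiv (.inr l) (dirDeriv F (fstVec K n) (sndVec K n)) = aeval (fstVec K n) (pderiv l F) := by
  simp only [dirDeriv, map_sum, Derivation.leibniz, pderiv_inr_aeval_fstVec, smul_eq_mul, mul_zero,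
    add_zero, sndVec, pderiv_X]
  rw [Finset.sum_eq_single l]
  · simp
  · intro b _ hb; simp [hb]
  · simp

lemma pderiv_inr_dirDeriv' (F : MvPolynomial (Fin n) K) (l : Fin n) :
    pderiv (.inr l) (dirDeriv F (sndVec K n) (fstVec K n)) =
      dirDeriv (pderiv l F) (sndVec K n) (fstVec K n) := by
  simp only [dirDeriv, map_sum, Derivation.leibniz, pderiv_inr_aeval_sndVec, smul_eq_mul]
  refine Finset.sum_congr rfl fun i _ => ?_
  rw [pderiv_pderiv_comm]
  simp [fstVec, mul_comm]

lemma pderiv_inl_dirDeriv' (F : MvPolynomial (Fin n) K) (l : Fin n) :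
    pderiv (.inl l) (dirDeriv F (sndVec K n) (fstVec K n)) = aeval (sndVec K n) (pderiv l F) := by
  simp only [dirDeriv, map_sum, Derivation.leibniz, pderiv_inl_aeval_sndVec, smul_eq_mul, mul_zero,
    add_zero, fstVec, pderiv_X]
  rw [Finset.sum_eq_single l]
  · simp
  · intro b _ hb; simp [hb]
  · simp

/-- The Jacobian matrix of the equations `lineEqs F`. -/
noncomputable def lineJacobian (F : MvPolynomial (Fin n) K) :
    Matrix (Fin 4) (Fin n ⊕ Fin n) (PairRing K n) :=
  Matrix.of fun j i => pderiv i (lineEqs F j)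

/-- A matrix over a field with linearly independent rows has a nonzero maximal minor. -/
lemma exists_minor_ne_zero {r : ℕ} {ι : Type*} [Finite ι] (M : Matrix (Fin r) ι K)
    (h : ∀ c : Fin r → K, (∀ i, ∑ j, c j * M j i = 0) → c = 0) :
    ∃ e : Fin r → ι, (M.submatrix id e).det ≠ 0 := by
  have : Fintype ι := Fintype.ofFinite ι
  have hspan : Submodule.span K (Set.range fun i => fun j => M j i) = ⊤ := by
    by_contra hne
    obtain ⟨f, hf0, hf⟩ := Submodule.exists_le_ker_of_lt_top _ (lt_top_iff_ne_top.mpr hne)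
    apply hf0
    have hfe : ∀ x : Fin r → K, f x = ∑ j, f (Pi.single j 1) * x j := by
      intro x
      conv_lhs => rw [LinearMap.pi_apply_eq_sum_univ f x]
      refine Finset.sum_congr rfl fun j _ => ?_
      rw [smul_eq_mul, mul_comm]
      congr 2
      ext i; simp [Pi.single_apply, eq_comm]
    have := h (fun j => f (Pi.single j 1)) fun i => by
      rw [← hfe]
      exact hf (Submodule.subset_span ⟨i, rfl⟩)
    ext j
    simpa using congrFun this j
  obtain ⟨κ, a, ha, hsp, hli⟩ := exists_linearIndependent' K (fun i => fun j => M j i)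
  rw [hspan] at hsp
  let b := Module.Basis.mk hli hsp.ge
  have : Finite κ := Finite.of_injective a ha
  have : Fintype κ := Fintype.ofFinite κ
  have hcard : Fintype.card κ = r := by
    rw [← Module.finrank_eq_card_basis b]; simp
  let e := (Fintype.equivFinOfCardEq hcard).symm
  refine ⟨a ∘ e, ?_⟩
  have hli' : LinearIndependent K (M.submatrix id (a ∘ e)).col := hli.comp e e.injective
  exact (Matrix.isUnit_iff_isUnit_det _).mp (Matrix.linearIndependent_cols_iff_isUnit.mp hli')
    |>.ne_zero

/-- Binary quadratic forms that all lie in the kernel of a nonzero `2 × 3` Hankel matrix have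
a common zero. This is the geometric content of the surjectivity of `W ⊗ Sym¹ → Sym³` for
a base point free space `W` of binary quadratic forms. -/
lemma exists_common_zero_of_hankel [IsAlgClosed K] {ι : Type*} (g0 g1 g2 : ι → K) (c : Fin 4 → K)
    (hc : c ≠ 0) (h1 : ∀ i, c 0 * g0 i + c 1 * g1 i + c 2 * g2 i = 0)
    (h2 : ∀ i, c 1 * g0 i + c 2 * g1 i + c 3 * g2 i = 0) :
    ∃ s t : K, (s ≠ 0 ∨ t ≠ 0) ∧ ∀ i, s ^ 2 * g0 i + s * t * g1 i + t ^ 2 * g2 i = 0 := by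
  -- the cross product of the two rows
  set p0 := c 1 * c 3 - c 2 * c 2 with hp0
  set p1 := c 2 * c 1 - c 0 * c 3 with hp1
  set p2 := c 0 * c 2 - c 1 * c 1 with hp2
  by_cases hp : p0 = 0 ∧ p1 = 0 ∧ p2 = 0
  · obtain ⟨e0, e1, e2⟩ := hp
    by_cases hc0 : c 0 = 0
    · have hc1 : c 1 = 0 := by
        rw [hp2, hc0] at e2; simpa using e2
      have hc2 : c 2 = 0 := by
        rw [hp0, hc1] at e0; simpa using e0
      have hc3 : c 3 ≠ 0 := by
        intro hc3
        apply hc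
        ext j
        fin_cases j <;> simp [hc0, hc1, hc2, hc3]
      refine ⟨0, 1, Or.inr one_ne_zero, fun i => ?_⟩
      have := h2 i
      rw [hc1, hc2] at this
      simpa [hc3] using this
    · refine ⟨c 0, c 1, Or.inl hc0, fun i => ?_⟩
      have := h1 i
      have e2' : c 0 * c 2 = c 1 * c 1 := sub_eq_zero.mp e2
      linear_combination c 0 * this - g2 i * e2'
  · -- all the forms are proportional to the one with coefficients `p0, p1, p2`
    have k01 : ∀ i, p0 * g1 i = p1 * g0 i := fun i => by
      linear_combination c 3 * h1 i - c 2 * h2 i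
    have k02 : ∀ i, p0 * g2 i = p2 * g0 i := fun i => by
      linear_combination c 1 * h2 i - c 2 * h1 i
    have k12 : ∀ i, p1 * g2 i = p2 * g1 i := fun i => by
      linear_combination c 1 * h1 i - c 0 * h2 i
    have hroot : ∃ s t : K, (s ≠ 0 ∨ t ≠ 0) ∧ s ^ 2 * p0 + s * t * p1 + t ^ 2 * p2 = 0 := by
      by_cases h : p0 = 0
      · exact ⟨1, 0, Or.inl one_ne_zero, by simp [h]⟩
      · have hdeg : (Polynomial.C p0 * Polynomial.X ^ 2 + Polynomial.C p1 * Polynomial.X +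
            Polynomial.C p2).degree ≠ 0 := by
          rw [Polynomial.degree_quadratic h]; decide
        obtain ⟨s, hs⟩ := IsAlgClosed.exists_root _ hdeg
        refine ⟨s, 1, Or.inr one_ne_zero, ?_⟩
        simp only [Polynomial.IsRoot, Polynomial.eval_add, Polynomial.eval_mul, Polynomial.eval_C,
          Polynomial.eval_pow, Polynomial.eval_X] at hs
        linear_combination hs
    obtain ⟨s, t, hst, hr⟩ := hroot
    refine ⟨s, t, hst, fun i => ?_⟩
    by_cases h0 : p0 = 0
    · by_cases h1' : p1 = 0
      · have h2' : p2 ≠ 0 := fun h => hp ⟨h0, h1', h⟩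
        apply mul_left_cancel₀ h2'
        linear_combination g2 i * hr - s ^ 2 * k02 i - s * t * k12 i
      · apply mul_left_cancel₀ h1'
        linear_combination g1 i * hr - s ^ 2 * k01 i + t ^ 2 * k12 i
    · apply mul_left_cancel₀ h0
      linear_combination g0 i * hr + s * t * k01 i + t ^ 2 * k02 i

/-- If the Jacobian matrix of `lineEqs F` has rank less than four at `(x, y)`, then all partial
derivatives of `F` vanish at some combination of `x` and `y`. -/
lemma exists_singular_of_jacobian [IsAlgClosed K] {F : MvPolynomial (Fin n) K}
    (hF : F.IsHomogeneous 3) (x y : Fin n → K)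
    (hJ : ∀ e : Fin 4 → Fin n ⊕ Fin n,
      aeval (Sum.elim x y) ((lineJacobian F).submatrix id e).det = 0) :
    ∃ s t : K, (s ≠ 0 ∨ t ≠ 0) ∧ ∀ i, aeval (s • x + t • y) (pderiv i F) = 0 := by
  let M : Matrix (Fin 4) (Fin n ⊕ Fin n) K :=
    (lineJacobian F).map (aeval (Sum.elim x y) : PairRing K n →ₐ[K] K)
  have hM : ∃ c : Fin 4 → K, (∀ i, ∑ j, c j * M j i = 0) ∧ c ≠ 0 := by
    by_contra! hcon
    obtain ⟨e, he⟩ := exists_minor_ne_zero M fun c hc => hcon c hc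
    apply he
    have := hJ e
    rwa [AlgHom.map_det] at this
  obtain ⟨c, hc, hc0⟩ := hM
  have hx : (aeval (Sum.elim x y) : PairRing K n →ₐ[K] K) ∘ fstVec K n = x := by
    ext i; simp [fstVec]
  have hy : (aeval (Sum.elim x y) : PairRing K n →ₐ[K] K) ∘ sndVec K n = y := by
    ext i; simp [sndVec]
  have hx' : (fun i => (aeval (Sum.elim x y) : PairRing K n →ₐ[K] K) (fstVec K n i)) = x := hx
  have hy' : (fun i => (aeval (Sum.elim x y) : PairRing K n →ₐ[K] K) (sndVec K n i)) = y := hy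
  have hF' : ∀ i, (pderiv i F).IsHomogeneous 2 := fun i => hF.pderiv
  have hcol : ∀ i, _ := fun i => hc (.inl i)
  have hcor : ∀ i, _ := fun i => hc (.inr i)
  simp only [Fin.sum_univ_four, M, Matrix.map_apply, lineJacobian, Matrix.of_apply, lineEqs,
    Matrix.cons_val_zero, Matrix.cons_val_one, Matrix.cons_val, pderiv_inl_aeval_fstVec,
    pderiv_inr_aeval_sndVec, pderiv_inl_aeval_sndVec, pderiv_inr_aeval_fstVec, pderiv_inl_dirDeriv,
    pderiv_inr_dirDeriv, pderiv_inl_dirDeriv', pderiv_inr_dirDeriv', map_dirDeriv,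
    comp_aeval_apply, map_zero, mul_zero, zero_add, add_zero, hx, hy, hx', hy'] at hcol hcor
  obtain ⟨s, t, hst, h⟩ := exists_common_zero_of_hankel (fun i => aeval x (pderiv i F))
    (fun i => dirDeriv (pderiv i F) x y) (fun i => aeval y (pderiv i F)) c hc0 hcol
    (fun i => by
      rw [dirDeriv_symm_of_quadratic (hF' i)]
      exact hcor i)
  refine ⟨s, t, hst, fun i => ?_⟩
  rw [aeval_add_of_quadratic (hF' i), ← h i]

end Jacobian

/-! ### Dimension of the variety of pairs spanning a line -/

section LineVarietyDimension

open MvPolynomial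

variable {K L : Type u} [Field K] [Field L] [Algebra K L] {n : ℕ}

/-- A nontrivial polynomial relation makes one of the coordinates algebraic over the others. -/
lemma exists_isAlgebraic_of_aeval_eq_zero {F : MvPolynomial (Fin n) K} (hF : F ≠ 0)
    (v : Fin n → L) (hv : aeval v F = 0) :
    ∃ i, IsAlgebraic (IntermediateField.adjoin K (v '' {j | j ≠ i})) (v i) := by
  by_contra! hcon
  refine hF (AlgebraicIndependent.eq_zero_of_aeval_eq_zero (x := v)
    (algebraicIndependent_of_finite_type' (algebraMap K L).injective fun t _ _ i hi => ?_) F hv)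
  refine Transcendental.of_tower_top_of_subalgebra_le
    (show Algebra.adjoin K (v '' t) ≤
      (IntermediateField.adjoin K (v '' {j | j ≠ i})).toSubalgebra from ?_) (hcon i)
  refine (Algebra.adjoin_mono (Set.image_mono fun j hj => ?_)).trans
    (IntermediateField.algebra_adjoin_le_adjoin _ _)
  rintro rfl
  exact hi hj

lemma isAlgebraic_of_mem_adjoin {s : Set L} {x : L} (hx : x ∈ s) :
    IsAlgebraic (IntermediateField.adjoin K s) x :=
  isAlgebraic_algebraMap
    (⟨x, IntermediateField.subset_adjoin K s hx⟩ : IntermediateField.adjoin K s)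

open Classical in
/-- If the coordinates of the first vector satisfy an equation and the second vector is rational
over the first one and a finite set `s`, the transcendence degree of the pair is less than the number
of coordinates of the first vector plus the size of `s`. -/
lemma trdeg_le_of_isAlgebraic_snd {v w : Fin n → L}
    (hx : IntermediateField.adjoin K (Set.range (Sum.elim v w)) = ⊤)
    {F : MvPolynomial (Fin n) K} (hF : F ≠ 0) (hv : aeval v F = 0) (s : Finset L)
    (hw : ∀ j, w j ∈ IntermediateField.adjoin K (Set.range v ∪ s)) :
    Algebra.trdeg K L + 1 ≤ (n + s.card : ℕ) := by
  obtain ⟨i, hi⟩ := exists_isAlgebraic_of_aeval_eq_zero hF v hv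
  let t : Finset L := (Finset.univ.erase i).image v ∪ s
  have hts : (t : Set L) = v '' {j | j ≠ i} ∪ s := by
    ext; simp [t]
  have hv' : ∀ j, IsAlgebraic (IntermediateField.adjoin K (t : Set L)) (v j) := by
    intro j
    by_cases hj : j = i
    · subst hj
      refine hi.tower_top_of_subalgebra_le (A := (IntermediateField.adjoin K _).toSubalgebra)
        (B := (IntermediateField.adjoin K (t : Set L)).toSubalgebra) ?_
      refine IntermediateField.adjoin.mono K _ _ ?_
      rw [hts]
      exact Set.subset_union_left
    · refine isAlgebraic_of_mem_adjoin ?_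
      rw [hts]
      exact Or.inl ⟨j, hj, rfl⟩
  have hle : IntermediateField.adjoin K (Set.range v ∪ s) ≤
      (IntermediateField.restrictScalars K
        (algebraicClosure (IntermediateField.adjoin K (t : Set L)) L)) := by
    rw [IntermediateField.adjoin_le_iff]
    rintro _ (⟨j, rfl⟩ | hj)
    · exact mem_algebraicClosure_iff.mpr (hv' j)
    · refine mem_algebraicClosure_iff.mpr (isAlgebraic_of_mem_adjoin ?_)
      rw [hts]
      exact Or.inr hj
  have hcard : t.card + 1 ≤ n + s.card := by
    have h1 : t.card ≤ _ := Finset.card_union_le _ _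
    have h2 : ((Finset.univ.erase i).image v).card ≤ _ := Finset.card_image_le
    have h3 : (Finset.univ.erase i : Finset (Fin n)).card + 1 = n := by
      rw [Finset.card_erase_add_one (Finset.mem_univ _), Finset.card_fin]
    omega
  have := trdeg_le_card_of_isAlgebraic (Sum.elim v w) hx t fun i => by
    rcases i with j | j
    · exact hv' j
    · exact mem_algebraicClosure_iff.mp (hle (hw j))
  calc Algebra.trdeg K L + 1 ≤ t.card + 1 := by gcongr
    _ ≤ _ := by exact_mod_cast hcard

open Classical in
/-- If the first vector lies in a field generated by a set `s`, the transcendence degree of the pair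
is at most the number of coordinates of the second vector plus the size of `s`. -/
lemma trdeg_le_of_fst_mem {v w : Fin n → L}
    (hx : IntermediateField.adjoin K (Set.range (Sum.elim v w)) = ⊤) (s : Finset L)
    (hv : ∀ j, v j ∈ IntermediateField.adjoin K (s : Set L)) :
    Algebra.trdeg K L ≤ (n + s.card : ℕ) := by
  let t : Finset L := Finset.univ.image w ∪ s
  have h1 : t.card ≤ _ := Finset.card_union_le _ _
  have h2 : (Finset.univ.image w).card ≤ _ := Finset.card_image_le
  rw [Finset.card_fin] at h2
  refine (trdeg_le_card_of_isAlgebraic (Sum.elim v w) hx t fun i => ?_).trans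
    (by exact_mod_cast h1.trans (by omega))
  rcases i with j | j
  · exact isAlgebraic_algebraMap (⟨v j, IntermediateField.adjoin.mono K _ _ (by simp [t]) (hv j)⟩ :
      IntermediateField.adjoin K (t : Set L))
  · exact isAlgebraic_of_mem_adjoin (by simp [t])

/-- Linearly dependent pairs whose first vector lies on the cubic form a set of dimension at most
`n`. -/
lemma trdeg_le_of_det_two {v w : Fin n → L}
    (hx : IntermediateField.adjoin K (Set.range (Sum.elim v w)) = ⊤)
    {F : MvPolynomial (Fin n) K} (hF : F ≠ 0) (hv : aeval v F = 0)
    (h : ∀ i j, v i * w j - v j * w i = 0) : Algebra.trdeg K L ≤ n := by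
  by_cases hv0 : v = 0
  · simpa using trdeg_le_of_fst_mem hx ∅ (by simp [hv0])
  · obtain ⟨i, hi⟩ := Function.ne_iff.mp hv0
    have := trdeg_le_of_isAlgebraic_snd hx hF hv {w i / v i} fun j => by
      have : w j = w i / v i * v j := by
        field_simp [show v i ≠ 0 from hi]
        linear_combination h i j
      rw [this]
      exact mul_mem (IntermediateField.subset_adjoin _ _ (by simp))
        (IntermediateField.subset_adjoin _ _ (by simp))
    simp only [Finset.card_singleton, Nat.cast_add, Nat.cast_one] at this
    exact Cardinal.add_one_le_add_one_iff.mp this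

open Classical in
/-- Pairs whose span, if it is a plane, contains a fixed vector `s`, and whose first vector lies on
the cubic, form a set of dimension at most `n + 1`. -/
lemma trdeg_le_of_det_three {v w : Fin n → L}
    (hx : IntermediateField.adjoin K (Set.range (Sum.elim v w)) = ⊤)
    {F : MvPolynomial (Fin n) K} (hF : F ≠ 0) (hv : aeval v F = 0) (s : Fin n → K) (hs : s ≠ 0)
    (h : ∀ e : Fin 3 → Fin n,
      ((Matrix.of ![algebraMap K L ∘ s, v, w]).submatrix id e).det = 0) :
    Algebra.trdeg K L ≤ (n + 1 : ℕ) := by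
  obtain ⟨c, hc, hc0⟩ : ∃ c : Fin 3 → L, (∀ i, ∑ j, c j * (Matrix.of ![algebraMap K L ∘ s, v, w])
      j i = 0) ∧ c ≠ 0 := by
    by_contra! hcon
    obtain ⟨e, he⟩ := exists_minor_ne_zero _ hcon
    exact he (h e)
  simp only [Fin.sum_univ_three, Matrix.of_apply, Matrix.cons_val_zero, Matrix.cons_val_one,
    Matrix.cons_val, Function.comp_apply] at hc
  by_cases h2 : c 2 = 0
  · have h1 : c 1 ≠ 0 := by
      intro h1
      obtain ⟨i, hi⟩ := Function.ne_iff.mp hs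
      have h0 : c 0 = 0 := by simpa [h1, h2, show s i ≠ 0 from hi] using hc i
      exact hc0 (by ext j; fin_cases j <;> assumption)
    refine trdeg_le_of_fst_mem hx {c 0 / c 1} fun j => ?_
    have : v j = - (c 0 / c 1 * algebraMap K L (s j)) := by
      field_simp
      linear_combination hc j - h2 * w j
    rw [this]
    exact neg_mem (mul_mem (IntermediateField.subset_adjoin _ _ (by simp)) (algebraMap_mem _ _))
  · have := trdeg_le_of_isAlgebraic_snd hx hF hv {c 0 / c 2, c 1 / c 2} fun j => by
      have : w j = - (c 0 / c 2 * algebraMap K L (s j) + c 1 / c 2 * v j) := by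
        field_simp
        linear_combination hc j
      rw [this]
      exact neg_mem (add_mem
        (mul_mem (IntermediateField.subset_adjoin _ _ (by simp)) (algebraMap_mem _ _))
        (mul_mem (IntermediateField.subset_adjoin _ _ (by simp))
          (IntermediateField.subset_adjoin _ _ (by simp))))
    have h2 : (({c 0 / c 2, c 1 / c 2} : Finset L)).card ≤ 2 := Finset.card_le_two
    have h3 : Algebra.trdeg K L + 1 ≤ ((n + 1 : ℕ) : Cardinal) + 1 :=
      this.trans (by exact_mod_cast (by omega))
    exact Cardinal.add_one_le_add_one_iff.mp h3

end LineVarietyDimension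

/-! ### The ideal of the line equations near the origin -/

section LineVariety

open MvPolynomial

/-- The generic point of the integral closed subscheme of affine space given by a prime ideal. -/
lemma exists_genericPoint {K : Type u} [Field K] {σ : Type} [Finite σ]
    (p : Ideal (MvPolynomial σ K)) [p.IsPrime] :
    ∃ (L : Type u) (_ : Field L) (_ : Algebra K L) (x : σ → L),
      IntermediateField.adjoin K (Set.range x) = ⊤ ∧ (∀ g, aeval x g = 0 ↔ g ∈ p) ∧
      ∀ c : ℕ, Algebra.trdeg K L ≤ c → primeDim p ≤ c := by
  let A := MvPolynomial σ K ⧸ p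
  let L := FractionRing A
  let φ : MvPolynomial σ K →ₐ[K] L := (IsScalarTower.toAlgHom K A L).comp (Ideal.Quotient.mkₐ K p)
  have hφ : ∀ g, φ g = aeval (fun i => φ (X i)) g := by
    intro g
    conv_lhs => rw [← aeval_X_left_apply g, comp_aeval_apply]
  have hinj : Function.Injective (algebraMap A L) := IsFractionRing.injective A L
  refine ⟨L, inferInstance, inferInstance, fun i => φ (X i), ?_, fun g => ?_, fun c hc => ?_⟩
  · rw [eq_top_iff]
    rintro z -
    have hmem : ∀ a : A, algebraMap A L a ∈
        IntermediateField.adjoin K (Set.range fun i => φ (X i)) := by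
      intro a
      obtain ⟨g, rfl⟩ := Ideal.Quotient.mk_surjective a
      change φ g ∈ _
      rw [hφ]
      refine IntermediateField.algebra_adjoin_le_adjoin K _ ?_
      rw [Algebra.adjoin_range_eq_range_aeval]
      exact ⟨g, rfl⟩
    obtain ⟨a, b, -, rfl⟩ := IsFractionRing.div_surjective A z
    exact div_mem (hmem a) (hmem b)
  · rw [← hφ, ← Ideal.Quotient.eq_zero_iff_mem]
    exact map_eq_zero_iff _ hinj
  · have := (trdeg_le_of_injective (IsScalarTower.toAlgHom K A L) hinj).trans hc
    have h2 := Cardinal.toNat_le_toNat this Cardinal.natCast_lt_aleph0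
    rwa [Cardinal.toNat_natCast] at h2

variable {K : Type u} [Field K] {n : ℕ}

/-- The Plücker coordinates of the line spanned by the universal pair of vectors, i.e. the `2 × 2`
minors of the pair. -/
noncomputable def pairMinor (K : Type u) [Field K] {n : ℕ} (i j : Fin n) : PairRing K n :=
  fstVec K n i * sndVec K n j - fstVec K n j * sndVec K n i

/-- The Nullstellensatz decomposition of the variety of pairs of vectors spanning a line in a cubic
hypersurface `F = 0` with isolated singularities: away from the pairs whose span contains a singular
point, and from the linearly dependent pairs, the Jacobian criterion applies. -/
lemma lineEqs_le_prime_cases [IsAlgClosed K] {F : MvPolynomial (Fin n) K} (hF : F.IsHomogeneous 3)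
    (T : Finset (Fin n → K))
    (hT : ∀ u : Fin n → K, u ≠ 0 → (∀ i, aeval u (pderiv i F) = 0) → aeval u F = 0 →
      ∃ s ∈ T, ∃ c : K, u = c • s)
    (p : Ideal (PairRing K n)) [p.IsPrime] (hp : ∀ j, lineEqs F j ∈ p) :
    (∃ e, ((lineJacobian F).submatrix id e).det ∉ p) ∨ (∀ i j, pairMinor K i j ∈ p) ∨
      ∃ s ∈ T, ∀ e : Fin 3 → Fin n,
        ((Matrix.of ![fun i => C (s i), fstVec K n, sndVec K n]).submatrix id e).det ∈ p := by
  by_contra! hcon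
  obtain ⟨h1, ⟨i, j, h2⟩, h3⟩ := hcon
  -- a closed point `z = (x, y)` of the variety of `p` at which the minor of the pair and, for each
  -- singular vector, a minor of the triple do not vanish
  have : Nonempty (Fin 3 → Fin n) := ⟨fun _ => i⟩
  choose! e he using h3
  set D : (Fin n → K) → PairRing K n := fun s =>
    ((Matrix.of ![fun i => C (s i), fstVec K n, sndVec K n]).submatrix id (e s)).det with hD
  have hh : pairMinor K i j * ∏ s ∈ T, D s ∉ p := by
    intro hmem
    rcases Ideal.IsPrime.mem_or_mem inferInstance hmem with h | h
    · exact h2 h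
    · rw [Ideal.IsPrime.prod_mem_iff] at h
      obtain ⟨s, hs, h⟩ := h
      exact he s hs h
  rw [← IsPrime.vanishingIdeal_zeroLocus (K := K) p, mem_vanishingIdeal_iff] at hh
  push Not at hh
  obtain ⟨z, hz, hne⟩ := hh
  rw [mem_zeroLocus_iff] at hz
  rw [map_mul, map_prod] at hne
  have hne1 := left_ne_zero_of_mul hne
  have hne2 := Finset.prod_ne_zero_iff.mp (right_ne_zero_of_mul hne)
  set x : Fin n → K := fun i => z (.inl i)
  set y : Fin n → K := fun i => z (.inr i)
  have hzxy : z = Sum.elim x y := by ext (i | i) <;> rfl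
  obtain ⟨s, t, hst, hsing⟩ := exists_singular_of_jacobian hF x y fun e =>
    hzxy ▸ hz _ (h1 e)
  have hx : (aeval z : PairRing K n →ₐ[K] K) ∘ fstVec K n = x := by
    ext i; simp [fstVec, x]
  have hy : (aeval z : PairRing K n →ₐ[K] K) ∘ sndVec K n = y := by
    ext i; simp [sndVec, y]
  have hx' : (fun i => (aeval z : PairRing K n →ₐ[K] K) (fstVec K n i)) = x := hx
  have hy' : (fun i => (aeval z : PairRing K n →ₐ[K] K) (sndVec K n i)) = y := hy
  have hq : ∀ j, _ := fun j => hz _ (hp j)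
  have hq0 := hq 0
  have hq1 := hq 1
  have hq2 := hq 2
  have hq3 := hq 3
  simp only [lineEqs, Matrix.cons_val_zero, Matrix.cons_val_one, Matrix.cons_val, map_dirDeriv,
    comp_aeval_apply, hx, hy, hx', hy'] at hq0 hq1 hq2 hq3
  have hmin : x i * y j - x j * y i ≠ 0 := by
    simpa [pairMinor, fstVec, sndVec, x, y] using hne1
  have hu : s • x + t • y ≠ 0 := by
    intro h0
    have hi := congr_fun h0 i
    have hj := congr_fun h0 j
    simp only [Pi.add_apply, Pi.smul_apply, smul_eq_mul, Pi.zero_apply] at hi hj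
    rcases hst with hs | ht
    · exact (mul_ne_zero hs hmin) (by linear_combination y j * hi - y i * hj)
    · exact (mul_ne_zero ht hmin) (by linear_combination x i * hj - x j * hi)
  obtain ⟨τ, hτ, c, hc⟩ := hT _ hu hsing (by
    rw [aeval_add_of_cubic hF, hq0, hq1, hq2, hq3]; ring)
  refine hne2 τ hτ ?_
  rw [hD, AlgHom.map_det, ← Matrix.exists_vecMul_eq_zero_iff]
  refine ⟨![c, -s, -t], ?_, ?_⟩
  · intro h0
    have h1 : -s = 0 := congr_fun h0 1
    have h2 : -t = 0 := congr_fun h0 2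
    rw [neg_eq_zero] at h1 h2
    tauto
  · ext l
    have := congr_fun hc (e τ l)
    simp only [Pi.add_apply, Pi.smul_apply, smul_eq_mul] at this
    simp [Matrix.vecMul, dotProduct, Fin.sum_univ_three, fstVec, sndVec]
    linear_combination -this

/-- The variety of pairs spanning a line in a cubic with isolated singularities has codimension at
least four, and its linearly dependent pairs have dimension at most `n`. -/
lemma primeDim_le_of_lineEqs_le [IsAlgClosed K] (hn : 5 ≤ n)
    {F : MvPolynomial (Fin n) K} (hF : F.IsHomogeneous 3) (hF0 : F ≠ 0) (T : Finset (Fin n → K))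
    (hT0 : ∀ s ∈ T, s ≠ 0)
    (hT : ∀ u : Fin n → K, u ≠ 0 → (∀ i, aeval u (pderiv i F) = 0) → aeval u F = 0 →
      ∃ s ∈ T, ∃ c : K, u = c • s)
    (p : Ideal (PairRing K n)) [p.IsPrime] (hp : ∀ j, lineEqs F j ∈ p) :
    primeDim p ≤ 2 * n - 4 ∧ ((∀ i j, pairMinor K i j ∈ p) → primeDim p ≤ n) := by
  obtain ⟨L, _, _, x, hx, hxp, hdim⟩ := exists_genericPoint p
  set v : Fin n → L := fun i => x (.inl i)
  set w : Fin n → L := fun i => x (.inr i)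
  have hxvw : x = Sum.elim v w := by ext (i | i) <;> rfl
  have hv : (aeval x : PairRing K n →ₐ[K] L) ∘ fstVec K n = v := by
    ext i; simp [fstVec, v]
  have hw : (aeval x : PairRing K n →ₐ[K] L) ∘ sndVec K n = w := by
    ext i; simp [sndVec, w]
  have hF1 : aeval v F = 0 := by
    have := (hxp _).mpr (hp 0)
    simp only [lineEqs, Matrix.cons_val_zero, comp_aeval_apply] at this
    rwa [show (fun i => (aeval x : PairRing K n →ₐ[K] L) (fstVec K n i)) = v from hv] at this
  have hsmall : (∀ i j, pairMinor K i j ∈ p) → primeDim p ≤ n := by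
    intro h
    refine hdim _ (trdeg_le_of_det_two (v := v) (w := w) (hxvw ▸ hx) hF0 hF1 fun i j => ?_)
    have := (hxp _).mpr (h i j)
    simpa [pairMinor, fstVec, sndVec] using this
  refine ⟨?_, hsmall⟩
  rcases lineEqs_le_prime_cases hF T hT p hp with ⟨e, he⟩ | h | ⟨s, hs, h⟩
  · obtain ⟨c, hc, hcn⟩ := trdeg_add_card_le_of_jacobian x hx (lineEqs F)
      (fun j => (hxp _).mpr (hp j)) e (by
        intro h0
        refine he ((hxp _).mp ?_)
        rw [AlgHom.map_det]
        exact h0)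
    simp only [Fintype.card_fin, Fintype.card_sum] at hcn
    exact (hdim c hc).trans (by omega)
  · exact (hsmall h).trans (by omega)
  · refine (hdim (n + 1) (trdeg_le_of_det_three (v := v) (w := w) (hxvw ▸ hx) hF0 hF1 s (hT0 s hs)
      fun e => ?_)).trans (by omega)
    have := (hxp _).mpr (h e)
    rw [AlgHom.map_det] at this
    rw [← this]
    congr 1
    ext a b
    fin_cases a
    · simp
    · exact (congr_fun hv (e b)).symm
    · exact (congr_fun hw (e b)).symm

/-- The ideal of the variety of pairs spanning a line in the cubic hypersurface `F = 0` is, near the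
origin, determined by its localizations at primes where the pair is linearly independent: the four
equations form a complete intersection at the origin, hence are unmixed, and the locus of dependent
pairs has too small a dimension to carry an associated prime. -/
lemma exists_mul_mem_span_lineEqs [IsAlgClosed K] (hn : 5 ≤ n)
    {F : MvPolynomial (Fin n) K} (hF : F.IsHomogeneous 3) (hF0 : F ≠ 0) (T : Finset (Fin n → K))
    (hT0 : ∀ s ∈ T, s ≠ 0)
    (hT : ∀ u : Fin n → K, u ≠ 0 → (∀ i, aeval u (pderiv i F) = 0) → aeval u F = 0 →
      ∃ s ∈ T, ∃ c : K, u = c • s) (Q : PairRing K n)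
    (hQ : ∀ p : Ideal (PairRing K n), p.IsPrime → (∀ j, lineEqs F j ∈ p) →
      (∃ i j, pairMinor K i j ∉ p) → ∃ s ∉ p, s * Q ∈ Ideal.span (Set.range (lineEqs F))) :
    ∃ s : PairRing K n, constantCoeff s ≠ 0 ∧ s * Q ∈ Ideal.span (Set.range (lineEqs F)) := by
  have hI : Ideal.ofList (List.ofFn (lineEqs F)) = Ideal.span (Set.range (lineEqs F)) := by
    rw [Ideal.ofList]
    congr 1
    ext a
    exact List.mem_ofFn' _ _
  have hle : ∀ p : Ideal (PairRing K n), Ideal.span (Set.range (lineEqs F)) ≤ p →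
      ∀ j, lineEqs F j ∈ p := fun p hp j => hp (Ideal.subset_span ⟨j, rfl⟩)
  have hzero : (fun i => (constantCoeff (X (.inl i : Fin n ⊕ Fin n)) : K)) = 0 ∧
      (fun i => (constantCoeff (X (.inr i : Fin n ⊕ Fin n)) : K)) = 0 := by
    constructor <;> ext <;> simp
  have hF00 : constantCoeff F = 0 := by
    rw [constantCoeff_eq]
    exact hF.coeff_eq_zero (by simp)
  have hc0 : ∀ f ∈ List.ofFn (lineEqs F), constantCoeff f = 0 := by
    intro f hf
    obtain ⟨j, rfl⟩ := (List.mem_ofFn' _ _).mp hf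
    fin_cases j
    · change constantCoeff (aeval (fstVec K n) F) = 0
      rw [aeval_fstVec, constantCoeff_rename, hF00]
    · change constantCoeff (dirDeriv F _ _) = 0
      simp [dirDeriv, sndVec]
    · change constantCoeff (dirDeriv F _ _) = 0
      simp [dirDeriv, fstVec]
    · change constantCoeff (aeval (sndVec K n) F) = 0
      rw [aeval_sndVec, constantCoeff_rename, hF00]
  rw [← hI] at hQ ⊢
  refine exists_mul_mem_of_forall_prime (c := 2 * n - 4) _ hc0 (by simp; omega)
    (fun p hp hpI => ?_) Q fun p hp hpI hdim => ?_
  · exact (primeDim_le_of_lineEqs_le hn hF hF0 T hT0 hT p (hle p (hI ▸ hpI))).1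
  · refine hQ p hp (hle p (hI ▸ hpI)) ?_
    by_contra! hcon
    have := (primeDim_le_of_lineEqs_le hn hF hF0 T hT0 hT p (hle p (hI ▸ hpI))).2 hcon
    omega

end LineVariety

/-! ### Homogeneous combinations of generators -/

section HomogeneousCombination

open MvPolynomial

variable {K : Type u} [Field K] {σ : Type*}

lemma homogeneousComponent_mul_of_isHomogeneous {a b : ℕ} (p : MvPolynomial σ K)
    {f : MvPolynomial σ K} (hf : f.IsHomogeneous a) :
    homogeneousComponent (b + a) (p * f) = homogeneousComponent b p * f := by
  conv_lhs => rw [← sum_homogeneousComponent p]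
  rw [Finset.sum_mul, map_sum]
  have h : ∀ i, homogeneousComponent (b + a) (homogeneousComponent i p * f) =
      if i = b then homogeneousComponent b p * f else 0 := by
    intro i
    rw [homogeneousComponent_of_mem (((homogeneousComponent_isHomogeneous i p).mul hf) :
      _ ∈ homogeneousSubmodule σ K (i + a))]
    by_cases hi : i = b
    · simp [hi]
    · rw [if_neg (by omega), if_neg hi]
  simp only [h, Finset.sum_ite_eq', Finset.mem_range]
  split_ifs with hb
  · rfl
  · rw [homogeneousComponent_eq_zero _ _ (by omega), zero_mul]

/-- Near the origin, a homogeneous element of an ideal generated by forms of degree `a` already lies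
in the ideal, with homogeneous coefficients: compare the lowest terms of `s * Q`. -/
lemma exists_homogeneous_combination {ι : Type*} [Fintype ι] {a b : ℕ}
    {f : ι → MvPolynomial σ K} (hf : ∀ j, (f j).IsHomogeneous a) {Q s : MvPolynomial σ K}
    (hQ : Q.IsHomogeneous (b + a)) (hs : constantCoeff s ≠ 0)
    (h : s * Q ∈ Ideal.span (Set.range f)) :
    ∃ q : ι → MvPolynomial σ K, (∀ j, (q j).IsHomogeneous b) ∧ Q = ∑ j, q j * f j := by
  obtain ⟨c, hc⟩ := Ideal.mem_span_range_iff_exists_fun.mp h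
  have h1 := congr_arg (homogeneousComponent (b + a)) hc
  rw [map_sum] at h1
  simp only [homogeneousComponent_mul_of_isHomogeneous _ (hf _)] at h1
  have h2 := homogeneousComponent_mul_of_isHomogeneous (b := 0) s hQ
  rw [zero_add, homogeneousComponent_zero, ← constantCoeff_eq] at h2
  rw [h2] at h1
  refine ⟨fun j => C (constantCoeff s)⁻¹ * homogeneousComponent b (c j), fun j => ?_, ?_⟩
  · have := (isHomogeneous_C σ (constantCoeff s)⁻¹).mul (homogeneousComponent_isHomogeneous b (c j))
    rwa [zero_add] at this
  · simp only [mul_assoc]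
    rw [← Finset.mul_sum, h1, ← mul_assoc, ← C_mul, inv_mul_cancel₀ hs, C_1, one_mul]

lemma exists_linear_of_isHomogeneous_one [Fintype σ] {q : MvPolynomial σ K}
    (hq : q.IsHomogeneous 1) : ∃ c : σ → K, ∀ z : σ → K, aeval z q = ∑ i, c i * z i := by
  have h : q ∈ homogeneousSubmodule σ K 1 := hq
  rw [homogeneousSubmodule_one_eq_span_X] at h
  obtain ⟨c, rfl⟩ := (Submodule.mem_span_range_iff_exists_fun K).mp h
  exact ⟨c, fun z => by simp⟩

end HomogeneousCombination

/-! ### Quartic relations on lines vanish identically -/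

section Vanishing

open MvPolynomial

variable {K : Type u} [Field K] {n : ℕ}

/-- A subspace covered by finitely many subspaces is contained in one of them. -/
lemma exists_le_of_subset_iUnion [Infinite K] {E : Type*} [AddCommGroup E] [Module K E]
    {ι : Type*} [Finite ι] (W : Submodule K E) (p : ι → Submodule K E)
    (h : ∀ x ∈ W, ∃ i, x ∈ p i) : ∃ i, W ≤ p i := by
  obtain ⟨i, hi⟩ := Subspace.exists_eq_top_of_iUnion_eq_univ
    (p := fun i => (p i).comap W.subtype) (by
      ext x
      simpa using h x x.2)
  exact ⟨i, by rwa [← Submodule.comap_subtype_eq_top]⟩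

lemma isHomogeneous_lineEqs {F : MvPolynomial (Fin n) K} (hF : F.IsHomogeneous 3) (j : Fin 4) :
    (lineEqs F j).IsHomogeneous 3 := by
  fin_cases j
  · change (aeval (fstVec K n) F).IsHomogeneous 3
    rw [aeval_fstVec]
    exact hF.rename_isHomogeneous
  · change (∑ i, aeval (fstVec K n) (pderiv i F) * sndVec K n i).IsHomogeneous 3
    refine IsHomogeneous.sum _ _ _ fun i _ => ?_
    rw [aeval_fstVec]
    exact (hF.pderiv (i := i)).rename_isHomogeneous.mul (isHomogeneous_X K _)
  · change (∑ i, aeval (sndVec K n) (pderiv i F) * fstVec K n i).IsHomogeneous 3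
    refine IsHomogeneous.sum _ _ _ fun i _ => ?_
    rw [aeval_sndVec]
    exact (hF.pderiv (i := i)).rename_isHomogeneous.mul (isHomogeneous_X K _)
  · change (aeval (sndVec K n) F).IsHomogeneous 3
    rw [aeval_sndVec]
    exact hF.rename_isHomogeneous

lemma aeval_lineEqs {A : Type*} [CommRing A] [Algebra K A] (F : MvPolynomial (Fin n) K)
    (x y : Fin n → A) (j : Fin 4) : aeval (Sum.elim x y) (lineEqs F j) =
      ![aeval x F, dirDeriv F x y, dirDeriv F y x, aeval y F] j := by
  have hx : (fun i => (aeval (Sum.elim x y) : PairRing K n →ₐ[K] A) (fstVec K n i)) = x := by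
    ext i; simp [fstVec]
  have hy : (fun i => (aeval (Sum.elim x y) : PairRing K n →ₐ[K] A) (sndVec K n i)) = y := by
    ext i; simp [sndVec]
  fin_cases j
  · change aeval _ (aeval (fstVec K n) F) = aeval x F
    rw [comp_aeval_apply, hx]
  · change aeval _ (dirDeriv F (fstVec K n) (sndVec K n)) = dirDeriv F x y
    rw [map_dirDeriv]
    exact congr_arg₂ _ hx hy
  · change aeval _ (dirDeriv F (sndVec K n) (fstVec K n)) = dirDeriv F y x
    rw [map_dirDeriv]
    exact congr_arg₂ _ hy hx
  · change aeval _ (aeval (sndVec K n) F) = aeval y F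
    rw [comp_aeval_apply, hy]

/-- Evaluation at infinitely many scalars isolates the middle coefficient of a quartic. -/
lemma eq_zero_of_forall_quartic [Infinite K] (e0 e1 e2 e3 e4 : K)
    (h : ∀ r : K, e0 + e1 * r + e2 * r ^ 2 + e3 * r ^ 3 + e4 * r ^ 4 = 0) : e2 = 0 := by
  let P : Polynomial K := .C e0 + .C e1 * .X + .C e2 * .X ^ 2 + .C e3 * .X ^ 3 + .C e4 * .X ^ 4
  have hP : P = 0 := Polynomial.funext fun r => by simpa [P] using h r
  have := congr_arg (Polynomial.coeff · 2) hP
  simpa [P, Polynomial.coeff_X, Polynomial.coeff_C, Polynomial.coeff_X_pow] using this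

lemma aeval_smul_of_isHomogeneous {σ A : Type*} [CommRing A] [Algebra K A] {m : ℕ}
    {F : MvPolynomial σ K} (hF : F.IsHomogeneous m) (r : A) (x : σ → A) :
    aeval (r • x) F = r ^ m * aeval x F := by
  rw [aeval_def, eval₂_eq, aeval_def, eval₂_eq, Finset.mul_sum]
  refine Finset.sum_congr rfl fun d hd => ?_
  have hdeg : ∑ i ∈ d.support, d i = m := by
    have := hF (mem_support_iff.mp hd)
    simpa [Finsupp.weight_apply, Finsupp.sum] using this
  simp only [Pi.smul_apply, smul_eq_mul, mul_pow, Finset.prod_mul_distrib,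
    Finset.prod_pow_eq_pow_sum,
    hdeg]
  ring

/-- An element of the ideal of `lineEqs F` of bidegree `(2, 2)` is a combination of the two middle
equations, with coefficients linear in `w` and in `v` respectively. -/
lemma exists_bilinear_combination [Infinite K] {F : MvPolynomial (Fin n) K}
    (hF : F.IsHomogeneous 3) {Q s : PairRing K n} (hQ : Q.IsHomogeneous 4)
    (hQ2 : ∀ (r : K) (x y : Fin n → K),
      aeval (Sum.elim (r • x) y) Q = r ^ 2 * aeval (Sum.elim x y) Q)
    (hs : constantCoeff s ≠ 0) (h : s * Q ∈ Ideal.span (Set.range (lineEqs F))) :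
    ∃ α β : (Fin n → K) →ₗ[K] K, ∀ x y : Fin n → K,
      aeval (Sum.elim x y) Q = α y * dirDeriv F x y + β x * dirDeriv F y x := by
  obtain ⟨q, hq, hQq⟩ := exists_homogeneous_combination (b := 1) (isHomogeneous_lineEqs hF) hQ hs h
  choose c hc using fun j => exists_linear_of_isHomogeneous_one (hq j)
  let γ : Fin 4 → (Fin n → K) →ₗ[K] K := fun j => ∑ i, c j (.inl i) • LinearMap.proj i
  let δ : Fin 4 → (Fin n → K) →ₗ[K] K := fun j => ∑ i, c j (.inr i) • LinearMap.proj i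
  have hval : ∀ j x y, aeval (Sum.elim x y) (q j) = γ j x + δ j y := by
    intro j x y
    simp [hc, γ, δ]
  refine ⟨δ 1, γ 2, fun x y => ?_⟩
  have hall : ∀ x y : Fin n → K, aeval (Sum.elim x y) Q =
      (γ 0 x + δ 0 y) * aeval x F + (γ 1 x + δ 1 y) * dirDeriv F x y +
      (γ 2 x + δ 2 y) * dirDeriv F y x + (γ 3 x + δ 3 y) * aeval y F := by
    intro x y
    conv_lhs => rw [hQq]
    simp only [map_add, map_mul, aeval_lineEqs, hval, Fin.sum_univ_four, Matrix.cons_val_zero,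
      Matrix.cons_val_one, Matrix.cons_val]
  have hd : ∀ (r : K) (x y : Fin n → K), dirDeriv F (r • x) y = r ^ 2 * dirDeriv F x y := by
    intro r x y
    simp only [dirDeriv, aeval_smul_of_isHomogeneous (hF.pderiv), Finset.mul_sum]
    exact Finset.sum_congr rfl fun i _ => by ring
  -- compare the coefficients of `r ^ 2` after scaling `x` by `r`
  have := eq_zero_of_forall_quartic (δ 3 y * aeval y F)
    (δ 2 y * dirDeriv F y x + γ 3 x * aeval y F)
    (δ 1 y * dirDeriv F x y + γ 2 x * dirDeriv F y x - aeval (Sum.elim x y) Q)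
    (δ 0 y * aeval x F + γ 1 x * dirDeriv F x y) (γ 0 x * aeval x F) fun r => by
      have h1 := hall (r • x) y
      rw [hQ2, aeval_smul_of_isHomogeneous hF, hd, dirDeriv_smul_right] at h1
      simp only [map_smul, smul_eq_mul] at h1
      linear_combination -h1
  linear_combination -this

lemma mul_eq_zero_of_forall_linear [Infinite K] {F : MvPolynomial (Fin n) K}
    (α : (Fin n → K) →ₗ[K] K) (h : ∀ x, α x * aeval x F = 0) : α = 0 ∨ F = 0 := by
  let P : MvPolynomial (Fin n) K := ∑ i, C (α (Pi.single i 1)) * X i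
  have hP : ∀ x, aeval x P = α x := by
    intro x
    conv_rhs => rw [LinearMap.pi_apply_eq_sum_univ α x]
    simp only [P, map_sum, map_mul, aeval_X, algHom_C, Algebra.algebraMap_self_apply, smul_eq_mul,
      mul_comm]
    refine Finset.sum_congr rfl fun i _ => ?_
    congr 2
    ext j
    simp [Pi.single_apply, eq_comm]
  have : P * F = 0 := funext fun x => by
    have := h x
    rw [← hP] at this
    simpa [← aeval_eq_eval] using this
  refine (mul_eq_zero.mp this).imp_left fun h0 => ?_
  ext1 x
  ext1
  simp [← hP, h0]

/-- A cubic form `F` with `3 ℓ(y) F(x) = ℓ(x) ∂_y F(x)` for a linear form `ℓ ≠ 0` is a multiple of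
`ℓ` and is singular along a quadric of the hyperplane `ℓ = 0`, hence has infinitely many singular
points. -/
lemma linear_eq_zero_of_isolated [IsAlgClosed K] (hn : 5 ≤ n) (h3 : (3 : K) ≠ 0)
    {F : MvPolynomial (Fin n) K} (hF : F.IsHomogeneous 3) (T : Finset (Fin n → K))
    (hT : ∀ u : Fin n → K, u ≠ 0 → (∀ i, aeval u (pderiv i F) = 0) → aeval u F = 0 →
      ∃ s ∈ T, ∃ c : K, u = c • s)
    (α : (Fin n → K) →ₗ[K] K)
    (h : ∀ x y, 3 * (α y * aeval x F) = α x * dirDeriv F x y) : α = 0 := by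
  classical
  by_contra hα
  obtain ⟨e, he⟩ : ∃ e, α e ≠ 0 := by
    by_contra! h0
    exact hα (LinearMap.ext h0)
  -- the derivatives of `F` in the directions of the hyperplane `α = 0` vanish
  have hker : ∀ y, α y = 0 → ∀ x, dirDeriv F x y = 0 := by
    intro y hy x
    let G : MvPolynomial (Fin n) K := ∑ i, pderiv i F * C (y i)
    have hG : ∀ x : Fin n → K, aeval x G = dirDeriv F x y := by
      intro x; simp [G, dirDeriv]
    rcases mul_eq_zero_of_forall_linear (F := G) α fun x => by rw [hG, ← h, hy]; ring with h0 | h0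
    · exact absurd h0 hα
    · rw [← hG, h0, map_zero]
  let q : (Fin n → K) → K := fun x => dirDeriv F x e
  have hsing : ∀ x, α x = 0 → q x = 0 → x ≠ 0 → ∃ s ∈ T, ∃ c : K, x = c • s := by
    intro x hx hqx hx0
    refine hT x hx0 (fun i => ?_) ?_
    · have h1 := hker (Pi.single i 1 - (α (Pi.single i 1) / α e) • e) (by
        simp [div_mul_cancel₀ _ he]) x
      have h2 : Pi.single i (1 : K) = (Pi.single i 1 - (α (Pi.single i 1) / α e) • e) +
        (α (Pi.single i 1) / α e) • e := by abel
      have h4 : dirDeriv F x (Pi.single i 1) = aeval x (pderiv i F) := by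
        simp [dirDeriv, Pi.single_apply]
      rw [← h4, h2, dirDeriv_add_right, h1, dirDeriv_smul_right]
      simp only [q] at hqx
      simp [hqx]
    · have := h x e
      rw [hx, zero_mul] at this
      simpa [h3, he] using this
  -- the kernel of `α` is covered by finitely many planes
  obtain ⟨c, hc⟩ : ∃ c : Fin n → K, ∀ x ∈ α.ker, ∃ s : ↥(insert 0 T),
      x ∈ Submodule.span K {s.1, c} := by
    by_cases hq : ∀ x, α x = 0 → q x = 0
    · refine ⟨0, fun x hx => ?_⟩
      by_cases hx0 : x = 0
      · exact ⟨⟨0, by simp⟩, by simp [hx0]⟩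
      obtain ⟨s, hs, c, rfl⟩ := hsing x hx (hq x hx) hx0
      exact ⟨⟨s, by simp [hs]⟩, Submodule.smul_mem _ _ (Submodule.subset_span (by simp))⟩
    · push Not at hq
      obtain ⟨c, hc, hqc⟩ := hq
      refine ⟨c, fun x hx => ?_⟩
      have hx' : α x = 0 := hx
      -- a point of the quadric `q = 0` on the line through `x` and `c`
      obtain ⟨t, ht⟩ : ∃ t : K, q (x + t • c) = 0 := by
        have hexp : ∃ B : K, ∀ t, q (x + t • c) = q x + t * B + t ^ 2 * q c := by
          refine ⟨dirDeriv (∑ i, C (e i) * pderiv i F) x c, fun t => ?_⟩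
          have hH : (∑ i, C (e i) * pderiv i F).IsHomogeneous 2 :=
            IsHomogeneous.sum _ _ _ fun i _ => by
              simpa using (isHomogeneous_C _ (e i)).mul (hF.pderiv (i := i))
          have := aeval_add_of_quadratic hH x c 1 t
          simpa [q, dirDeriv, mul_comm (e _)] using this
        obtain ⟨B, hB⟩ := hexp
        obtain ⟨t, ht⟩ := IsAlgClosed.exists_root
          (Polynomial.C (q c) * Polynomial.X ^ 2 + Polynomial.C B * Polynomial.X +
            Polynomial.C (q x)) (by
            rw [Polynomial.degree_quadratic hqc]; decide)
        refine ⟨t, ?_⟩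
        rw [hB]
        have : q c * t ^ 2 + B * t + q x = 0 := by simpa using ht
        linear_combination this
      by_cases hx0 : x + t • c = 0
      · refine ⟨⟨0, by simp⟩, ?_⟩
        rw [eq_neg_of_add_eq_zero_left hx0]
        exact neg_mem (Submodule.smul_mem _ _ (Submodule.subset_span (by simp)))
      · obtain ⟨s, hs, r, hr⟩ := hsing _ (by simp [hx', hc]) ht hx0
        refine ⟨⟨s, by simp [hs]⟩, ?_⟩
        rw [eq_sub_of_add_eq hr]
        exact sub_mem (Submodule.smul_mem _ _ (Submodule.subset_span (by simp)))
          (Submodule.smul_mem _ _ (Submodule.subset_span (by simp)))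
  have : Infinite K := IsAlgClosed.instInfinite
  obtain ⟨s, hs⟩ := exists_le_of_subset_iUnion α.ker
    (fun s : ↥(insert 0 T) => Submodule.span K {s.1, c}) hc
  have h1 := Submodule.finrank_mono hs
  have h2 : Module.finrank K (Submodule.span K {s.1, c}) ≤ 2 := by
    have := finrank_span_finset_le_card (R := K) ({s.1, c} : Finset (Fin n → K))
    have h := Finset.card_le_two (a := s.1) (b := c)
    simp only [Finset.coe_insert, Finset.coe_singleton] at this
    exact this.trans h
  have h5 := α.finrank_range_add_finrank_ker
  have h6 : Module.finrank K α.range ≤ 1 := by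
    simpa using Submodule.finrank_le α.range
  rw [Module.finrank_fin_fun] at h5
  omega

/-- A form of bidegree `(2, 2)` in the pair `(v, w)` lying in the ideal of `lineEqs F` and with the
invariance properties of a quadratic form in the Plücker coordinates of `v ∧ w` vanishes. -/
lemma aeval_eq_zero_of_mul_mem [IsAlgClosed K] (hn : 5 ≤ n) (h3 : (3 : K) ≠ 0)
    {F : MvPolynomial (Fin n) K} (hF : F.IsHomogeneous 3) (hF0 : F ≠ 0) (T : Finset (Fin n → K))
    (hT : ∀ u : Fin n → K, u ≠ 0 → (∀ i, aeval u (pderiv i F) = 0) → aeval u F = 0 →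
      ∃ s ∈ T, ∃ c : K, u = c • s)
    {Q s : PairRing K n} (hQ : Q.IsHomogeneous 4)
    (hQ2 : ∀ (r : K) (x y : Fin n → K),
      aeval (Sum.elim (r • x) y) Q = r ^ 2 * aeval (Sum.elim x y) Q)
    (hQ0 : ∀ x : Fin n → K, aeval (Sum.elim x x) Q = 0)
    (hQadd : ∀ x y : Fin n → K, aeval (Sum.elim x (y + x)) Q = aeval (Sum.elim x y) Q)
    (hs : constantCoeff s ≠ 0) (h : s * Q ∈ Ideal.span (Set.range (lineEqs F)))
    (x y : Fin n → K) : aeval (Sum.elim x y) Q = 0 := by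
  have : Infinite K := IsAlgClosed.instInfinite
  obtain ⟨α, β, hαβ⟩ := exists_bilinear_combination hF hQ hQ2 hs h
  -- on the diagonal, `Q` is `3 (α + β) F`
  have hsum : α + β = 0 := by
    refine (mul_eq_zero_of_forall_linear (F := F) (α + β) fun x => ?_).resolve_right hF0
    have h1 := hαβ x x
    rw [hQ0, dirDeriv_self_of_cubic hF] at h1
    refine (mul_eq_zero.mp (?_ : (3 : K) * _ = 0)).resolve_left h3
    rw [LinearMap.add_apply]
    linear_combination -h1
  have hβ : ∀ x, β x = - α x := fun x => by
    rw [eq_neg_iff_add_eq_zero, add_comm]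
    exact DFunLike.congr_fun hsum x
  have hα : α = 0 := by
    refine linear_eq_zero_of_isolated hn h3 hF T hT α fun x y => ?_
    have h1 := hQadd x y
    rw [hαβ, hαβ, dirDeriv_add_right, dirDeriv_self_of_cubic hF, dirDeriv_add_self_of_cubic hF,
      hβ, map_add] at h1
    linear_combination h1
  rw [hαβ, hβ, hα]
  simp

/-- A cubic form in `v` alone lying in the ideal of `lineEqs F` is proportional to `F`. -/
lemma exists_eq_mul_of_mul_mem {F : MvPolynomial (Fin n) K} (hF : F.IsHomogeneous 3)
    {G : MvPolynomial (Fin n) K} (hG : G.IsHomogeneous 3) {s : PairRing K n}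
    (hs : constantCoeff s ≠ 0)
    (h : s * aeval (fstVec K n) G ∈ Ideal.span (Set.range (lineEqs F))) :
    ∃ c : K, G = C c * F := by
  obtain ⟨q, hq, hQq⟩ := exists_homogeneous_combination (b := 0) (isHomogeneous_lineEqs hF)
    (Q := aeval (fstVec K n) G) (by rw [aeval_fstVec]; exact hG.rename_isHomogeneous) hs h
  have hc : ∀ j, ∃ c : K, q j = C c := fun j =>
    ⟨_, ((totalDegree_eq_zero_iff_eq_C).mp ((totalDegree_zero_iff_isHomogeneous _).mpr (hq j)))⟩
  choose c hc using hc
  refine ⟨c 0, ?_⟩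
  have h0 : ∀ G : MvPolynomial (Fin n) K, G.IsHomogeneous 3 →
      aeval (0 : Fin n → MvPolynomial (Fin n) K) G = 0 := by
    intro G hG
    have := aeval_smul_of_isHomogeneous hG (0 : MvPolynomial (Fin n) K) 0
    simpa using this
  -- set `w = 0`, which kills all the equations but the first
  have h1 := congr_arg (aeval (Sum.elim (X : Fin n → MvPolynomial (Fin n) K) 0)) hQq
  have hX : (fun i => (aeval (Sum.elim (X : Fin n → MvPolynomial (Fin n) K) 0) :
      PairRing K n →ₐ[K] _) (fstVec K n i)) = X := by
    ext1 i; simp [fstVec]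
  have hd : dirDeriv F (0 : Fin n → MvPolynomial (Fin n) K) X = 0 := by
    refine Finset.sum_eq_zero fun i _ => ?_
    have := aeval_smul_of_isHomogeneous (hF.pderiv (i := i)) (0 : MvPolynomial (Fin n) K) 0
    rw [zero_smul] at this
    rw [this]
    ring
  have hd' : dirDeriv F X (0 : Fin n → MvPolynomial (Fin n) K) = 0 := by
    simp [dirDeriv]
  rw [comp_aeval_apply, hX, aeval_X_left_apply] at h1
  simp only [map_add, map_mul, aeval_lineEqs, Fin.sum_univ_four, Matrix.cons_val_zero,
      Matrix.cons_val_one, Matrix.cons_val, hc, algHom_C, hd, hd', h0 F hF, aeval_X_left_apply,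
      algebraMap_eq] at h1
  simpa using h1

end Vanishing

/-! ### Decomposable bivectors -/

section Bivectors

variable {k : Type u} [Field k] {n : ℕ}

/-- Contraction of a bivector with a linear form: `x ∧ y ↦ φ(x) y - φ(y) x`. The value
`ψ (contract φ ω)` is the value of the bivector `ω`, seen as an alternating form on the dual space,
at `(φ, ψ)`. -/
noncomputable def contract (φ : Module.Dual k (V k n)) : (⋀[k]^2 (V k n)) →ₗ[k] V k n :=
  exteriorPower.alternatingMapLinearEquiv
    { toFun := fun m => φ (m 0) • m 1 - φ (m 1) • m 0
      map_update_add' := by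
        intro inst m i x y
        rw [Subsingleton.elim inst inferInstance]
        fin_cases i <;> simp [add_smul] <;> abel
      map_update_smul' := by
        intro inst m i c x
        rw [Subsingleton.elim inst inferInstance]
        fin_cases i <;> simp [smul_sub, mul_smul, smul_comm c]
      map_eq_zero_of_eq' := by
        intro m i j h hij
        have h01 : m 0 = m 1 := by
          fin_cases i <;> fin_cases j <;> first | exact absurd rfl hij | exact h | exact h.symm
        simp [h01] }

@[simp]
lemma contract_wedge (φ : Module.Dual k (V k n)) (x y : V k n) :
    contract φ (wedge k n x y) = φ x • y - φ y • x := by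
  simp [contract, wedge]

lemma wedge_hom_ext {M : Type*} [AddCommGroup M] [Module k M] {f g : (⋀[k]^2 (V k n)) →ₗ[k] M}
    (h : ∀ x y, f (wedge k n x y) = g (wedge k n x y)) : f = g := by
  refine exteriorPower.linearMap_ext (AlternatingMap.ext fun m => ?_)
  have hm : m = ![m 0, m 1] := by ext i; fin_cases i <;> rfl
  rw [hm]
  exact h _ _

lemma wedge_hom_ext_single {M : Type*} [AddCommGroup M] [Module k M]
    {f g : (⋀[k]^2 (V k n)) →ₗ[k] M}
    (h : ∀ i j, f (wedge k n (Pi.single i 1) (Pi.single j 1)) =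
      g (wedge k n (Pi.single i 1) (Pi.single j 1))) : f = g := by
  refine wedge_hom_ext fun x y => ?_
  have : (wedge k n).compr₂ f = (wedge k n).compr₂ g :=
    LinearMap.ext_basis (Pi.basisFun k (Fin n)) (Pi.basisFun k (Fin n)) fun i j => by
      simpa using h i j
  exact congr_fun (congr_arg DFunLike.coe (DFunLike.congr_fun this x)) y

@[simp]
lemma wedge_self (x : V k n) : wedge k n x x = 0 := by
  simp only [wedge, LinearMap.mk₂_apply]
  exact AlternatingMap.map_eq_zero_of_eq _ _ (i := 0) (j := 1) rfl (by decide)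

lemma wedge_swap (x y : V k n) : wedge k n y x = - wedge k n x y := by
  have h := wedge_self (x + y)
  simp only [map_add, LinearMap.add_apply, wedge_self, zero_add, add_zero] at h
  exact eq_neg_of_add_eq_zero_left h

lemma contract_antisymm (φ ψ : Module.Dual k (V k n)) (ω : ⋀[k]^2 (V k n)) :
    ψ (contract φ ω) = - φ (contract ψ ω) := by
  have : ψ ∘ₗ contract φ = - (φ ∘ₗ contract ψ) := wedge_hom_ext fun x y => by
    simp; ring
  exact DFunLike.congr_fun this ω

@[simp]
lemma contract_self (φ : Module.Dual k (V k n)) (ω : ⋀[k]^2 (V k n)) : φ (contract φ ω) = 0 := by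
  have : φ ∘ₗ contract φ = 0 := wedge_hom_ext fun x y => by
    simp; ring
  exact DFunLike.congr_fun this ω

lemma contract_add (φ ψ : Module.Dual k (V k n)) (ω : ⋀[k]^2 (V k n)) :
    contract (φ + ψ) ω = contract φ ω + contract ψ ω := by
  have : contract (φ + ψ) = contract φ + contract ψ := wedge_hom_ext fun x y => by
    simp [add_smul]; abel
  rw [this, LinearMap.add_apply]

lemma contract_smul (c : k) (φ : Module.Dual k (V k n)) (ω : ⋀[k]^2 (V k n)) :
    contract (c • φ) ω = c • contract φ ω := by
  have : contract (c • φ) = c • contract φ := wedge_hom_ext fun x y => by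
    simp [mul_smul, smul_sub]
  rw [this, LinearMap.smul_apply]

lemma bivector_ext {ω ω' : ⋀[k]^2 (V k n)} (h : ∀ φ ψ : Module.Dual k (V k n),
    ψ (contract φ ω) = ψ (contract φ ω')) : ω = ω' := by
  let B := Pi.basisFun k (Fin n)
  refine (B.exteriorPower 2).ext_elem fun s => ?_
  rw [exteriorPower.basis_repr_apply, exteriorPower.basis_repr_apply]
  have : exteriorPower.ιMultiDual k 2 B s =
      (B.coord (Set.powersetCard.ofFinEmbEquiv.symm s 1)) ∘ₗ
        contract (B.coord (Set.powersetCard.ofFinEmbEquiv.symm s 0)) := by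
    refine wedge_hom_ext fun x y => ?_
    rw [LinearMap.comp_apply, contract_wedge]
    simp only [wedge, LinearMap.mk₂_apply]
    rw [exteriorPower.ιMultiDual_apply_ιMulti, Matrix.det_fin_two]
    simp
    ring
  rw [this]
  rw [LinearMap.comp_apply, LinearMap.comp_apply]
  exact h _ _

lemma exists_dual_of_linearIndependent {m : ℕ} {v : Fin m → V k n} (hv : LinearIndependent k v) :
    ∃ δ : Fin m → Module.Dual k (V k n), ∀ i j, δ i (v j) = if i = j then 1 else 0 := by
  obtain ⟨g, hg⟩ := (Fintype.linearCombination k v).exists_leftInverse_of_injective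
    (LinearMap.ker_eq_bot.mpr
      (linearIndependent_iff_injective_fintypeLinearCombination.mp hv))
  refine ⟨fun i => LinearMap.proj i ∘ₗ g, fun i j => ?_⟩
  have := DFunLike.congr_fun hg (Pi.single j 1)
  rw [LinearMap.comp_apply, Fintype.linearCombination_apply_single, one_smul] at this
  simp [this, Pi.single_apply]

lemma exists_dual_eq_one {v : V k n} (hv : v ≠ 0) : ∃ φ : Module.Dual k (V k n), φ v = 1 := by
  obtain ⟨δ, hδ⟩ := exists_dual_of_linearIndependent (v := ![v])
    (LinearIndependent.of_subsingleton 0 hv)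
  exact ⟨δ 0, by simpa using hδ 0 0⟩

lemma exists_smul_eq_of_wedge_eq_zero {v w : V k n} (hv : v ≠ 0) (h : wedge k n v w = 0) :
    ∃ c : k, w = c • v := by
  obtain ⟨φ, hφ⟩ := exists_dual_eq_one hv
  refine ⟨φ w, ?_⟩
  have := congr_arg (contract φ) h
  rwa [contract_wedge, hφ, one_smul, map_zero, sub_eq_zero] at this

lemma eq_zero_of_wedge_ne_zero {v w : V k n} (h : wedge k n v w ≠ 0) (s t : k)
    (hst : s • v + t • w = 0) : s = 0 ∧ t = 0 := by
  have h1 : s • wedge k n v w = 0 := by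
    have := congr_arg (fun x => wedge k n x w) hst
    simpa using this
  have h2 : t • wedge k n v w = 0 := by
    have := congr_arg (wedge k n v) hst
    simpa using this
  exact ⟨(smul_eq_zero.mp h1).resolve_right h, (smul_eq_zero.mp h2).resolve_right h⟩

lemma linearIndependent_of_wedge_ne_zero {v w : V k n} (h : wedge k n v w ≠ 0) :
    LinearIndependent k ![v, w] :=
  LinearIndependent.pair_iff.mpr (eq_zero_of_wedge_ne_zero h)

/-- The value at a bivector of the quadratic Plücker relation given by four linear forms. -/
noncomputable def plueckerRelation (φ : Fin 4 → Module.Dual k (V k n)) (ω : ⋀[k]^2 (V k n)) : k :=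
  φ 1 (contract (φ 0) ω) * φ 3 (contract (φ 2) ω) -
    φ 2 (contract (φ 0) ω) * φ 3 (contract (φ 1) ω) +
    φ 3 (contract (φ 0) ω) * φ 2 (contract (φ 1) ω)

/-- A bivector is decomposable if it satisfies all quadratic Plücker relations. This polynomial
condition is equivalent to being of the form `x ∧ y`; see `IsDecomposable.exists_eq_wedge`. -/
def IsDecomposable (ω : ⋀[k]^2 (V k n)) : Prop :=
  ∀ φ : Fin 4 → Module.Dual k (V k n), plueckerRelation φ ω = 0

/-- If the coordinate `(φ, ψ)` of `ω` does not vanish, then `ω` is a multiple of the wedge product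
of its contractions with `φ` and `ψ`. -/
lemma IsDecomposable.exists_eq_wedge {ω : ⋀[k]^2 (V k n)} (h : IsDecomposable ω) :
    ∃ x y, ω = wedge k n x y := by
  by_cases h0 : ∀ φ ψ : Module.Dual k (V k n), ψ (contract φ ω) = 0
  · exact ⟨0, 0, bivector_ext fun φ ψ => by simp [h0]⟩
  push Not at h0
  obtain ⟨φ, ψ, hne⟩ := h0
  refine ⟨(ψ (contract φ ω))⁻¹ • contract φ ω, contract ψ ω, bivector_ext fun α β => ?_⟩
  have h1 := h ![φ, ψ, α, β]
  simp only [plueckerRelation, Matrix.cons_val_zero, Matrix.cons_val_one, Matrix.cons_val] at h1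
  rw [contract_wedge]
  simp only [map_smul, map_sub, smul_eq_mul]
  field_simp
  linear_combination h1

lemma exists_wedge_eq_of_combination {x y : V k n} (s t : k) (h0 : s • x + t • y ≠ 0) :
    ∃ z, wedge k n x y = wedge k n (s • x + t • y) z := by
  by_cases hs : s = 0
  · have ht : t ≠ 0 := by
      intro ht
      rw [ht] at h0
      simp [hs] at h0
    refine ⟨- t⁻¹ • x, ?_⟩
    simp [hs, ht, wedge_swap x y, smul_smul]
  · refine ⟨s⁻¹ • y, ?_⟩
    simp [hs, smul_smul]

/-- If a sum of two decomposable bivectors is decomposable, the four factors are linearly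
dependent. -/
lemma exists_combination_of_isDecomposable_add {x y z w : V k n}
    (hd : IsDecomposable (wedge k n x y + wedge k n z w)) :
    ∃ g : Fin 4 → k, g 0 • x + g 1 • y + g 2 • z + g 3 • w = 0 ∧ g ≠ 0 := by
  by_contra! hcon
  have hli : LinearIndependent k ![x, y, z, w] := by
    rw [Fintype.linearIndependent_iff]
    intro g hg i
    simp only [Fin.sum_univ_four, Matrix.cons_val_zero, Matrix.cons_val_one, Matrix.cons_val] at hg
    exact congr_fun (hcon g hg) i
  obtain ⟨δ, hδ⟩ := exists_dual_of_linearIndependent hli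
  have hx := fun i => hδ i 0
  have hy := fun i => hδ i 1
  have hz := fun i => hδ i 2
  have hw := fun i => hδ i 3
  simp only [Matrix.cons_val_zero, Matrix.cons_val_one, Matrix.cons_val] at hx hy hz hw
  have := hd δ
  simp only [plueckerRelation, map_add, contract_wedge, map_sub, map_smul, hx, hy, hz, hw] at this
  simp at this

/-- Two nonzero decomposable bivectors whose sum is decomposable share a vector. -/
lemma exists_common_vector {ω₁ ω₂ : ⋀[k]^2 (V k n)} (h₁ : ω₁ ≠ 0) (h₂ : ω₂ ≠ 0)
    (hd₁ : IsDecomposable ω₁) (hd₂ : IsDecomposable ω₂) (hd : IsDecomposable (ω₁ + ω₂)) :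
    ∃ u y z, ω₁ = wedge k n u y ∧ ω₂ = wedge k n u z := by
  obtain ⟨x, y, hω₁⟩ := hd₁.exists_eq_wedge
  obtain ⟨z, w, hω₂⟩ := hd₂.exists_eq_wedge
  rw [hω₁] at h₁ hd ⊢
  rw [hω₂] at h₂ hd ⊢
  have hxy := eq_zero_of_wedge_ne_zero h₁
  have hzw := eq_zero_of_wedge_ne_zero h₂
  obtain ⟨g, hg, hg0⟩ := exists_combination_of_isDecomposable_add hd
  have hu : g 0 • x + g 1 • y = (-g 2) • z + (-g 3) • w := by
    rw [← sub_eq_zero]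
    refine Eq.trans ?_ hg
    module
  have hne : g 0 • x + g 1 • y ≠ 0 := by
    intro h0
    obtain ⟨h1, h2⟩ := hxy _ _ h0
    obtain ⟨h3, h4⟩ := hzw _ _ (hu.symm.trans h0)
    rw [neg_eq_zero] at h3 h4
    refine hg0 (funext fun i => ?_)
    fin_cases i
    exacts [h1, h2, h3, h4]
  obtain ⟨y', hy'⟩ := exists_wedge_eq_of_combination _ _ hne
  rw [hu] at hne
  obtain ⟨z', hz'⟩ := exists_wedge_eq_of_combination _ _ hne
  rw [← hu] at hz'
  exact ⟨_, y', z', hy', hz'⟩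

/-- If `ω` and `ω + x ∧ y` are decomposable, then `ω` vanishes on linear forms killing `x` and `y`:
geometrically, the line of `ω` meets the line spanned by `x` and `y`. -/
lemma IsDecomposable.apply_eq_zero {ω : ⋀[k]^2 (V k n)} {x y : V k n} (hω : IsDecomposable ω)
    (hd : IsDecomposable (ω + wedge k n x y)) (hxy : LinearIndependent k ![x, y])
    {φ ψ : Module.Dual k (V k n)} (hφx : φ x = 0) (hφy : φ y = 0) (hψx : ψ x = 0) (hψy : ψ y = 0) :
    ψ (contract φ ω) = 0 := by
  obtain ⟨δ, hδ⟩ := exists_dual_of_linearIndependent hxy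
  have hx := fun i => hδ i 0
  have hy := fun i => hδ i 1
  simp only [Matrix.cons_val_zero, Matrix.cons_val_one] at hx hy
  have h1 := hω ![δ 0, δ 1, φ, ψ]
  have h2 := hd ![δ 0, δ 1, φ, ψ]
  simp only [plueckerRelation, Matrix.cons_val_zero, Matrix.cons_val_one, Matrix.cons_val, map_add,
    contract_wedge, map_sub, map_smul, hx, hy, hφx, hφy, hψx, hψy] at h1 h2
  simp at h1 h2
  linear_combination h2 - h1

/-- A bivector that vanishes in the exterior square of the quotient by `u` is a multiple of `u`. -/
lemma eq_wedge_of_forall_apply_eq_zero {ω : ⋀[k]^2 (V k n)} {u : V k n}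
    {δ : Module.Dual k (V k n)} (hδ : δ u = 1)
    (h : ∀ φ ψ : Module.Dual k (V k n), φ u = 0 → ψ u = 0 → ψ (contract φ ω) = 0) :
    ω = wedge k n u (contract δ ω) := by
  refine bivector_ext fun φ ψ => ?_
  have h1 := h (φ - φ u • δ) (ψ - ψ u • δ) (by simp [hδ]) (by simp [hδ])
  have h2 : contract (φ - φ u • δ) ω = contract φ ω - φ u • contract δ ω := by
    rw [sub_eq_add_neg, ← neg_one_smul k (_ • δ), contract_add, contract_smul, contract_smul,
      neg_one_smul, ← sub_eq_add_neg]
  rw [h2] at h1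
  simp only [map_sub, map_smul, LinearMap.sub_apply, LinearMap.smul_apply, contract_self,
    smul_eq_mul] at h1
  rw [contract_wedge]
  simp only [map_sub, map_smul, smul_eq_mul]
  rw [contract_antisymm φ δ] at h1
  linear_combination h1

lemma exists_mem_notMem_span_singleton {E : Type*} [AddCommGroup E] [Module k E]
    (S : Submodule k E) (h : 2 ≤ Module.finrank k S) :
    ∃ ω₁ ∈ S, ∃ ω₂ ∈ S, ω₁ ≠ 0 ∧ ω₂ ∉ Submodule.span k {ω₁} := by
  have hfin : Module.Finite k S := Module.finite_of_finrank_pos (by omega)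
  obtain ⟨ω₁, hω₁, h₁⟩ : ∃ ω₁ ∈ S, ω₁ ≠ 0 := by
    apply Submodule.exists_mem_ne_zero_of_ne_bot
    rintro rfl
    simp at h
  obtain ⟨ω₂, hω₂, h₂⟩ : ∃ ω₂ ∈ S, ω₂ ∉ Submodule.span k {ω₁} := by
    by_contra! hcon
    have := Submodule.finrank_mono (show S ≤ Submodule.span k {ω₁} from hcon)
    rw [finrank_span_singleton h₁] at this
    omega
  exact ⟨ω₁, hω₁, ω₂, hω₂, h₁, h₂⟩

lemma finrank_le_of_forall_eq_zero {E : Type*} [AddCommGroup E] [Module k E] {m : ℕ}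
    (S : Submodule k E) (L : E →ₗ[k] (Fin m → k)) (h : ∀ ω ∈ S, L ω = 0 → ω = 0) :
    Module.finrank k S ≤ m := by
  have hL : Function.Injective (L ∘ₗ S.subtype) := by
    rw [← LinearMap.ker_eq_bot, LinearMap.ker_eq_bot']
    rintro ⟨ω, hω⟩ h0
    exact Subtype.ext (h ω hω h0)
  simpa using LinearMap.finrank_le_finrank_of_injective hL

/-- A linear space of decomposable bivectors of dimension at least four consists of the multiples
of a vector. -/
lemma exists_le_range_wedge (S : Submodule k (⋀[k]^2 (V k n))) (hS : ∀ ω ∈ S, IsDecomposable ω)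
    (h4 : 4 ≤ Module.finrank k S) : ∃ v ≠ 0, S ≤ LinearMap.range (wedge k n v) := by
  obtain ⟨ω₁, hω₁, ω₂, hω₂, h₁, h₂⟩ := exists_mem_notMem_span_singleton S (by omega)
  have h₂0 : ω₂ ≠ 0 := fun h => h₂ (h ▸ zero_mem _)
  obtain ⟨u, y, z, rfl, rfl⟩ := exists_common_vector h₁ h₂0 (hS _ hω₁) (hS _ hω₂)
    (hS _ (add_mem hω₁ hω₂))
  have hu : u ≠ 0 := by rintro rfl; simp at h₁
  have hli : LinearIndependent k ![u, y, z] := by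
    rw [Fintype.linearIndependent_iff]
    intro g hg
    simp only [Fin.sum_univ_three, Matrix.cons_val_zero, Matrix.cons_val_one, Matrix.cons_val] at hg
    have hg' := congr_arg (wedge k n u) hg
    simp only [map_add, map_smul, wedge_self, smul_zero, zero_add, map_zero] at hg'
    have g2 : g 2 = 0 := by
      by_contra hne
      refine h₂ (Submodule.mem_span_singleton.mpr ⟨-(g 2)⁻¹ * g 1, ?_⟩)
      have := congr_arg ((g 2)⁻¹ • ·) hg'
      simp only [smul_add, smul_smul, inv_mul_cancel₀ hne, one_smul, smul_zero] at this
      rw [neg_mul, neg_smul, neg_eq_iff_add_eq_zero]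
      exact this
    have g1 : g 1 = 0 := by
      rw [g2, zero_smul, add_zero] at hg'
      exact (smul_eq_zero.mp hg').resolve_right h₁
    have g0 : g 0 = 0 := by
      rw [g1, g2, zero_smul, zero_smul, add_zero, add_zero] at hg
      exact (smul_eq_zero.mp hg).resolve_right hu
    intro i
    fin_cases i <;> assumption
  obtain ⟨δ, hδ⟩ := exists_dual_of_linearIndependent hli
  have hδu := fun i => hδ i 0
  have hδy := fun i => hδ i 1
  have hδz := fun i => hδ i 2
  simp only [Matrix.cons_val_zero, Matrix.cons_val_one, Matrix.cons_val] at hδu hδy hδz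
  have hy : ∀ ω ∈ S, ∀ φ ψ : Module.Dual k (V k n), φ u = 0 → φ y = 0 → ψ u = 0 → ψ y = 0 →
      ψ (contract φ ω) = 0 := fun ω hω φ ψ h1 h2 h3 h4 =>
    (hS ω hω).apply_eq_zero (hS _ (add_mem hω hω₁)) (linearIndependent_of_wedge_ne_zero h₁)
      h1 h2 h3 h4
  have hz : ∀ ω ∈ S, ∀ φ ψ : Module.Dual k (V k n), φ u = 0 → φ z = 0 → ψ u = 0 → ψ z = 0 →
      ψ (contract φ ω) = 0 := fun ω hω φ ψ h1 h2 h3 h4 =>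
    (hS ω hω).apply_eq_zero (hS _ (add_mem hω hω₂)) (linearIndependent_of_wedge_ne_zero h₂0)
      h1 h2 h3 h4
  -- the component of a linear form killing `u, y, z`
  have hsplit : ∀ φ : Module.Dual k (V k n), ∃ φ' : Module.Dual k (V k n),
      φ = φ u • δ 0 + φ y • δ 1 + φ z • δ 2 + φ' ∧ φ' u = 0 ∧ φ' y = 0 ∧ φ' z = 0 := by
    intro φ
    refine ⟨φ - (φ u • δ 0 + φ y • δ 1 + φ z • δ 2), by abel, ?_, ?_, ?_⟩ <;>
      simp [hδu, hδy, hδz]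
  -- modulo `u`, every member of `S` is a multiple of `y ∧ z`
  have hval : ∀ ω ∈ S, ∀ φ ψ : Module.Dual k (V k n), φ u = 0 → ψ u = 0 →
      ψ (contract φ ω) = (φ y * ψ z - φ z * ψ y) * δ 2 (contract (δ 1) ω) := by
    intro ω hω φ ψ hφ hψ
    obtain ⟨φ', hφ', h1, h2, h3⟩ := hsplit φ
    obtain ⟨ψ', hψ', h4, h5, h6⟩ := hsplit ψ
    have e1 : ψ' (contract φ' ω) = 0 := hy ω hω _ _ h1 h2 h4 h5
    have e2 : ψ' (contract (δ 1) ω) = 0 := hz ω hω _ _ (by simp [hδu]) (by simp [hδz]) h4 h6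
    have e3 : ψ' (contract (δ 2) ω) = 0 := hy ω hω _ _ (by simp [hδu]) (by simp [hδy]) h4 h5
    have e4 : δ 1 (contract φ' ω) = 0 := hz ω hω _ _ h1 h3 (by simp [hδu]) (by simp [hδz])
    have e5 : δ 2 (contract φ' ω) = 0 := hy ω hω _ _ h1 h2 (by simp [hδu]) (by simp [hδy])
    have e6 := contract_antisymm (δ 2) (δ 1) ω
    conv_lhs => rw [hφ', hψ']
    simp only [contract_add, contract_smul, LinearMap.add_apply, LinearMap.smul_apply, map_add,
      map_smul, hφ, hψ, zero_smul, zero_add, smul_eq_mul, e1, e2, e3, e4, e5, contract_self, e6]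
    ring
  by_cases hall : ∀ ω ∈ S, δ 2 (contract (δ 1) ω) = 0
  · refine ⟨u, hu, fun ω hω => ⟨_, (eq_wedge_of_forall_apply_eq_zero (δ := δ 0) (by simp [hδu])
      fun φ ψ hφ hψ => ?_).symm⟩⟩
    rw [hval ω hω φ ψ hφ hψ, hall ω hω, mul_zero]
  exfalso
  -- otherwise all members of `S` are bivectors of the space spanned by `u, y, z`, which has only
  -- a three-dimensional space of bivectors
  push Not at hall
  obtain ⟨ω₀, hω₀, hne⟩ := hall
  have hstep : ∀ ω ∈ S, δ 2 (contract (δ 1) ω) ≠ 0 → ∀ φ : Module.Dual k (V k n),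
      φ u = 0 → φ y = 0 → φ z = 0 → φ (contract (δ 0) ω) = 0 := by
    intro ω hω h0 φ h1 h2 h3
    have h := hS ω hω ![δ 0, φ, δ 1, δ 2]
    simp only [plueckerRelation, Matrix.cons_val_zero, Matrix.cons_val_one, Matrix.cons_val] at h
    rw [hval ω hω φ (δ 1) h1 (by simp [hδu]), hval ω hω φ (δ 2) h1 (by simp [hδu]), h2, h3] at h
    simp only [zero_mul, sub_zero, mul_zero, add_zero] at h
    exact (mul_eq_zero.mp h).resolve_right h0
  have hzero : ∀ ω ∈ S, ∀ φ : Module.Dual k (V k n),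
      φ u = 0 → φ y = 0 → φ z = 0 → φ (contract (δ 0) ω) = 0 := by
    intro ω hω φ h1 h2 h3
    by_cases h0 : δ 2 (contract (δ 1) ω) = 0
    · have := hstep (ω + ω₀) (add_mem hω hω₀) (by simpa [h0] using hne) φ h1 h2 h3
      rw [map_add, map_add, hstep ω₀ hω₀ hne φ h1 h2 h3, add_zero] at this
      exact this
    · exact hstep ω hω h0 φ h1 h2 h3
  have h3 := finrank_le_of_forall_eq_zero S (LinearMap.pi
      ![δ 1 ∘ₗ contract (δ 0), δ 2 ∘ₗ contract (δ 0), δ 2 ∘ₗ contract (δ 1)]) fun ω hω h0 => by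
    have l0 : δ 1 (contract (δ 0) ω) = 0 := congr_fun h0 0
    have l1 : δ 2 (contract (δ 0) ω) = 0 := congr_fun h0 1
    have l2 : δ 2 (contract (δ 1) ω) = 0 := congr_fun h0 2
    have hδ0 : ∀ φ : Module.Dual k (V k n), φ (contract (δ 0) ω) = 0 := by
      intro φ
      obtain ⟨φ', hφ', h1, h2, h3⟩ := hsplit φ
      rw [hφ']
      simp [l0, l1, hzero ω hω φ' h1 h2 h3]
    have hc : contract (δ 0) ω = 0 := (Module.forall_dual_apply_eq_zero_iff k _).mp hδ0
    have := eq_wedge_of_forall_apply_eq_zero (ω := ω) (u := u) (δ := δ 0) (by simp [hδu])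
      fun φ ψ hφ hψ => by rw [hval ω hω φ ψ hφ hψ, l2, mul_zero]
    rw [hc, map_zero] at this
    exact this
  omega

end Bivectors

/-! ### Automorphisms preserving decomposable bivectors -/

section Chow

variable {k : Type u} [Field k] {n : ℕ}

lemma finrank_range_wedge {v : V k n} (hv : v ≠ 0) :
    Module.finrank k (LinearMap.range (wedge k n v)) + 1 = n := by
  have h := (wedge k n v).finrank_range_add_finrank_ker
  rw [Module.finrank_fin_fun] at h
  have hker : LinearMap.ker (wedge k n v) = Submodule.span k {v} := by
    refine le_antisymm (fun w hw => ?_) ?_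
    · obtain ⟨c, rfl⟩ := exists_smul_eq_of_wedge_eq_zero hv hw
      exact Submodule.smul_mem _ _ (Submodule.mem_span_singleton_self v)
    · rw [Submodule.span_singleton_le_iff_mem]
      exact wedge_self v
  rwa [hker, finrank_span_singleton hv] at h

/-- Multiples of `x` and multiples of `y` among the bivectors meet in the line spanned by
`x ∧ y`. -/
lemma exists_eq_smul_wedge {x y u w : V k n} (hxy : wedge k n x y ≠ 0)
    (h : wedge k n x u = wedge k n y w) : ∃ c : k, wedge k n x u = c • wedge k n x y := by
  obtain ⟨δ, hδ⟩ := exists_dual_of_linearIndependent (linearIndependent_of_wedge_ne_zero hxy)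
  have h1 : δ 0 x = 1 := by simpa using hδ 0 0
  have h2 : δ 0 y = 0 := by simpa using hδ 0 1
  have h3 := congr_arg (contract (δ 0)) h
  rw [contract_wedge, contract_wedge, h1, h2, one_smul, zero_smul, zero_sub,
    sub_eq_iff_eq_add] at h3
  refine ⟨-δ 0 w, ?_⟩
  rw [h3]
  simp only [map_add, map_neg, map_smul, wedge_self, smul_zero, add_zero]
  exact (neg_smul _ _).symm

lemma wedge_eq_zero_of_range_eq {v w : V k n} (hn : 3 ≤ n)
    (h : LinearMap.range (wedge k n v) = LinearMap.range (wedge k n w)) : wedge k n v w = 0 := by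
  by_contra hne
  have hv : v ≠ 0 := by
    intro hv
    rw [hv] at hne
    simp at hne
  have hle : LinearMap.range (wedge k n v) ≤ Submodule.span k {wedge k n v w} := by
    rintro _ ⟨u, rfl⟩
    obtain ⟨z, hz⟩ : wedge k n v u ∈ LinearMap.range (wedge k n w) := h ▸ ⟨u, rfl⟩
    obtain ⟨c, hc⟩ := exists_eq_smul_wedge hne hz.symm
    rw [hc]
    exact Submodule.smul_mem _ _ (Submodule.mem_span_singleton_self _)
  have h1 := Submodule.finrank_mono hle
  rw [finrank_span_singleton hne] at h1
  have := finrank_range_wedge hv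
  omega

/-- Vectors whose wedge products span all bivectors are linearly independent: a linear form killing
all of them would give a zero contraction. -/
lemma linearIndependent_of_forall_wedge (hn : 2 ≤ n) (b : (⋀[k]^2 (V k n)) ≃ₗ[k] (⋀[k]^2 (V k n)))
    (e : Fin n → V k n) (c : Fin n → Fin n → k)
    (h : ∀ i j, b (wedge k n (Pi.single i 1) (Pi.single j 1)) = c i j • wedge k n (e i) (e j)) :
    LinearIndependent k e := by
  refine linearIndependent_of_top_le_span_of_card_eq_finrank ?_ (by simp)
  by_contra hne
  obtain ⟨φ, hφ0, hφ⟩ := Submodule.exists_le_ker_of_lt_top _ (lt_top_iff_ne_top.mpr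
    (fun h => hne h.ge))
  have hφe : ∀ i, φ (e i) = 0 := fun i => hφ (Submodule.subset_span ⟨i, rfl⟩)
  have h0 : contract φ ∘ₗ b.toLinearMap = 0 := wedge_hom_ext_single fun i j => by
    simp [h, hφe]
  obtain ⟨x, hx⟩ : ∃ x, φ x ≠ 0 := by
    by_contra! hcon
    exact hφ0 (LinearMap.ext hcon)
  have hspan : (⊤ : Submodule k (V k n)) ≤ Submodule.span k {x} := by
    intro y _
    have h1 := DFunLike.congr_fun h0 (b.symm (wedge k n x y))
    rw [LinearMap.comp_apply, LinearEquiv.coe_coe, LinearEquiv.apply_symm_apply, contract_wedge,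
      LinearMap.zero_apply, sub_eq_zero] at h1
    refine Submodule.mem_span_singleton.mpr ⟨(φ x)⁻¹ * φ y, ?_⟩
    rw [mul_smul, ← h1, smul_smul, inv_mul_cancel₀ hx, one_smul]
  have h2 := Submodule.finrank_mono hspan
  rw [finrank_top, Module.finrank_fin_fun] at h2
  have := h2.trans (finrank_span_le_card {x})
  simp at this
  omega

/-- **Chow's theorem** for the Grassmannian of lines: a linear automorphism of the bivectors
preserving the decomposable ones is, up to a scalar, induced by a linear automorphism of the
space. -/
theorem exists_linearEquiv_of_isDecomposable (hn : 5 ≤ n)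
    (b : (⋀[k]^2 (V k n)) ≃ₗ[k] (⋀[k]^2 (V k n)))
    (hb : ∀ x y, IsDecomposable (b (wedge k n x y))) :
    ∃ (a : V k n ≃ₗ[k] V k n) (μ : k), μ ≠ 0 ∧
      ∀ x y, b (wedge k n x y) = μ • wedge k n (a x) (a y) := by
  -- the multiples of `v` have dimension `n - 1 ≥ 4`, so they are mapped to those of some `v'`
  have hex : ∀ v : V k n, v ≠ 0 → ∃ v' ≠ 0,
      (LinearMap.range (wedge k n v)).map b.toLinearMap = LinearMap.range (wedge k n v') := by
    intro v hv
    have h1 := finrank_range_wedge hv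
    have h2 := LinearEquiv.finrank_map_eq b (LinearMap.range (wedge k n v))
    obtain ⟨v', hv', hle⟩ := exists_le_range_wedge
      ((LinearMap.range (wedge k n v)).map b.toLinearMap)
      (by rintro _ ⟨_, ⟨w, rfl⟩, rfl⟩; exact hb v w) (by omega)
    have h3 := finrank_range_wedge hv'
    exact ⟨v', hv', Submodule.eq_of_le_of_finrank_le hle (by omega)⟩
  have hmem : ∀ {v v' : V k n}, (LinearMap.range (wedge k n v)).map b.toLinearMap =
      LinearMap.range (wedge k n v') → ∀ w, ∃ u, wedge k n v' u = b (wedge k n v w) := by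
    intro v v' h w
    have : b (wedge k n v w) ∈ LinearMap.range (wedge k n v') := h ▸ ⟨_, ⟨w, rfl⟩, rfl⟩
    exact this
  have hindep : ∀ {v w v' w' : V k n}, v' ≠ 0 → w' ≠ 0 →
      (LinearMap.range (wedge k n v)).map b.toLinearMap = LinearMap.range (wedge k n v') →
      (LinearMap.range (wedge k n w)).map b.toLinearMap = LinearMap.range (wedge k n w') →
      wedge k n v w ≠ 0 → wedge k n v' w' ≠ 0 := by
    intro v w v' w' hv' hw' h1 h2 hvw h0
    obtain ⟨c, rfl⟩ := exists_smul_eq_of_wedge_eq_zero hv' h0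
    have hc : c ≠ 0 := by
      intro hc
      simp [hc] at hw'
    refine hvw (wedge_eq_zero_of_range_eq (by omega) ?_)
    refine Submodule.map_injective_of_injective b.injective ?_
    rw [h1, h2, map_smul, LinearMap.range_smul _ _ hc]
  -- images of the pencils through the vectors of the standard basis
  let s : Fin n → V k n := fun i => Pi.single i 1
  have hs0 : ∀ i, s i ≠ 0 := fun i => by simp [s]
  have hsind : ∀ {i j}, i ≠ j → wedge k n (s i) (s j) ≠ 0 := by
    intro i j hij h
    obtain ⟨c, hc⟩ := exists_smul_eq_of_wedge_eq_zero (hs0 i) h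
    have := congr_fun hc j
    simp [s, hij] at this
  choose! e he0 he using fun i => hex (s i) (hs0 i)
  have heind : ∀ {i j}, i ≠ j → wedge k n (e i) (e j) ≠ 0 := fun {i j} hij =>
    hindep (he0 i) (he0 j) (he i) (he j) (hsind hij)
  have hc : ∀ i j, ∃ c : k, b (wedge k n (s i) (s j)) = c • wedge k n (e i) (e j) := by
    intro i j
    by_cases hij : i = j
    · exact ⟨0, by simp [hij]⟩
    obtain ⟨u, hu⟩ := hmem (he i) (s j)
    obtain ⟨w, hw⟩ := hmem (he j) (s i)
    obtain ⟨c, hc⟩ := exists_eq_smul_wedge (u := u) (w := -w) (heind hij) (by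
      rw [hu, map_neg, hw, wedge_swap (s j) (s i), map_neg])
    exact ⟨c, by rw [← hu, hc]⟩
  choose c hc using hc
  have hli : LinearIndependent k e := linearIndependent_of_forall_wedge (by omega) b e c hc
  have hc0 : ∀ {i j}, i ≠ j → c i j ≠ 0 := by
    intro i j hij h0
    have := hc i j
    rw [h0, zero_smul, LinearEquiv.map_eq_zero_iff] at this
    exact hsind hij this
  obtain ⟨δ, hδ⟩ := exists_dual_of_linearIndependent hli
  let B := basisOfLinearIndependentOfCardEqFinrank' e hli (by simp)
  -- the pencil through the sum of the basis vectors rigidifies the scalars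
  let t : V k n := ∑ i, s i
  have htind : ∀ j, wedge k n t (s j) ≠ 0 := by
    intro j h0
    obtain ⟨i, hij⟩ : ∃ i, i ≠ j := by
      have : Nontrivial (Fin n) := Fin.nontrivial_iff_two_le.mpr (by omega)
      exact exists_ne j
    obtain ⟨r, hr⟩ := exists_smul_eq_of_wedge_eq_zero (v := s j) (w := t) (hs0 j) (by
      rw [wedge_swap, h0, neg_zero])
    have := congr_fun hr i
    simp [t, s, Finset.sum_apply, Pi.single_apply, hij] at this
  have ht0 : t ≠ 0 := by
    intro h
    have := htind ⟨0, by omega⟩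
    simp [h] at this
  obtain ⟨t', ht'0, ht'⟩ := hex t ht0
  have hd : ∀ j, ∃ d : k, ∀ i, i ≠ j → c i j = d * δ i t' := by
    intro j
    have hne := hindep ht'0 (he0 j) ht' (he j) (htind j)
    obtain ⟨u, hu⟩ := hmem ht' (s j)
    obtain ⟨w, hw⟩ := hmem (he j) t
    obtain ⟨d, hd⟩ := exists_eq_smul_wedge (u := u) (w := -w) hne (by
      rw [hu, map_neg, hw, wedge_swap (s j) t, map_neg])
    rw [hu] at hd
    have hsum : b (wedge k n t (s j)) = ∑ i, c i j • wedge k n (e i) (e j) := by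
      simp only [t, map_sum, LinearMap.sum_apply, hc]
    refine ⟨d, fun i hij => ?_⟩
    have := congr_arg (fun ω => δ j (contract (δ i) ω)) (hsum.symm.trans hd)
    simpa [contract_wedge, hδ, hij, hij.symm, Ne.symm hij, Finset.sum_ite_eq] using this
  choose d hd using hd
  have hcsymm : ∀ {i j}, i ≠ j → c i j = c j i := by
    intro i j hij
    have h1 := hc i j
    rw [wedge_swap (s j) (s i), map_neg, hc j i, wedge_swap (e i) (e j), smul_neg, neg_neg] at h1
    exact (smul_left_injective k (heind hij) h1).symm
  have ht'δ : ∀ i, δ i t' ≠ 0 := by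
    intro i h0
    obtain ⟨j, hij⟩ : ∃ j, j ≠ i := by
      have : Nontrivial (Fin n) := Fin.nontrivial_iff_two_le.mpr (by omega)
      exact exists_ne i
    refine hc0 hij.symm ?_
    rw [hd j i hij.symm, h0, mul_zero]
  -- `c i j = d j * δ i t'` is symmetric in `i` and `j`, so `d j` is proportional to `δ j t'`
  let i₀ : Fin n := ⟨0, by omega⟩
  let μ := d i₀ / δ i₀ t'
  have hdμ : ∀ i, d i = μ * δ i t' := by
    intro i
    by_cases hi : i = i₀
    · subst hi
      simp only [μ]
      field_simp [ht'δ i₀]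
    · have h1 := hcsymm hi
      rw [hd _ _ hi, hd _ _ (Ne.symm hi)] at h1
      simp only [μ]
      field_simp [ht'δ i₀]
      linear_combination -h1
  have hcμ : ∀ i j, i ≠ j → c i j = μ * (δ i t' * δ j t') := by
    intro i j hij
    rw [hd _ _ hij, hdμ]
    ring
  -- rescale the basis `e` by the coordinates of `t'`
  refine ⟨(Pi.basisFun k (Fin n)).equiv
    (B.unitsSMul fun i => Units.mk0 (δ i t') (ht'δ i)) (Equiv.refl _), μ, ?_, ?_⟩
  · intro hμ
    have h1 : i₀ ≠ ⟨1, by omega⟩ := by simp [i₀]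
    exact hc0 h1 (by rw [hcμ _ _ h1, hμ, zero_mul])
  · have ha : ∀ i, (Pi.basisFun k (Fin n)).equiv
        (B.unitsSMul fun i => Units.mk0 (δ i t') (ht'δ i)) (Equiv.refl _) (s i) = δ i t' • e i := by
      intro i
      have := (Pi.basisFun k (Fin n)).equiv_apply i
        (B.unitsSMul fun i => Units.mk0 (δ i t') (ht'δ i)) (Equiv.refl _)
      simpa [s, B, Module.Basis.unitsSMul_apply, Units.smul_def] using this
    set a := (Pi.basisFun k (Fin n)).equiv
      (B.unitsSMul fun i => Units.mk0 (δ i t') (ht'δ i)) (Equiv.refl _) with ha_def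
    have hbil : (wedge k n).compr₂ b.toLinearMap =
        μ • (wedge k n).compl₁₂ a.toLinearMap a.toLinearMap :=
      LinearMap.ext_basis (Pi.basisFun k (Fin n)) (Pi.basisFun k (Fin n)) fun i j => by
        have h1 := hc i j
        simp only [LinearMap.compr₂_apply, Pi.basisFun_apply, LinearEquiv.coe_coe,
          LinearMap.smul_apply, LinearMap.compl₁₂_apply]
        change b (wedge k n (s i) (s j)) = μ • wedge k n (a (s i)) (a (s j))
        by_cases hij : i = j
        · simp [hij]
        rw [h1, ha, ha, hcμ i j hij]
        simp [smul_smul, mul_comm]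
    intro x y
    exact congr_fun (congr_arg DFunLike.coe (DFunLike.congr_fun hbil x)) y

end Chow

/-! ### Base change of points of Grassmannians -/

section BaseChange

open Module Module.Grassmannian TensorProduct.AlgebraTensorModule

variable {k : Type u} [Field k] {M : Type u} [AddCommGroup M] [Module k M] {c : ℕ}
  {A B : Type u} [CommRing A] [Algebra k A] [CommRing B] [Algebra k B] (f : A →ₐ[k] B)

/-- Extension of scalars of vectors along `f : A → B`. -/
noncomputable def extendScalars (M : Type u) [AddCommGroup M] [Module k M] :
    A ⊗[k] M →ₗ[k] B ⊗[k] M :=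
  TensorProduct.map f.toLinearMap LinearMap.id

@[simp]
lemma extendScalars_tmul (a : A) (m : M) : extendScalars f M (a ⊗ₜ m) = f a ⊗ₜ m := rfl

lemma cancelBaseChange_tmul_eq [Algebra A B] [IsScalarTower k A B] (hf : algebraMap A B = f)
    (b : B) (x : A ⊗[k] M) :
    cancelBaseChange k A B B M (b ⊗ₜ x) = b • extendScalars f M x := by
  induction x using TensorProduct.induction_on with
  | zero => simp
  | tmul a m =>
    have : algebraMap A B a = f a := by rw [hf]; rfl
    rw [cancelBaseChange_tmul, extendScalars_tmul, TensorProduct.smul_tmul', Algebra.smul_def, this,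
      smul_eq_mul, mul_comm]
  | add x y hx hy => rw [TensorProduct.tmul_add, map_add, hx, hy, map_add, smul_add]

lemma baseChangeMkQ_extendScalars [Algebra A B] [IsScalarTower k A B] (hf : algebraMap A B = f)
    (N : Submodule A (A ⊗[k] M)) (x : A ⊗[k] M) :
    baseChangeMkQ B N (extendScalars f M x) = 1 ⊗ₜ N.mkQ x := by
  have h := cancelBaseChange_tmul_eq f hf 1 x
  rw [one_smul] at h
  rw [← h, baseChangeMkQ, LinearMap.comp_apply, LinearEquiv.coe_coe, LinearEquiv.symm_apply_apply,
    LinearMap.baseChange_tmul]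

/-- A point of a Grassmannian over `A` is base changed to `B` by extending scalars of its vectors
and taking their span. -/
lemma toSubmodule_map_eq_span (N : G(c, A ⊗[k] M; A)) :
    (Module.Grassmannian.map f N).toSubmodule =
      Submodule.span B (extendScalars f M '' N.toSubmodule) := by
  let _ : Algebra A B := f.toAlgebra
  have : IsScalarTower k A B :=
    IsScalarTower.of_algebraMap_eq' <| IsScalarTower.algebraMap_eq k A B
  rw [map_toSubmodule]
  refine le_antisymm (fun z hz => ?_) (Submodule.span_le.mpr ?_)
  · have hex : Function.Exact (LinearMap.lTensor B N.toSubmodule.subtype)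
        (LinearMap.lTensor B N.toSubmodule.mkQ) :=
      lTensor_exact B (LinearMap.exact_subtype_mkQ _) (Submodule.mkQ_surjective _)
    have hz' : LinearMap.lTensor B N.toSubmodule.mkQ ((cancelBaseChange k A B B M).symm z) = 0 := hz
    obtain ⟨w, hw⟩ := (hex _).mp hz'
    rw [← (LinearEquiv.eq_symm_apply _).mp hw]
    clear hw hz hz'
    induction w using TensorProduct.induction_on with
    | zero => simp
    | tmul b x =>
      rw [LinearMap.lTensor_tmul, cancelBaseChange_tmul_eq f rfl]
      exact Submodule.smul_mem _ _ (Submodule.subset_span ⟨_, x.2, rfl⟩)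
    | add x y hx hy =>
      rw [map_add, map_add]
      exact add_mem hx hy
  · rintro _ ⟨x, hx, rfl⟩
    rw [SetLike.mem_coe, LinearMap.mem_ker, baseChangeMkQ_extendScalars f rfl]
    rw [Submodule.mkQ_apply, (Submodule.Quotient.mk_eq_zero _).mpr hx, TensorProduct.tmul_zero]

/-- Two points of a Grassmannian over `A` agree if they agree over all localizations of `A` at
maximal ideals. -/
lemma eq_of_forall_map_localization (N₁ N₂ : G(c, A ⊗[k] M; A))
    (h : ∀ (p : Ideal A) [p.IsMaximal],
      Module.Grassmannian.map (IsScalarTower.toAlgHom k A (Localization.AtPrime p)) N₁ =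
      Module.Grassmannian.map (IsScalarTower.toAlgHom k A (Localization.AtPrime p)) N₂) :
    N₁ = N₂ := by
  have key : ∀ N₁ N₂ : G(c, A ⊗[k] M; A), (∀ (p : Ideal A) [p.IsMaximal],
      Module.Grassmannian.map (IsScalarTower.toAlgHom k A (Localization.AtPrime p)) N₁ =
      Module.Grassmannian.map (IsScalarTower.toAlgHom k A (Localization.AtPrime p)) N₂) →
      N₁.toSubmodule ≤ N₂.toSubmodule := by
    intro N₁ N₂ h x hx
    rw [← Submodule.Quotient.mk_eq_zero]
    refine Module.eq_zero_of_localization_maximal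
      (fun p _ => Localization.AtPrime p ⊗[A] ((A ⊗[k] M) ⧸ N₂.toSubmodule))
      (fun p _ => TensorProduct.mk A (Localization.AtPrime p) _ 1) _ fun p hp => ?_
    have h1 : extendScalars (IsScalarTower.toAlgHom k A (Localization.AtPrime p)) M x ∈
        (Module.Grassmannian.map (IsScalarTower.toAlgHom k A (Localization.AtPrime p))
          N₁).toSubmodule := by
      rw [toSubmodule_map_eq_span]
      exact Submodule.subset_span ⟨x, hx, rfl⟩
    rw [h p] at h1
    have h2 : baseChangeMkQ (Localization.AtPrime p) N₂.toSubmodule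
        (extendScalars (IsScalarTower.toAlgHom k A (Localization.AtPrime p)) M x) = 0 := by
      rw [toSubmodule_map_eq_span] at h1
      refine (Submodule.span_le (p := (baseChangeMkQ (Localization.AtPrime p)
        N₂.toSubmodule).ker)).mpr ?_ h1
      rintro _ ⟨y, hy, rfl⟩
      rw [SetLike.mem_coe, LinearMap.mem_ker, baseChangeMkQ_extendScalars _ rfl,
        Submodule.mkQ_apply, (Submodule.Quotient.mk_eq_zero _).mpr hy, TensorProduct.tmul_zero]
    rwa [baseChangeMkQ_extendScalars _ rfl] at h2
  exact Module.Grassmannian.ext (le_antisymm (key N₁ N₂ h) (key N₂ N₁ fun p _ => (h p).symm))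

variable {M' : Type u} [AddCommGroup M'] [Module k M']

/-- The isomorphism of Grassmannians induced by a linear isomorphism. -/
noncomputable def grassmannianMap (e : M ≃ₗ[k] M') (N : G(c, A ⊗[k] M; A)) :
    G(c, A ⊗[k] M'; A) :=
  let q : ((A ⊗[k] M) ⧸ N.toSubmodule) ≃ₗ[A]
      ((A ⊗[k] M') ⧸ N.toSubmodule.map (e.toLinearMap.baseChange A)) :=
    Submodule.Quotient.equiv _ _ (e.baseChange k A M M') rfl
  { toSubmodule := N.toSubmodule.map (e.toLinearMap.baseChange A)
    finite_quotient := Module.Finite.equiv q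
    projective_quotient := Module.Projective.of_equiv q
    rankAtStalk_eq := fun p => by
      rw [← Module.rankAtStalk_eq_of_equiv q]
      exact N.rankAtStalk_eq p }

lemma extendScalars_baseChange (e : M →ₗ[k] M') (x : A ⊗[k] M) :
    extendScalars f M' (e.baseChange A x) = e.baseChange B (extendScalars f M x) := by
  induction x using TensorProduct.induction_on with
  | zero => simp
  | tmul a m => simp
  | add x y hx hy => simp only [map_add, hx, hy]

lemma map_grassmannianMap (e : M ≃ₗ[k] M') (N : G(c, A ⊗[k] M; A)) :
    Module.Grassmannian.map f (grassmannianMap e N) =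
      grassmannianMap e (Module.Grassmannian.map f N) := by
  apply Module.Grassmannian.ext
  change _ = Submodule.map _ (Module.Grassmannian.map f N).toSubmodule
  rw [toSubmodule_map_eq_span, toSubmodule_map_eq_span, Submodule.map_span]
  congr 1
  ext z
  simp only [grassmannianMap, Submodule.map_coe, Set.image_image, extendScalars_baseChange]

lemma grassmannianMap_symm_grassmannianMap (e : M ≃ₗ[k] M') (N : G(c, A ⊗[k] M; A)) :
    grassmannianMap e.symm (grassmannianMap e N) = N := by
  apply Module.Grassmannian.ext
  change (N.toSubmodule.map (e.toLinearMap.baseChange A)).map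
    (e.symm.toLinearMap.baseChange A) = N.toSubmodule
  rw [← Submodule.map_comp, ← LinearMap.baseChange_comp]
  simp

end BaseChange

/-! ### Vectors with coordinates in an algebra -/

section Coordinates

open MvPolynomial

variable {k : Type u} [Field k] {n : ℕ} {A B : Type u} [CommRing A] [Algebra k A] [CommRing B]
  [Algebra k B]

/-- The vector of `A ⊗ k ^ n` with coordinates `x`. -/
noncomputable def vec (k : Type u) [Field k] [Algebra k A] (n : ℕ) :
    (Fin n → A) ≃ₗ[A] A ⊗[k] V k n :=
  (TensorProduct.piScalarRight k A A (Fin n)).symm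

lemma vec_apply (x : Fin n → A) : vec k n x = ∑ i, x i ⊗ₜ[k] (Pi.single i 1 : V k n) := by
  conv_lhs => rw [← Finset.univ_sum_single x]
  rw [map_sum]
  exact Finset.sum_congr rfl fun i _ => TensorProduct.piScalarRight_symm_single ..

lemma exists_vec (z : A ⊗[k] V k n) : ∃ x, vec k n x = z := (vec k n).surjective z

lemma evalForm_vec (f : MvPolynomial (Fin n) k) (x : Fin n → A) :
    evalForm f (vec k n x) = aeval x f := by
  rw [evalForm]
  congr 2
  exact (vec k n).symm_apply_apply x

lemma extendScalars_vec (φ : A →ₐ[k] B) (x : Fin n → A) :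
    extendScalars φ (V k n) (vec k n x) = vec k n (φ ∘ x) := by
  simp [vec_apply]

lemma extendScalars_smul (φ : A →ₐ[k] B) (a : A) (z : A ⊗[k] V k n) :
    extendScalars φ (V k n) (a • z) = φ a • extendScalars φ (V k n) z := by
  induction z using TensorProduct.induction_on with
  | zero => simp
  | tmul b m => simp [TensorProduct.smul_tmul']
  | add x y hx hy => simp only [smul_add, map_add, hx, hy]

/-- The submodule of `A ⊗ k ^ n` spanned by two vectors given by their coordinates. -/
noncomputable def spanPair (k : Type u) [Field k] [Algebra k A] (x y : Fin n → A) :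
    Submodule A (A ⊗[k] V k n) :=
  Submodule.span A {vec k n x, vec k n y}

lemma vec_mem_spanPair_iff {x y z : Fin n → A} :
    vec k n z ∈ spanPair k x y ↔ ∃ s t : A, s • x + t • y = z := by
  rw [spanPair, Submodule.mem_span_pair]
  simp only [← map_smul, ← map_add, EmbeddingLike.apply_eq_iff_eq]

lemma span_extendScalars_spanPair (φ : A →ₐ[k] B) (x y : Fin n → A) :
    Submodule.span B (extendScalars φ (V k n) '' spanPair k x y) =
      spanPair k (φ ∘ x) (φ ∘ y) := by
  refine le_antisymm (Submodule.span_le.mpr ?_) (Submodule.span_le.mpr ?_)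
  · rintro _ ⟨z, hz, rfl⟩
    obtain ⟨s, t, rfl⟩ := Submodule.mem_span_pair.mp hz
    simp only [map_add, extendScalars_smul, extendScalars_vec]
    exact Submodule.mem_span_pair.mpr ⟨_, _, rfl⟩
  · rintro _ (rfl | rfl)
    · exact Submodule.subset_span ⟨_, Submodule.subset_span (Or.inl rfl), extendScalars_vec φ x⟩
    · exact Submodule.subset_span ⟨_, Submodule.subset_span (Or.inr rfl), extendScalars_vec φ y⟩

lemma baseChange_vec (a : V k n →ₗ[k] V k n) (x : Fin n → A) :
    a.baseChange A (vec k n x) =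
      vec k n fun i => ∑ j, algebraMap k A (a (Pi.single j 1) i) * x j := by
  rw [vec_apply, map_sum, vec_apply]
  simp only [LinearMap.baseChange_tmul, TensorProduct.sum_tmul]
  rw [Finset.sum_comm]
  refine Finset.sum_congr rfl fun j _ => ?_
  conv_lhs => rw [← Finset.univ_sum_single (a (Pi.single j 1)), TensorProduct.tmul_sum]
  refine Finset.sum_congr rfl fun i _ => ?_
  have : (Pi.single i (a (Pi.single j 1) i) : V k n) =
      a (Pi.single j 1) i • (Pi.single i 1 : V k n) := by
    rw [← Pi.single_smul, smul_eq_mul, mul_one]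
  rw [this, TensorProduct.tmul_smul, TensorProduct.smul_tmul', Algebra.smul_def]

end Coordinates

/-! ### Bivectors over an algebra -/

section ExteriorSquare

variable {k : Type u} [Field k] {n : ℕ} {A B : Type u} [CommRing A] [Algebra k A] [CommRing B]
  [Algebra k B]

lemma baseChange_wedge_swap (x y : A ⊗[k] V k n) :
    (wedge k n).baseChange A y x = - (wedge k n).baseChange A x y := by
  induction x using TensorProduct.induction_on with
  | zero => simp
  | add x x' hx hx' => simp only [map_add, LinearMap.add_apply, hx, hx', neg_add]
  | tmul a v =>
    induction y using TensorProduct.induction_on with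
    | zero => simp
    | add y y' hy hy' => simp only [map_add, LinearMap.add_apply, hy, hy', neg_add]
    | tmul b w =>
      rw [LinearMap.BilinMap.baseChange_tmul, LinearMap.BilinMap.baseChange_tmul, wedge_swap v w,
        TensorProduct.tmul_neg, mul_comm]

lemma baseChange_wedge_self (x : A ⊗[k] V k n) : (wedge k n).baseChange A x x = 0 := by
  induction x using TensorProduct.induction_on with
  | zero => simp
  | add x x' hx hx' =>
    simp only [map_add, LinearMap.add_apply, hx, hx', baseChange_wedge_swap x x', zero_add,
      add_zero]
    exact neg_add_cancel _
  | tmul a v => rw [LinearMap.BilinMap.baseChange_tmul, wedge_self, TensorProduct.tmul_zero]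

lemma pluecker_spanPair (x y : Fin n → A) : pluecker (spanPair k x y) =
    Submodule.span A {(wedge k n).baseChange A (vec k n x) (vec k n y)} := by
  rw [pluecker, spanPair, Submodule.map₂_span_span]
  refine le_antisymm (Submodule.span_le.mpr ?_) (Submodule.span_le.mpr ?_)
  · rintro _ ⟨u, (rfl | rfl), v, (rfl | rfl), rfl⟩
    · simp [baseChange_wedge_self]
    · exact Submodule.mem_span_singleton_self _
    · simp only [baseChange_wedge_swap (vec k n x) (vec k n y)]
      exact neg_mem (Submodule.mem_span_singleton_self _)
    · simp [baseChange_wedge_self]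
  · rintro _ rfl
    exact Submodule.subset_span ⟨_, Or.inl rfl, _, Or.inr rfl, rfl⟩

/-- Extension of scalars of a linear form on the exterior square. -/
noncomputable def extendForm (A : Type u) [CommRing A] [Algebra k A]
    (θ : (⋀[k]^2 (V k n)) →ₗ[k] k) : A ⊗[k] (⋀[k]^2 (V k n)) →ₗ[A] A :=
  (TensorProduct.AlgebraTensorModule.rid k A A).toLinearMap ∘ₗ θ.baseChange A

@[simp]
lemma extendForm_tmul (θ : (⋀[k]^2 (V k n)) →ₗ[k] k) (a : A) (ω : ⋀[k]^2 (V k n)) :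
    extendForm A θ (a ⊗ₜ ω) = algebraMap k A (θ ω) * a := by
  simp [extendForm, Algebra.smul_def]

lemma extendForm_baseChange (θ : (⋀[k]^2 (V k n)) →ₗ[k] k)
    (b : (⋀[k]^2 (V k n)) →ₗ[k] (⋀[k]^2 (V k n))) (z : A ⊗[k] (⋀[k]^2 (V k n))) :
    extendForm A θ (b.baseChange A z) = extendForm A (θ ∘ₗ b) z := by
  induction z using TensorProduct.induction_on with
  | zero => simp
  | tmul a m => simp
  | add x y hx hy => simp only [map_add, hx, hy]

/-- The value at `x ∧ y` of a linear form on the exterior square, as a bilinear function of the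
coordinates. -/
noncomputable def evalWedge (θ : (⋀[k]^2 (V k n)) →ₗ[k] k) (x y : Fin n → A) : A :=
  ∑ i, ∑ j, algebraMap k A (θ (wedge k n (Pi.single i 1) (Pi.single j 1))) * (x i * y j)

lemma extendForm_wedge (θ : (⋀[k]^2 (V k n)) →ₗ[k] k) (x y : Fin n → A) :
    extendForm A θ ((wedge k n).baseChange A (vec k n x) (vec k n y)) = evalWedge θ x y := by
  simp only [vec_apply, map_sum, LinearMap.sum_apply, LinearMap.BilinMap.baseChange_tmul,
    extendForm_tmul, evalWedge]
  exact Finset.sum_comm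

lemma evalWedge_self (θ : (⋀[k]^2 (V k n)) →ₗ[k] k) (x : Fin n → A) : evalWedge θ x x = 0 := by
  rw [← extendForm_wedge, baseChange_wedge_self, map_zero]

lemma evalWedge_add_self (θ : (⋀[k]^2 (V k n)) →ₗ[k] k) (x y : Fin n → A) :
    evalWedge θ x (y + x) = evalWedge θ x y := by
  rw [← extendForm_wedge, map_add, map_add, map_add, baseChange_wedge_self, map_zero, add_zero,
    extendForm_wedge]

lemma evalWedge_smul (θ : (⋀[k]^2 (V k n)) →ₗ[k] k) (r : A) (x y : Fin n → A) :
    evalWedge θ (r • x) y = r * evalWedge θ x y := by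
  rw [← extendForm_wedge, map_smul, map_smul, LinearMap.smul_apply, map_smul, extendForm_wedge,
    smul_eq_mul]

lemma map_evalWedge (φ : A →ₐ[k] B) (θ : (⋀[k]^2 (V k n)) →ₗ[k] k) (x y : Fin n → A) :
    φ (evalWedge θ x y) = evalWedge θ (φ ∘ x) (φ ∘ y) := by
  simp [evalWedge]

lemma evalWedge_eq (θ : (⋀[k]^2 (V k n)) →ₗ[k] k) (x y : V k n) :
    evalWedge θ x y = θ (wedge k n x y) := by
  have hx : ∀ x : V k n, vec k n x = (1 : k) ⊗ₜ x := by
    intro x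
    rw [vec_apply]
    conv_rhs => rw [← Finset.univ_sum_single x, TensorProduct.tmul_sum]
    refine Finset.sum_congr rfl fun i _ => ?_
    have : (Pi.single i (x i) : V k n) = x i • (Pi.single i 1 : V k n) := by
      rw [← Pi.single_smul, smul_eq_mul, mul_one]
    rw [this, TensorProduct.tmul_smul, TensorProduct.smul_tmul', smul_eq_mul, mul_one]
  rw [← extendForm_wedge, hx, hx, LinearMap.BilinMap.baseChange_tmul, extendForm_tmul]
  simp

/-- Extension of scalars of a linear form. -/
noncomputable def evalDual (φ : Module.Dual k (V k n)) (x : Fin n → A) : A :=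
  ∑ i, algebraMap k A (φ (Pi.single i 1)) * x i

lemma evalWedge_contract (φ ψ : Module.Dual k (V k n)) (x y : Fin n → A) :
    evalWedge (ψ ∘ₗ contract φ) x y =
      evalDual φ x * evalDual ψ y - evalDual φ y * evalDual ψ x := by
  simp only [evalWedge, evalDual, LinearMap.comp_apply, contract_wedge, map_sub, map_smul,
    smul_eq_mul, map_mul, Finset.sum_mul_sum]
  rw [Finset.sum_comm (f := fun i j => algebraMap k A (φ (Pi.single i 1)) * y i *
    (algebraMap k A (ψ (Pi.single j 1)) * x j)), ← Finset.sum_sub_distrib]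
  refine Finset.sum_congr rfl fun i _ => ?_
  rw [← Finset.sum_sub_distrib]
  exact Finset.sum_congr rfl fun j _ => by ring

lemma evalDual_proj (i : Fin n) (x : Fin n → A) :
    evalDual (LinearMap.proj i : Module.Dual k (V k n)) x = x i := by
  simp [evalDual, Pi.single_apply]

/-- The Plücker relation of four linear forms evaluated at the image under `b` of `x ∧ y`. -/
noncomputable def wedgeRelation (φ : Fin 4 → Module.Dual k (V k n))
    (b : (⋀[k]^2 (V k n)) →ₗ[k] (⋀[k]^2 (V k n))) (x y : Fin n → A) : A :=
  evalWedge ((φ 1 ∘ₗ contract (φ 0)) ∘ₗ b) x y * evalWedge ((φ 3 ∘ₗ contract (φ 2)) ∘ₗ b) x y -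
    evalWedge ((φ 2 ∘ₗ contract (φ 0)) ∘ₗ b) x y * evalWedge ((φ 3 ∘ₗ contract (φ 1)) ∘ₗ b) x y +
    evalWedge ((φ 3 ∘ₗ contract (φ 0)) ∘ₗ b) x y * evalWedge ((φ 2 ∘ₗ contract (φ 1)) ∘ₗ b) x y

lemma wedgeRelation_eq_zero (φ : Fin 4 → Module.Dual k (V k n))
    (b : (⋀[k]^2 (V k n)) →ₗ[k] (⋀[k]^2 (V k n))) {x y x' y' : Fin n → A} {c : A}
    (h : b.baseChange A ((wedge k n).baseChange A (vec k n x) (vec k n y)) =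
      c • (wedge k n).baseChange A (vec k n x') (vec k n y')) :
    wedgeRelation φ b x y = 0 := by
  have key : ∀ θ : (⋀[k]^2 (V k n)) →ₗ[k] k,
      evalWedge (θ ∘ₗ b) x y = c * evalWedge θ x' y' := by
    intro θ
    rw [← extendForm_wedge, ← extendForm_baseChange, h, map_smul, extendForm_wedge, smul_eq_mul]
  simp only [wedgeRelation, key, evalWedge_contract]
  ring

end ExteriorSquare

/-! ### Points of Grassmannians over local rings -/

section LocalRings

open MvPolynomial Module.Grassmannian

variable {k : Type u} [Field k] {d : ℕ} {A : Type u} [CommRing A] [Algebra k A]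

/-- The Plücker coordinates of the span of two vectors. -/
def minor {n : ℕ} (x y : Fin n → A) (i j : Fin n) : A := x i * y j - x j * y i

/-- A vector all of whose `3 × 3` minors with the pair `(x, y)` vanish lies in the span, by Cramer's
rule. -/
lemma vec_mem_spanPair_of_minors {n : ℕ} {x y v : Fin n → A} {i j : Fin n}
    (hij : IsUnit (minor x y i j))
    (h : ∀ l, v l * minor x y i j - v i * minor x y l j + v j * minor x y l i = 0) :
    vec k n v ∈ spanPair k x y := by
  obtain ⟨u, hu⟩ := hij.exists_left_inv
  refine vec_mem_spanPair_iff.mpr ⟨u * (v i * y j - v j * y i), u * (x i * v j - x j * v i), ?_⟩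
  ext l
  have := h l
  simp only [minor, Pi.add_apply, Pi.smul_apply, smul_eq_mul] at this hu ⊢
  linear_combination -u * this + v l * hu

lemma minors_eq_zero_of_vec_mem_spanPair {n : ℕ} {x y v : Fin n → A}
    (h : vec k n v ∈ spanPair k x y) (l i j : Fin n) :
    v l * minor x y i j - v i * minor x y l j + v j * minor x y l i = 0 := by
  obtain ⟨s, t, rfl⟩ := vec_mem_spanPair_iff.mp h
  simp only [minor, Pi.add_apply, Pi.smul_apply, smul_eq_mul]
  ring

/-- Two vectors with an invertible Plücker coordinate span a point of the Grassmannian: a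
complement is spanned by the other vectors of the standard basis. -/
lemma exists_grassmannian_spanPair [Nontrivial A] {x y : Fin (d + 2) → A} {i j : Fin (d + 2)}
    (hij : IsUnit (minor x y i j)) :
    ∃ N : G(d, A ⊗[k] V k (d + 2); A), N.toSubmodule = spanPair k x y := by
  classical
  have hne : i ≠ j := by
    rintro rfl
    simp [minor] at hij
  obtain ⟨u, hu⟩ := hij.exists_left_inv
  let κ := {l : Fin (d + 2) // l ≠ i ∧ l ≠ j}
  have hκ : Fintype.card κ = d := by
    rw [Fintype.card_subtype]
    have : (Finset.univ.filter fun l : Fin (d + 2) => l ≠ i ∧ l ≠ j) = ({i, j} : Finset _)ᶜ := by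
      ext l; simp
    rw [this, Finset.card_compl, Finset.card_pair hne]
    simp
  -- the projection along the span
  let P : (Fin (d + 2) → A) →ₗ[A] (κ → A) := LinearMap.pi fun l =>
    LinearMap.proj l.1 - (u * minor x y l j) • LinearMap.proj i +
      (u * minor x y l i) • LinearMap.proj j
  have hP : ∀ v l, P v l = v l - u * minor x y l j * v i + u * minor x y l i * v j := by
    intro v l; simp [P]
  let Q := P ∘ₗ (vec k (d + 2)).symm.toLinearMap
  have hsurj : Function.Surjective Q := by
    refine Function.Surjective.comp (g := P) (fun w => ?_) (vec k (d + 2)).symm.surjective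
    refine ⟨fun l => if h : l ≠ i ∧ l ≠ j then w ⟨l, h⟩ else 0, ?_⟩
    ext l
    rw [hP]
    simp [l.2.1, l.2.2]
  have hker : LinearMap.ker Q = spanPair k x y := by
    ext z
    obtain ⟨v, rfl⟩ := exists_vec z
    have hQ : Q (vec k (d + 2) v) = P v := by simp [Q]
    rw [LinearMap.mem_ker, hQ]
    refine ⟨fun h => ?_, fun h => ?_⟩
    · refine vec_mem_spanPair_of_minors hij fun l => ?_
      by_cases hl : l ≠ i ∧ l ≠ j
      · have h1 := congr_fun h ⟨l, hl⟩
        rw [hP, Pi.zero_apply] at h1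
        linear_combination minor x y i j * h1 + (v i * minor x y l j - v j * minor x y l i) * hu
      · rw [not_and_or, not_not, not_not] at hl
        rcases hl with rfl | rfl <;> simp only [minor] <;> ring
    · ext l
      rw [hP, Pi.zero_apply]
      linear_combination u * minors_eq_zero_of_vec_mem_spanPair h l i j - v l * hu
  let e : ((A ⊗[k] V k (d + 2)) ⧸ spanPair k x y) ≃ₗ[A] (κ → A) :=
    (Submodule.quotEquivOfEq _ _ hker.symm).trans (Q.quotKerEquivOfSurjective hsurj)
  refine ⟨⟨spanPair k x y, Module.Finite.equiv e.symm, Module.Projective.of_equiv e.symm,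
    fun p => ?_⟩, rfl⟩
  rw [Module.rankAtStalk_eq_of_equiv e, Module.rankAtStalk_eq_finrank_of_free]
  simp [hκ]

/-- Over a local ring, every rank two direct summand is spanned by two vectors with an invertible
Plücker coordinate. -/
lemma exists_eq_spanPair [IsLocalRing A] (N : G(d, A ⊗[k] V k (d + 2); A)) :
    ∃ x y : Fin (d + 2) → A, N.toSubmodule = spanPair k x y ∧ ∃ i j, IsUnit (minor x y i j) := by
  set M := A ⊗[k] V k (d + 2)
  have hfreeM : Module.Free A M := inferInstance
  have hfinM : Module.Finite A M := inferInstance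
  have hrM : Module.finrank A M = d + 2 := by
    rw [← (vec (A := A) k (d + 2)).finrank_eq, Module.finrank_fin_fun]
  obtain ⟨s, hs⟩ := Module.projective_lifting_property N.toSubmodule.mkQ LinearMap.id
    (Submodule.mkQ_surjective _)
  have hfreeQ : Module.Free A (M ⧸ N.toSubmodule) := Module.free_of_flat_of_isLocalRing
  have hrQ : Module.finrank A (M ⧸ N.toSubmodule) = d := by
    have := N.rankAtStalk_eq (IsLocalRing.closedPoint A)
    rwa [Module.rankAtStalk_eq_finrank_of_free] at this
  -- a retraction onto the summand
  let r : M →ₗ[A] N.toSubmodule := (LinearMap.id - s ∘ₗ N.toSubmodule.mkQ).codRestrict _ fun z => by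
    rw [← Submodule.Quotient.mk_eq_zero]
    have := DFunLike.congr_fun hs (N.toSubmodule.mkQ z)
    simp only [LinearMap.comp_apply, LinearMap.id_apply] at this
    change N.toSubmodule.mkQ (z - s (N.toSubmodule.mkQ z)) = 0
    rw [map_sub, this, sub_self]
  have hr : r ∘ₗ N.toSubmodule.subtype = LinearMap.id := by
    ext z
    have : N.toSubmodule.mkQ z.1 = 0 := (Submodule.Quotient.mk_eq_zero _).mpr z.2
    simp [r, -Submodule.mkQ_apply, this]
  have hrsurj : Function.Surjective r := fun z => ⟨z, DFunLike.congr_fun hr z⟩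
  have hfinN : Module.Finite A N.toSubmodule := Module.Finite.of_surjective r hrsurj
  have hprojN : Module.Projective A N.toSubmodule := Module.Projective.of_split _ r hr
  have hfreeN : Module.Free A N.toSubmodule :=
    Module.free_of_flat_of_isLocalRing (P := N.toSubmodule)
  have hrN : Module.finrank A N.toSubmodule = 2 := by
    let e : M ≃ₗ[A] N.toSubmodule × (M ⧸ N.toSubmodule) := LinearEquiv.ofLinearMap
      (r.prod N.toSubmodule.mkQ) (N.toSubmodule.subtype.coprod s) (by
        have hrs : r ∘ₗ s = 0 := by
          ext z
          have := DFunLike.congr_fun hs z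
          simp only [LinearMap.comp_apply, LinearMap.id_apply] at this
          simp [r, -Submodule.mkQ_apply, this]
        refine LinearMap.prod_ext ?_ ?_
        · ext z
          · simpa using congr_arg Subtype.val (DFunLike.congr_fun hr z)
          · simp
        · refine LinearMap.ext fun z => Prod.ext ?_ ?_
          · simpa using DFunLike.congr_fun hrs z
          · simpa using DFunLike.congr_fun hs z) (by
        ext z
        simp [r])
    have := e.finrank_eq
    rw [hrM, Module.finrank_prod, hrQ] at this
    omega
  let β := Module.finBasisOfFinrankEq A N.toSubmodule hrN
  obtain ⟨x, hx⟩ := exists_vec (β 0).1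
  obtain ⟨y, hy⟩ := exists_vec (β 1).1
  refine ⟨x, y, ?_, ?_⟩
  · have h1 := congr_arg (Submodule.map N.toSubmodule.subtype) β.span_eq
    rw [Submodule.map_span, Submodule.map_top, Submodule.range_subtype] at h1
    rw [← h1, spanPair, hx, hy]
    congr 1
    ext z
    simp [Fin.exists_fin_two, eq_comm]
  · -- the minors generate the unit ideal, as the summand has a retraction
    let ρ : Fin 2 → (Fin (d + 2) → A) →ₗ[A] A := fun a =>
      β.coord a ∘ₗ r ∘ₗ (vec k (d + 2)).toLinearMap
    have hρ : ∀ a b, ρ a (![x, y] b) = if b = a then 1 else 0 := by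
      intro a b
      have h1 : r (vec k (d + 2) (![x, y] b)) = β b := by
        have : vec k (d + 2) (![x, y] b) = (β b).1 := by
          fin_cases b
          · exact hx
          · exact hy
        rw [this]
        exact DFunLike.congr_fun hr (β b)
      simp only [ρ, LinearMap.comp_apply, LinearEquiv.coe_coe, h1, Module.Basis.coord_apply,
        Module.Basis.repr_self, Finsupp.single_apply]
    have hexp : ∀ a (v : Fin (d + 2) → A), ρ a v = ∑ i, v i * ρ a (Pi.single i 1) := by
      intro a v
      conv_lhs => rw [← Finset.univ_sum_single v, map_sum]
      refine Finset.sum_congr rfl fun i _ => ?_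
      have : (Pi.single i (v i) : Fin (d + 2) → A) = v i • Pi.single i 1 := by
        rw [← Pi.single_smul, smul_eq_mul, mul_one]
      rw [this, map_smul, smul_eq_mul]
    by_contra! hcon
    have hmem : ∑ i, ∑ j, ρ 0 (Pi.single i 1) * ρ 1 (Pi.single j 1) * minor x y i j ∈
        IsLocalRing.maximalIdeal A :=
      Ideal.sum_mem _ fun i _ => Ideal.sum_mem _ fun j _ => Ideal.mul_mem_left _ _ (hcon i j)
    have h00 : ρ 0 x = 1 := by simpa using hρ 0 0
    have h01 : ρ 0 y = 0 := by simpa using hρ 0 1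
    have h10 : ρ 1 x = 0 := by simpa using hρ 1 0
    have h11 : ρ 1 y = 1 := by simpa using hρ 1 1
    have hone : ∑ i, ∑ j, ρ 0 (Pi.single i 1) * ρ 1 (Pi.single j 1) * minor x y i j =
        ρ 0 x * ρ 1 y - ρ 0 y * ρ 1 x := by
      rw [hexp 0 x, hexp 1 y, hexp 0 y, hexp 1 x, Finset.sum_mul_sum, Finset.sum_mul_sum,
        ← Finset.sum_sub_distrib]
      refine Finset.sum_congr rfl fun i _ => ?_
      rw [← Finset.sum_sub_distrib]
      refine Finset.sum_congr rfl fun j _ => ?_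
      simp only [minor]
      ring
    rw [hone, h00, h01, h10, h11] at hmem
    simp at hmem

/-- The plane is recovered from its Plücker coordinates as the set of vectors satisfying the linear
relations `v_l p_ij - v_i p_lj + v_j p_li = 0`. -/
lemma spanPair_le_of_pluecker_eq {n : ℕ} {x y x' y' : Fin n → A} {i j : Fin n}
    (hij : IsUnit (minor x' y' i j))
    (h : pluecker (spanPair k x' y') ≤ pluecker (spanPair k x y)) :
    spanPair k x y ≤ spanPair k x' y' := by
  rw [pluecker_spanPair, pluecker_spanPair, Submodule.span_singleton_le_iff_mem,
    Submodule.mem_span_singleton] at h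
  obtain ⟨c, hc⟩ := h
  have hminor : ∀ a b, minor x' y' a b = c * minor x y a b := by
    intro a b
    have := congr_arg (extendForm A ((LinearMap.proj b : Module.Dual k (V k n)) ∘ₗ
      contract (LinearMap.proj a))) hc
    rw [map_smul, extendForm_wedge, extendForm_wedge, evalWedge_contract,
      evalWedge_contract] at this
    simp only [evalDual_proj, smul_eq_mul] at this
    simp only [minor]
    linear_combination -this
  have key : ∀ v, vec k n v ∈ spanPair k x y → vec k n v ∈ spanPair k x' y' := fun v hv =>
    vec_mem_spanPair_of_minors hij fun l => by
      rw [hminor, hminor, hminor]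
      linear_combination c * minors_eq_zero_of_vec_mem_spanPair hv l i j
  intro z hz
  obtain ⟨v, rfl⟩ := exists_vec z
  exact key v hz

/-- The Plücker embedding is injective on points over local rings. -/
lemma eq_of_pluecker_eq [IsLocalRing A] {N N' : G(d, A ⊗[k] V k (d + 2); A)}
    (h : pluecker N.toSubmodule = pluecker N'.toSubmodule) : N = N' := by
  obtain ⟨x, y, hN, i, j, hij⟩ := exists_eq_spanPair N
  obtain ⟨x', y', hN', i', j', hij'⟩ := exists_eq_spanPair N'
  rw [hN, hN'] at h
  apply Module.Grassmannian.ext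
  rw [hN, hN']
  exact le_antisymm (spanPair_le_of_pluecker_eq hij' h.ge) (spanPair_le_of_pluecker_eq hij h.le)

/-- A cubic form vanishes on the span of `x` and `y`, and on all its base changes, as soon as its
four coefficients on the span vanish. -/
lemma mem_linearSubspaces_of_spanPair {f : MvPolynomial (Fin (d + 2)) k} (hf : f.IsHomogeneous 3)
    (A : CommAlgCat.{u} k) (N : G(d, A ⊗[k] V k (d + 2); A)) {x y : Fin (d + 2) → A}
    (hN : N.toSubmodule = spanPair k x y) (h0 : aeval x f = 0) (h1 : dirDeriv f x y = 0)
    (h2 : dirDeriv f y x = 0) (h3 : aeval y f = 0) :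
    N ∈ (linearSubspaces f d).obj A := by
  intro B φ z hz
  change z ∈ (Module.Grassmannian.map φ.hom N).toSubmodule at hz
  rw [toSubmodule_map_eq_span, hN, span_extendScalars_spanPair] at hz
  obtain ⟨v, rfl⟩ := exists_vec z
  obtain ⟨s, t, rfl⟩ := vec_mem_spanPair_iff.mp hz
  have h0' : aeval (φ.hom ∘ x) f = 0 := by
    have := congr_arg φ.hom h0
    rwa [comp_aeval_apply, map_zero] at this
  have h3' : aeval (φ.hom ∘ y) f = 0 := by
    have := congr_arg φ.hom h3
    rwa [comp_aeval_apply, map_zero] at this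
  have h1' : dirDeriv f (φ.hom ∘ x) (φ.hom ∘ y) = 0 := by
    rw [← map_dirDeriv, h1, map_zero]
  have h2' : dirDeriv f (φ.hom ∘ y) (φ.hom ∘ x) = 0 := by
    rw [← map_dirDeriv, h2, map_zero]
  rw [evalForm_vec, aeval_add_of_cubic hf, h0', h1', h2', h3']
  ring

end LocalRings

/-! ### Isomorphisms of schemes of linear subspaces -/

section LinearSubspaces

open MvPolynomial Module.Grassmannian

variable {k : Type u} [Field k] {n c : ℕ} {f f' : MvPolynomial (Fin n) k}

lemma grassmannianMap_mem_linearSubspaces (a : V k n ≃ₗ[k] V k n)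
    (h : ∀ (A : CommAlgCat.{u} k) (z : A ⊗[k] V k n), evalForm f z = 0 →
      evalForm f' (a.toLinearMap.baseChange A z) = 0)
    {A : CommAlgCat.{u} k} {N : G(c, A ⊗[k] V k n; A)} (hN : N ∈ (linearSubspaces f c).obj A) :
    grassmannianMap a N ∈ (linearSubspaces f' c).obj A := by
  intro B φ z hz
  change z ∈ (Module.Grassmannian.map φ.hom (grassmannianMap a N)).toSubmodule at hz
  rw [map_grassmannianMap] at hz
  obtain ⟨w, hw, rfl⟩ := hz
  exact h B w (hN B φ w hw)

/-- The isomorphism between the schemes of linear subspaces of two projectively equivalent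
hypersurfaces. -/
noncomputable def linearSubspacesIso (a : V k n ≃ₗ[k] V k n)
    (h : ∀ (A : CommAlgCat.{u} k) (z : A ⊗[k] V k n),
      evalForm f' (a.toLinearMap.baseChange A z) = 0 ↔ evalForm f z = 0) :
    (linearSubspaces f c).toFunctor ≅ (linearSubspaces f' c).toFunctor :=
  NatIso.ofComponents (fun A => Equiv.toIso
    { toFun := fun L => ⟨grassmannianMap a L.1,
        grassmannianMap_mem_linearSubspaces a (fun A z => (h A z).mpr) L.2⟩
      invFun := fun L => ⟨grassmannianMap a.symm L.1,
        grassmannianMap_mem_linearSubspaces a.symm (fun A z hz => (h A _).mp (by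
          rw [← LinearMap.comp_apply, ← LinearMap.baseChange_comp]
          simpa using hz)) L.2⟩
      left_inv := fun L => Subtype.ext (grassmannianMap_symm_grassmannianMap a L.1)
      right_inv := fun L => Subtype.ext (grassmannianMap_symm_grassmannianMap a.symm L.1) })
    (fun {A B} φ => by
      ext L
      exact Subtype.ext (map_grassmannianMap φ.hom a L.1).symm)

lemma isInducedBy_linearSubspacesIso (a : V k n ≃ₗ[k] V k n)
    (h : ∀ (A : CommAlgCat.{u} k) (z : A ⊗[k] V k n),
      evalForm f' (a.toLinearMap.baseChange A z) = 0 ↔ evalForm f z = 0) :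
    IsInducedBy (linearSubspacesIso (c := c) a h) a := fun _ _ => rfl

lemma baseChange_wedge_eq_smul {b : (⋀[k]^2 (V k n)) ≃ₗ[k] (⋀[k]^2 (V k n))}
    {a : V k n ≃ₗ[k] V k n} {μ : k} (h : ∀ x y, b (wedge k n x y) = μ • wedge k n (a x) (a y))
    {A : Type u} [CommRing A] [Algebra k A] (u v : A ⊗[k] V k n) :
    b.toLinearMap.baseChange A ((wedge k n).baseChange A u v) =
      algebraMap k A μ • (wedge k n).baseChange A (a.toLinearMap.baseChange A u)
        (a.toLinearMap.baseChange A v) := by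
  induction u using TensorProduct.induction_on with
  | zero => simp
  | add x x' hx hx' => simp only [map_add, LinearMap.add_apply, hx, hx', smul_add]
  | tmul r x =>
    induction v using TensorProduct.induction_on with
    | zero => simp
    | add y y' hy hy' => simp only [map_add, hy, hy', smul_add]
    | tmul s y =>
      simp only [LinearMap.BilinMap.baseChange_tmul, LinearMap.baseChange_tmul,
        LinearEquiv.coe_coe, h]
      rw [algebraMap_smul, TensorProduct.tmul_smul]

lemma map_pluecker {b : (⋀[k]^2 (V k n)) ≃ₗ[k] (⋀[k]^2 (V k n))}
    {a : V k n ≃ₗ[k] V k n} {μ : k} (hμ : μ ≠ 0)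
    (h : ∀ x y, b (wedge k n x y) = μ • wedge k n (a x) (a y))
    {A : Type u} [CommRing A] [Algebra k A] (L : Submodule A (A ⊗[k] V k n)) :
    (pluecker L).map (b.toLinearMap.baseChange A) =
      pluecker (L.map (a.toLinearMap.baseChange A)) := by
  refine le_antisymm ?_ ?_
  · rw [Submodule.map_le_iff_le_comap, pluecker, Submodule.map₂_le]
    intro u hu v hv
    rw [Submodule.mem_comap, baseChange_wedge_eq_smul h]
    exact Submodule.smul_mem _ _ (Submodule.apply_mem_map₂ _ ⟨u, hu, rfl⟩ ⟨v, hv, rfl⟩)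
  · rw [pluecker, Submodule.map₂_le]
    rintro _ ⟨u, hu, rfl⟩ _ ⟨v, hv, rfl⟩
    have h1 := baseChange_wedge_eq_smul h u v
    have h2 : (wedge k n).baseChange A (a.toLinearMap.baseChange A u)
        (a.toLinearMap.baseChange A v) = algebraMap k A μ⁻¹ •
          b.toLinearMap.baseChange A ((wedge k n).baseChange A u v) := by
      rw [h1, smul_smul, ← map_mul, inv_mul_cancel₀ hμ, map_one, one_smul]
    rw [h2]
    exact Submodule.smul_mem _ _ ⟨_, Submodule.apply_mem_map₂ _ hu hv, rfl⟩

end LinearSubspaces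

/-! ### Reduction to local rings -/

section Induced

open MvPolynomial Module.Grassmannian

variable {k : Type u} [Field k] {d : ℕ} {f f' : MvPolynomial (Fin (d + 2)) k}

/-- If `b` is a multiple of the exterior square of `a`, then on points over local rings the
isomorphism with Plücker map `b` is given by `a`. -/
lemma eq_grassmannianMap_of_isLocalRing
    (g : (linearSubspaces f d).toFunctor ≅ (linearSubspaces f' d).toFunctor)
    {b : (⋀[k]^2 (V k (d + 2))) ≃ₗ[k] (⋀[k]^2 (V k (d + 2)))}
    (hg : ∀ (A : CommAlgCat.{u} k) (L : (linearSubspaces f d).toFunctor.obj A),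
      pluecker (g.hom.app A L).1.toSubmodule =
        (pluecker L.1.toSubmodule).map (b.toLinearMap.baseChange A))
    {a : V k (d + 2) ≃ₗ[k] V k (d + 2)} {μ : k} (hμ : μ ≠ 0)
    (h : ∀ x y, b (wedge k (d + 2) x y) = μ • wedge k (d + 2) (a x) (a y))
    (A : CommAlgCat.{u} k) [IsLocalRing A] (L : (linearSubspaces f d).toFunctor.obj A) :
    (g.hom.app A L).1 = grassmannianMap a L.1 :=
  eq_of_pluecker_eq ((hg A L).trans (map_pluecker hμ h _))

/-- An isomorphism of schemes of lines is induced by a linear automorphism if this holds on points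
over local rings. -/
lemma isInducedBy_of_isLocalRing
    (g : (linearSubspaces f d).toFunctor ≅ (linearSubspaces f' d).toFunctor)
    (a : V k (d + 2) ≃ₗ[k] V k (d + 2))
    (hloc : ∀ (A : CommAlgCat.{u} k) [IsLocalRing A]
      (L : (linearSubspaces f d).toFunctor.obj A),
      (g.hom.app A L).1 = grassmannianMap a L.1) :
    IsInducedBy g a := by
  intro A L
  suffices hs : (g.hom.app A L).1 = grassmannianMap a L.1 by rw [hs]; rfl
  refine eq_of_forall_map_localization _ _ fun p hp => ?_
  let φ : A ⟶ CommAlgCat.of k (Localization.AtPrime p) :=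
    CommAlgCat.ofHom (IsScalarTower.toAlgHom k A (Localization.AtPrime p))
  have : IsLocalRing (CommAlgCat.of k (Localization.AtPrime p)) :=
    (inferInstance : IsLocalRing (Localization.AtPrime p))
  have h1 := hloc (CommAlgCat.of k (Localization.AtPrime p))
    ((linearSubspaces f d).toFunctor.map φ L)
  rw [NatTrans.naturality_apply g.hom φ L] at h1
  exact h1.trans (map_grassmannianMap φ.hom a L.1).symm

end Induced

/-! ### The universal line over a local ring -/

section UniversalPoint

open MvPolynomial Module.Grassmannian

variable {k : Type u} [Field k]

lemma dirDeriv_map {K A : Type*} [Field K] [CommRing A] [Algebra k K] [Algebra K A]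
    [Algebra k A] [IsScalarTower k K A] {n : ℕ} (f : MvPolynomial (Fin n) k) (x y : Fin n → A) :
    dirDeriv (map (algebraMap k K) f) x y = dirDeriv f x y := by
  simp only [dirDeriv, pderiv_map, aeval_map_algebraMap]

/-- The universal pair of vectors spanning a line in `F = 0`, over the local ring of the scheme of
such pairs at a prime where the pair is linearly independent. -/
lemma exists_universal_localPoint (k : Type u) [Field k] {K : Type u} [Field K] [Algebra k K]
    {n : ℕ} (F : MvPolynomial (Fin n) K)
    (p : Ideal (PairRing K n)) [p.IsPrime] (hp : ∀ j, lineEqs F j ∈ p) {i j : Fin n}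
    (hij : pairMinor K i j ∉ p) :
    ∃ (A : Type u) (_ : CommRing A) (_ : Algebra k A) (_ : Algebra K A) (_ : IsScalarTower k K A)
      (_ : IsLocalRing A) (x y : Fin n → A), (∀ j, aeval (Sum.elim x y) (lineEqs F j) = 0) ∧
      IsUnit (minor x y i j) ∧ ∀ Q : PairRing K n, aeval (Sum.elim x y) Q = 0 →
        ∃ s ∉ p, s * Q ∈ Ideal.span (Set.range (lineEqs F)) := by
  let R := Localization.AtPrime p
  let I := Ideal.span (Set.range (lineEqs F))
  let J : Ideal R := I.map (algebraMap (PairRing K n) R)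
  have hJ : J ≠ ⊤ := by
    have h1 : I ≤ p := Ideal.span_le.mpr (by rintro _ ⟨j, rfl⟩; exact hp j)
    have h2 : J ≤ IsLocalRing.maximalIdeal R := by
      rw [← Localization.AtPrime.map_eq_maximalIdeal]
      exact Ideal.map_mono h1
    exact fun h => (IsLocalRing.maximalIdeal.isMaximal R).ne_top (top_le_iff.mp (h ▸ h2))
  have hnt : Nontrivial (R ⧸ J) := Ideal.Quotient.nontrivial_iff.mpr hJ
  have hloc : IsLocalRing (R ⧸ J) :=
    IsLocalRing.of_surjective' (Ideal.Quotient.mk J) Ideal.Quotient.mk_surjective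
  let π : PairRing K n →ₐ[K] R ⧸ J :=
    (Ideal.Quotient.mkₐ K J).comp (IsScalarTower.toAlgHom K (PairRing K n) R)
  let x : Fin n → R ⧸ J := fun i => π (X (.inl i))
  let y : Fin n → R ⧸ J := fun i => π (X (.inr i))
  have hπ : ∀ Q, aeval (Sum.elim x y) Q = π Q := by
    intro Q
    refine DFunLike.congr_fun (algHom_ext (f := aeval (Sum.elim x y)) (g := π) ?_) Q
    rintro (i | i) <;> simp [x, y]
  refine ⟨R ⧸ J, inferInstance, inferInstance, inferInstance, inferInstance, hloc, x, y,
    fun j => ?_, ?_, fun Q hQ => ?_⟩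
  · rw [hπ]
    exact Ideal.Quotient.eq_zero_iff_mem.mpr
      (Ideal.mem_map_of_mem _ (Ideal.subset_span ⟨j, rfl⟩))
  · have h1 : minor x y i j = π (pairMinor K i j) := by
      simp only [minor, x, y, pairMinor, fstVec, sndVec, map_sub, map_mul]
    rw [h1]
    exact (IsLocalization.map_units R (⟨_, hij⟩ : p.primeCompl)).map (Ideal.Quotient.mk J)
  · rw [hπ] at hQ
    have h1 : algebraMap (PairRing K n) R Q ∈ J := Ideal.Quotient.eq_zero_iff_mem.mp hQ
    obtain ⟨s, hs, hsQ⟩ :=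
      (IsLocalization.algebraMap_mem_map_algebraMap_iff p.primeCompl R I Q).mp h1
    exact ⟨s, hs, hsQ⟩

/-- The form obtained from `f'` by the linear substitution `a`. -/
noncomputable def pullback {n : ℕ} (a : V k n →ₗ[k] V k n) (f' : MvPolynomial (Fin n) k) :
    MvPolynomial (Fin n) k :=
  aeval (fun i => ∑ j, C (a (Pi.single j 1) i) * X j : Fin n → MvPolynomial (Fin n) k) f'

lemma isHomogeneous_pullback {n m : ℕ} (a : V k n →ₗ[k] V k n) {f' : MvPolynomial (Fin n) k}
    (hf' : f'.IsHomogeneous m) : (pullback a f').IsHomogeneous m := by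
  have := hf'.aeval (fun i => ∑ j, C (a (Pi.single j 1) i) * X j : Fin n → MvPolynomial (Fin n) k)
    (n := 1) fun i => IsHomogeneous.sum _ _ _ fun j _ => by
      simpa using (isHomogeneous_C (Fin n) _).mul (isHomogeneous_X k j)
  rwa [one_mul] at this

lemma evalForm_baseChange {n : ℕ} (a : V k n →ₗ[k] V k n) (f' : MvPolynomial (Fin n) k)
    {A : Type u} [CommRing A] [Algebra k A] (x : Fin n → A) :
    evalForm f' (a.baseChange A (vec k n x)) = aeval x (pullback a f') := by
  rw [baseChange_vec, evalForm_vec, pullback, comp_aeval_apply]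
  simp

end UniversalPoint

/-! ### From the lines to the hypersurface -/

section Final

open MvPolynomial Module.Grassmannian

variable {k : Type u} [Field k]

/-- A geometric form of isolated singularities: up to scalars there are finitely many singular
vectors. -/
lemma HasIsolatedSingularities.exists_finset {n : ℕ} {f : MvPolynomial (Fin n) k}
    (hf : f.IsHomogeneous 3) (hs : HasIsolatedSingularities f) :
    ∃ T : Finset (Fin n → AlgebraicClosure k), (∀ s ∈ T, s ≠ 0) ∧
      ∀ u : Fin n → AlgebraicClosure k, u ≠ 0 →
        (∀ i, aeval u (pderiv i (map (algebraMap k (AlgebraicClosure k)) f)) = 0) →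
        aeval u (map (algebraMap k (AlgebraicClosure k)) f) = 0 →
        ∃ s ∈ T, ∃ c : AlgebraicClosure k, u = c • s := by
  classical
  have hfin : (geometricSingularPoints f).Finite := hs
  refine ⟨hfin.toFinset.image Projectivization.rep, ?_, fun u hu h1 h2 => ?_⟩
  · intro s hs
    obtain ⟨p, -, rfl⟩ := Finset.mem_image.mp hs
    exact p.rep_nonzero
  · obtain ⟨a, ha⟩ := Projectivization.exists_smul_eq_mk_rep (AlgebraicClosure k) u hu
    refine ⟨_, Finset.mem_image.mpr ⟨Projectivization.mk _ u hu, ?_, rfl⟩,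
      ((a⁻¹ : (AlgebraicClosure k)ˣ) : AlgebraicClosure k), ?_⟩
    · rw [Set.Finite.mem_toFinset]
      rw [aeval_map_algebraMap] at h2
      refine ⟨?_, fun i => ?_⟩
      · rw [← ha, Units.smul_def, aeval_smul_of_isHomogeneous hf, h2, mul_zero]
      · have := h1 i
        rw [pderiv_map, aeval_map_algebraMap] at this
        rw [← ha, Units.smul_def, aeval_smul_of_isHomogeneous (hf.pderiv (i := i)), this, mul_zero]
    · rw [← ha, ← Units.smul_def, inv_smul_smul]

lemma isHomogeneous_evalWedge {K : Type u} [Field K] [Algebra k K] {n : ℕ}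
    (θ : (⋀[k]^2 (V k n)) →ₗ[k] k) :
    (evalWedge θ (fstVec K n) (sndVec K n)).IsHomogeneous 2 := by
  refine IsHomogeneous.sum _ _ _ fun i _ => IsHomogeneous.sum _ _ _ fun j _ => ?_
  rw [IsScalarTower.algebraMap_apply k K (PairRing K n)]
  have := (isHomogeneous_C (Fin n ⊕ Fin n) (algebraMap k K (θ (wedge k n (Pi.single i 1)
    (Pi.single j 1))))).mul ((isHomogeneous_X K (.inl i : Fin n ⊕ Fin n)).mul
      (isHomogeneous_X K (.inr j)))
  simpa [fstVec, sndVec] using this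

lemma isHomogeneous_wedgeRelation {K : Type u} [Field K] [Algebra k K] {n : ℕ}
    (φ : Fin 4 → Module.Dual k (V k n)) (b : (⋀[k]^2 (V k n)) →ₗ[k] (⋀[k]^2 (V k n))) :
    (wedgeRelation φ b (fstVec K n) (sndVec K n)).IsHomogeneous 4 :=
  (((isHomogeneous_evalWedge _).mul (isHomogeneous_evalWedge _)).sub
    ((isHomogeneous_evalWedge _).mul (isHomogeneous_evalWedge _))).add
      ((isHomogeneous_evalWedge _).mul (isHomogeneous_evalWedge _))

lemma aeval_wedgeRelation {K A : Type u} [Field K] [Algebra k K] [CommRing A] [Algebra K A]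
    [Algebra k A] [IsScalarTower k K A] {n : ℕ} (φ : Fin 4 → Module.Dual k (V k n))
    (b : (⋀[k]^2 (V k n)) →ₗ[k] (⋀[k]^2 (V k n))) (x y : Fin n → A) :
    aeval (Sum.elim x y) (wedgeRelation φ b (fstVec K n) (sndVec K n)) = wedgeRelation φ b x y := by
  let ψ : PairRing K n →ₐ[k] A := (aeval (Sum.elim x y) : PairRing K n →ₐ[K] A).restrictScalars k
  have hx : ψ ∘ fstVec K n = x := by ext i; simp [ψ, fstVec]
  have hy : ψ ∘ sndVec K n = y := by ext i; simp [ψ, sndVec]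
  change ψ _ = _
  simp only [wedgeRelation, map_add, map_sub, map_mul, map_evalWedge, hx, hy]

variable {d : ℕ} {f f' : MvPolynomial (Fin (d + 2)) k}

/-- A polynomial which vanishes at all pairs of vectors spanning a line of `f = 0` over local
rings lies in the ideal of `lineEqs` near the origin. -/
lemma exists_mul_mem_of_forall_localPoint (hd : 3 ≤ d) (hf : IsCubicForm f)
    (hs : HasIsolatedSingularities f) (Q : PairRing (AlgebraicClosure k) (d + 2))
    (hQ : ∀ (A : Type u) [CommRing A] [Algebra k A] [Algebra (AlgebraicClosure k) A]
      [IsScalarTower k (AlgebraicClosure k) A] [IsLocalRing A] (x y : Fin (d + 2) → A)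
      (L : (linearSubspaces f d).toFunctor.obj (CommAlgCat.of k A)),
      L.1.toSubmodule = spanPair k x y → aeval (Sum.elim x y) Q = 0) :
    ∃ s : PairRing (AlgebraicClosure k) (d + 2), constantCoeff s ≠ 0 ∧
      s * Q ∈ Ideal.span (Set.range (lineEqs (map (algebraMap k (AlgebraicClosure k)) f))) := by
  set F := map (algebraMap k (AlgebraicClosure k)) f with hFdef
  obtain ⟨T, hT0, hT⟩ := hs.exists_finset hf.2
  refine exists_mul_mem_span_lineEqs (by omega) (hf.2.map _) (fun h => hf.1 ?_) T hT0 hT Q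
    fun p hp hpI ⟨i, j, hij⟩ => ?_
  · exact map_injective _ (algebraMap k (AlgebraicClosure k)).injective (h.trans (map_zero _).symm)
  · obtain ⟨A, _, _, _, _, _, x, y, h0, hu, hA⟩ := exists_universal_localPoint k F p hpI hij
    refine hA Q ?_
    obtain ⟨N, hN⟩ := exists_grassmannian_spanPair (k := k) hu
    have e0 := h0 0
    have e1 := h0 1
    have e2 := h0 2
    have e3 := h0 3
    simp only [aeval_lineEqs, hFdef, dirDeriv_map, aeval_map_algebraMap, Matrix.cons_val_zero,
      Matrix.cons_val_one, Matrix.cons_val] at e0 e1 e2 e3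
    exact hQ A x y ⟨N, mem_linearSubspaces_of_spanPair hf.2 (CommAlgCat.of k A) N hN e0 e1 e2 e3⟩ hN

/-- A linear automorphism of the bivectors inducing an isomorphism between the schemes of lines of
two cubic hypersurfaces preserves decomposable bivectors. -/
lemma isDecomposable_of_isPlueckerProjective (hk : ringChar k ≠ 3) (hd : 3 ≤ d)
    (hf : IsCubicForm f) (hs : HasIsolatedSingularities f)
    (g : (linearSubspaces f d).toFunctor ≅ (linearSubspaces f' d).toFunctor)
    (b : (⋀[k]^2 (V k (d + 2))) ≃ₗ[k] (⋀[k]^2 (V k (d + 2))))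
    (hg : ∀ (A : CommAlgCat.{u} k) (L : (linearSubspaces f d).toFunctor.obj A),
      pluecker (g.hom.app A L).1.toSubmodule =
        (pluecker L.1.toSubmodule).map (b.toLinearMap.baseChange A))
    (x y : V k (d + 2)) : IsDecomposable (b (wedge k (d + 2) x y)) := by
  intro φ
  let K := AlgebraicClosure k
  have hk3 : (3 : k) ≠ 0 := by
    intro h
    have h1 : ringChar k ∣ 3 := ringChar.dvd (by exact_mod_cast h)
    rcases (Nat.dvd_prime Nat.prime_three).mp h1 with h2 | h2
    · exact CharP.ringChar_ne_one h2
    · exact hk h2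
  have h3 : (3 : K) ≠ 0 := by
    intro h
    apply hk3
    apply (algebraMap k K).injective
    rw [map_zero, ← h, map_ofNat]
  let Q := wedgeRelation φ b.toLinearMap (fstVec K (d + 2)) (sndVec K (d + 2))
  obtain ⟨T, hT0, hT⟩ := hs.exists_finset hf.2
  obtain ⟨s, hs0, hsQ⟩ := exists_mul_mem_of_forall_localPoint hd hf hs Q
    fun A _ _ _ _ _ x y L hL => by
      rw [aeval_wedgeRelation]
      obtain ⟨x', y', hL', -⟩ := exists_eq_spanPair (g.hom.app (CommAlgCat.of k A) L).1
      have h := hg (CommAlgCat.of k A) L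
      rw [hL, hL', pluecker_spanPair, pluecker_spanPair, Submodule.map_span,
        Set.image_singleton] at h
      obtain ⟨c, hc⟩ := Submodule.mem_span_singleton.mp
        (h.ge (Submodule.mem_span_singleton_self _))
      exact wedgeRelation_eq_zero φ b.toLinearMap hc.symm
  have hval : ∀ x y : Fin (d + 2) → K, aeval (Sum.elim x y) Q = 0 :=
    aeval_eq_zero_of_mul_mem (by omega) h3 (hf.2.map _) (fun h => hf.1
      (map_injective _ (algebraMap k K).injective (h.trans (map_zero _).symm))) T hT
      (isHomogeneous_wedgeRelation φ _)
      (fun r x y => by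
        simp only [Q, aeval_wedgeRelation]
        simp only [wedgeRelation, evalWedge_smul]
        ring)
      (fun x => by
        simp only [Q, aeval_wedgeRelation]
        simp only [wedgeRelation, evalWedge_self]
        ring)
      (fun x y => by
        simp only [Q, aeval_wedgeRelation]
        simp only [wedgeRelation, evalWedge_add_self])
      hs0 hsQ
  have h1 := hval (algebraMap k K ∘ x) (algebraMap k K ∘ y)
  rw [aeval_wedgeRelation] at h1
  apply (algebraMap k K).injective
  rw [map_zero, ← h1]
  have h2 : ∀ θ : (⋀[k]^2 (V k (d + 2))) →ₗ[k] k,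
      evalWedge θ (algebraMap k K ∘ x) (algebraMap k K ∘ y) =
        algebraMap k K (θ (wedge k (d + 2) x y)) := by
    intro θ
    rw [← evalWedge_eq]
    exact (map_evalWedge (Algebra.ofId k K) θ x y).symm
  simp only [wedgeRelation, h2, plueckerRelation, map_add, map_sub, map_mul, LinearMap.comp_apply,
    LinearEquiv.coe_coe]

/-- If the scheme of lines of a cubic hypersurface `f = 0` with isolated singularities is mapped
by `a` to the scheme of lines of `f' = 0`, then `a` maps the first hypersurface to the second. -/
lemma exists_pullback_eq (hd : 3 ≤ d) (hf : IsCubicForm f) (hf' : IsCubicForm f')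
    (hs : HasIsolatedSingularities f)
    (g : (linearSubspaces f d).toFunctor ≅ (linearSubspaces f' d).toFunctor)
    {a : V k (d + 2) ≃ₗ[k] V k (d + 2)} (hga : IsInducedBy g a) :
    ∃ c : k, pullback a.toLinearMap f' = C c * f := by
  let K := AlgebraicClosure k
  obtain ⟨s, hs0, hsQ⟩ := exists_mul_mem_of_forall_localPoint hd hf hs
    (aeval (fstVec K (d + 2)) (map (algebraMap k K) (pullback a.toLinearMap f')))
    fun A _ _ _ _ _ x y L hL => by
      have hx : (fun i => (aeval (Sum.elim x y) : PairRing K (d + 2) →ₐ[K] A)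
          (fstVec K (d + 2) i)) = x := by
        ext i; simp [fstVec]
      rw [comp_aeval_apply, hx, aeval_map_algebraMap, ← evalForm_baseChange]
      refine (g.hom.app (CommAlgCat.of k A) L).2 (CommAlgCat.of k A) (𝟙 _) _ ?_
      rw [CategoryTheory.Functor.map_id]
      change _ ∈ (g.hom.app (CommAlgCat.of k A) L).1.toSubmodule
      rw [hga, hL]
      exact ⟨_, Submodule.subset_span (Or.inl rfl), rfl⟩
  obtain ⟨c, hc⟩ := exists_eq_mul_of_mul_mem (hf.2.map _)
    ((isHomogeneous_pullback a.toLinearMap hf'.2).map (algebraMap k K)) hs0 hsQ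
  -- the factor lies in `k`, as can be seen on a nonzero coefficient of `f`
  obtain ⟨m, hm⟩ := ne_zero_iff.mp hf.1
  have h1 := congr_arg (coeff m) hc
  rw [coeff_C_mul, coeff_map, coeff_map] at h1
  have hm' : algebraMap k K (coeff m f) ≠ 0 := by simpa using hm
  have h2 : c = algebraMap k K (coeff m (pullback a.toLinearMap f') / coeff m f) := by
    rw [map_div₀, h1, mul_div_assoc, div_self hm', mul_one]
  refine ⟨coeff m (pullback a.toLinearMap f') / coeff m f,
    map_injective (algebraMap k K) (algebraMap k K).injective ?_⟩
  rw [hc, h2, map_mul, map_C]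

lemma pullback_ne_zero {n : ℕ} (a : V k n ≃ₗ[k] V k n) {f' : MvPolynomial (Fin n) k}
    (hf' : f' ≠ 0) : pullback a.toLinearMap f' ≠ 0 := by
  intro h
  apply hf'
  obtain ⟨x, hx⟩ := exists_vec (a.symm.toLinearMap.baseChange (MvPolynomial (Fin n) k)
    (vec k n X))
  have h1 := evalForm_baseChange a.toLinearMap f' x
  rw [hx, h, map_zero, ← LinearMap.comp_apply, ← LinearMap.baseChange_comp] at h1
  simpa [evalForm_vec] using h1

end Final

end CubicFano

theorem proposition3p1 {k : Type u} [Field k] (hk : ringChar k ≠ 3)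
    (d : ℕ) (hd : 3 ≤ d) (f f' : MvPolynomial (Fin (d + 2)) k)
    (hf : CubicFano.IsCubicForm f) (hf' : CubicFano.IsCubicForm f')
    (hs : CubicFano.HasIsolatedSingularities f) (hs' : CubicFano.HasIsolatedSingularities f')
    (g : CubicFano.fanoOfLines f ≅ CubicFano.fanoOfLines f')
    (hg : CubicFano.IsPlueckerProjective g) :
    ∃ (a : CubicFano.V k (d + 2) ≃ₗ[k] CubicFano.V k (d + 2))
      (h : CubicFano.hypersurface f ≅ CubicFano.hypersurface f'),
      CubicFano.IsInducedBy h a ∧ CubicFano.IsInducedBy g a := by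
  obtain ⟨b, hb⟩ := hg
  obtain ⟨a, μ, hμ, ha⟩ := CubicFano.exists_linearEquiv_of_isDecomposable (by omega) b
    (CubicFano.isDecomposable_of_isPlueckerProjective hk hd hf hs g b hb)
  have hga : CubicFano.IsInducedBy g a := CubicFano.isInducedBy_of_isLocalRing g a
    fun A _ L => CubicFano.eq_grassmannianMap_of_isLocalRing g hb hμ ha A L
  obtain ⟨c, hc⟩ := CubicFano.exists_pullback_eq hd hf hf' hs g hga
  have hc0 : c ≠ 0 := by
    intro h0
    refine CubicFano.pullback_ne_zero a hf'.1 ?_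
    rw [hc, h0, MvPolynomial.C_0, zero_mul]
  have heval : ∀ (A : CommAlgCat.{u} k) (z : A ⊗[k] CubicFano.V k (d + 2)),
      CubicFano.evalForm f' (a.toLinearMap.baseChange A z) = 0 ↔ CubicFano.evalForm f z = 0 := by
    intro A z
    obtain ⟨x, rfl⟩ := CubicFano.exists_vec z
    rw [CubicFano.evalForm_baseChange, CubicFano.evalForm_vec, hc, map_mul,
      MvPolynomial.algHom_C]
    exact ((isUnit_iff_ne_zero.mpr hc0).map (algebraMap k A)).mul_right_eq_zero
  exact ⟨a, CubicFano.linearSubspacesIso a heval,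
    CubicFano.isInducedBy_linearSubspacesIso a heval, hga⟩
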